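/- **Corollary (A Discretization of the PHT).** There is an absolute constant $C$ such that the following holds. Let $K$ be a finite, nonempty geometric simplicial complex in $\mathbb{R}^d$ of dimension $\kappa<d$, with $n_0$ vertices and $n$ simplices in total, whose vertex set $K_0$ is in general position: (i) any at most $d+1$ vertices are affinely independent; (ii) no three vertices have collinear images under the orthogonal projection onto the $(e_1,e_2)$-plane (required if $d\ge 2$); (iii) the vertices have pairwise distinct heights $e_1\cdot v$. For a unit vector $s$ let $\mathrm{Dgm}(s)$ be the directional augmented persistence diagram of $K$, graded by dimension: the lower-star filter is $h_s(\sigma)=\max_{v\in\sigma}s\cdot v$; one takes the persistence diagrams (with coefficients in a fixed field) of an index filtration $\sigma_1,\dots,\sigma_n$ compatible with $h_s$, and replaces each point $(i,j)$ by $(h_s(\sigma_i),h_s(\sigma_j))$, with $h_s(\sigma_\infty)=\infty$. The Persistent Homology Transform (PHT) of $K$ is $s\mapsto\mathrm{Dgm}(s)$ on $\mathbb{S}^{d-1}$. Consider the algorithm below, which has no access to $K$ other than querying $\mathrm{Dgm}(s)$ for directions $s$ of its choice. *Tilt* of $s$ towards $s'$: the normalization of $(1-\varepsilon)s+\varepsilon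 s'$, $\varepsilon=\tfrac12\, g/(g+r')$, where $g$ is the smallest positive difference of vertex heights in direction $s$ and $r'$ the largest difference in direction $s'$ ($\varepsilon=\tfrac14$ if all heights in direction $s$ agree). *$k$-indegree* of a simplex $\sigma$ in a direction $s$ orthogonal to $\sigma$: for each nonempty $\tau\subseteq\sigma$ query the direction $s_\tau$, where $s_\sigma=s$ and, for $\tau\ne\sigma$, $s_\tau$ is the tilt of $s$ towards a direction orthogonal to $\tau$ that has the other vertices of $\sigma$ above $\tau$; let $\delta_\tau$ be the number of $k$-dimensional births plus $(k-1)$-dimensional deaths at the height of $\tau$; compute recursively $I(\tau)=\delta_\tau-\sum_{\emptyset\ne\rho\subsetneq\tau}I(\rho)$ and return $I(\sigma)$. 1. *Vertices.* Query $e_1$ and, for $2\le i\le d$, query $e_i$ and the tilt of $e_1$ towards $e_i$; solve for the coordinates from the sorted zero-dimensional births. Read $\kappa$ off $\mathrm{Dgm}(e_1)$. 2. *Edges.* Query $-e_1$. Process the vertices $v$ by increasing $e_1\cdot v$. The vertices above $v$, sorted radially around $v$ in the $(e_1,e_2)$-plane, form an interval, whose number of edges to $v$ is read off $\mathrm{Dgm}(-e_1)$.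 Discard an interval with edge count $0$; report an edge for an interval with one vertex and nonzero count; split any other interval into halves by a direction in the $(e_1,e_2)$-plane that has the first half below $v$, the second half above $v$, and no other vertex at the height of $v$. The edge count of the first half is the $1$-indegree of $v$ in this direction minus the number of already known edges from $v$ to vertices below $v$ in this direction; the second half gets the remaining edges. Process the first half before the second. 3. *Higher simplices.* For $k=2,\dots,\kappa$, each found $(k-1)$-simplex $\sigma$ and each vertex $v\notin\sigma$: let $s_1$ be orthogonal to $\sigma\cup\{v\}$, let $s_2$ be orthogonal to $\sigma\cup\{v\}$ with no other vertex at its height, let $s_*$ be the tilt of $s_1$ towards $s_2$, and let $s_3$ be orthogonal to $\sigma$ with $v$ above $\sigma$. Let $s_L$ be the tilt of $s_*$ towards $s_3$, and $s_U$ the negative of the tilt of $-s_*$ towards $s_3$. Add the simplex $\sigma\cup\{v\}$ if and only if the $k$-indegrees of $\sigma$ in the directions $s_U$ and $s_L$ differ by exactly $1$. Then, whatever rule is used to pick the directions that are only described by their properties, the algorithm returns $K$, and it queries at most $C\,(2^{\kappa}\,n\,n_0+d)$ directional augmented persistence diagrams (in particular $O(2^\kappa n n_0)$ of them for fixed $d$).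 The queried diagrams form a faithful finite discretization of the PHT of $K$: all queried directions lie on $\mathbb{S}^{d-1}$, there are finitely many, and every finite simplicial complex $K'$ in $\mathbb{R}^d$ (no further hypothesis on $K'$) with the same diagrams in all queried directions is equal to $K$. -/

import Mathlib

namespace PHTRecon

noncomputable section

open scoped InnerProductSpace

/-- The ambient space `ℝ^d`, with its Euclidean structure. -/
abbrev Pt (d : ℕ) := EuclideanSpace ℝ (Fin d)

/-- Geometric simplicial complexes in `ℝ^d`.  A simplex is recorded by its vertex set.
Finiteness of the set of simplices is stated separately where it is needed. -/
abbrev Cpx (d : ℕ) := Geometry.SimplicialComplex ℝ (Pt d)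

/-- `K` has dimension `κ`: its highest-dimensional simplices have `κ + 1` vertices. -/
def HasDim {d : ℕ} (K : Cpx d) (κ : ℕ) : Prop :=
  IsGreatest {k : ℕ | ∃ σ ∈ K.faces, σ.card = k + 1} κ

/-- The `j`-th coordinate (counted from `0`) of `x`, and `0` when `j ≥ d`. -/
def coord {d : ℕ} (x : Pt d) (j : ℕ) : ℝ := if h : j < d then x ⟨j, h⟩ else 0

/-- The `j`-th standard basis vector (counted from `0`), for `j < d`. -/
def basisVec (d : ℕ) (j : ℕ) : Pt d :=
  if h : j < d then EuclideanSpace.single ⟨j, h⟩ 1 else 0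

/-- Projection onto the plane of the first two coordinates. -/
def proj₂ {d : ℕ} (x : Pt d) : EuclideanSpace ℝ (Fin 2) := !₂[coord x 0, coord x 1]

/-- General position of a set of vertices.  The second condition refers to the plane of the first
two coordinates and is therefore only imposed when that plane exists. -/
structure GeneralPosition {d : ℕ} (V : Set (Pt d)) : Prop where
  affine_independent : ∀ S : Finset (Pt d), ↑S ⊆ V → S.card ≤ d + 1 →
    AffineIndependent ℝ ((↑) : S → Pt d)
  proj_not_collinear : 2 ≤ d → ∀ u ∈ V, ∀ v ∈ V, ∀ w ∈ V, u ≠ v → v ≠ w → u ≠ w →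
    ¬ Collinear ℝ {proj₂ u, proj₂ v, proj₂ w}
  height_injective : Set.InjOn (fun v => ⟪basisVec d 0, v⟫_ℝ) V

/-! ### Simplicial homology with coefficients in a field -/

/-- `u` precedes `v` in the lexicographic order of coordinates; this total order of the points of
`ℝ^d` is used to orient simplices. -/
def Precedes {d : ℕ} (u v : Pt d) : Prop := toLex (fun i => u i) < toLex (fun i => v i)

open scoped Classical in
/-- Boundary of a single oriented simplex (zero for a vertex, and for the empty set). -/
def simplexBoundary (F : Type*) [Field F] {d : ℕ} (σ : Finset (Pt d)) : Finset (Pt d) →₀ F :=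
  if σ.card ≤ 1 then 0
  else ∑ v ∈ σ, Finsupp.single (σ.erase v) ((-1 : F) ^ (σ.filter (fun u => Precedes u v)).card)

/-- The boundary operator. -/
def boundary (F : Type*) [Field F] (d : ℕ) :
    (Finset (Pt d) →₀ F) →ₗ[F] (Finset (Pt d) →₀ F) :=
  Finsupp.linearCombination F (simplexBoundary F)

/-- The `k`-chains of a set `L` of simplices. -/
def chains (F : Type*) [Field F] {d : ℕ} (L : Set (Finset (Pt d))) (k : ℕ) :
    Submodule F (Finset (Pt d) →₀ F) :=
  Finsupp.supported F F {σ | σ ∈ L ∧ σ.card = k + 1}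

/-- The `k`-cycles of `L`. -/
def cycles (F : Type*) [Field F] {d : ℕ} (L : Set (Finset (Pt d))) (k : ℕ) :
    Submodule F (Finset (Pt d) →₀ F) :=
  chains F L k ⊓ LinearMap.ker (boundary F d)

/-- The `k`-boundaries of `L`. -/
def boundaries (F : Type*) [Field F] {d : ℕ} (L : Set (Finset (Pt d))) (k : ℕ) :
    Submodule F (Finset (Pt d) →₀ F) :=
  (chains F L (k + 1)).map (boundary F d)

/-- For subcomplexes `L ⊆ L'`, the rank of `H_k(L) → H_k(L')`: the dimension of the space of those
classes modulo the `k`-boundaries of `L'` that are represented by `k`-cycles of `L`. -/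
def persistentBetti (F : Type*) [Field F] {d : ℕ} (L L' : Set (Finset (Pt d))) (k : ℕ) : ℕ :=
  Module.finrank F ((cycles F L k).map (boundaries F L' k).mkQ)

/-! ### Lower-star filtrations and augmented persistence diagrams -/

/-- The lower-star filter function in direction `s`: the largest height of a vertex. -/
def lowerStar {d : ℕ} (s : Pt d) (σ : Finset (Pt d)) : ℝ :=
  if h : σ.Nonempty then σ.sup' h (fun v => ⟪s, v⟫_ℝ) else 0

/-- The list `l` enumerates the simplices in `L`, each once, with nondecreasing values of `f` and
with every simplex after its proper faces.  In other words, `l` is an index filtration that is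
compatible with `f`. -/
def IsIndexFiltration {d : ℕ} (L : Set (Finset (Pt d))) (f : Finset (Pt d) → ℝ)
    (l : List (Finset (Pt d))) : Prop :=
  l.Nodup ∧ (∀ σ, σ ∈ l ↔ σ ∈ L) ∧ l.Pairwise (fun σ τ => f σ ≤ f τ ∧ ¬ τ ⊂ σ)

/-- A monotone filter function on a finite set of simplices has a compatible index filtration. -/
theorem exists_isIndexFiltration {d : ℕ} {L : Set (Finset (Pt d))} (hL : L.Finite)
    {f : Finset (Pt d) → ℝ} (hf : ∀ σ ∈ L, ∀ τ ∈ L, τ ⊆ σ → f τ ≤ f σ) :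
    ∃ l, IsIndexFiltration L f l := by
  classical
  let le : Finset (Pt d) → Finset (Pt d) → Bool :=
    fun σ τ => decide (f σ < f τ ∨ (f σ = f τ ∧ σ.card ≤ τ.card))
  refine ⟨hL.toFinset.toList.mergeSort le, ?_, ?_, ?_⟩
  · exact (List.mergeSort_perm _ _).nodup_iff.2 (Finset.nodup_toList _)
  · intro σ; simp
  · have h := List.pairwise_mergeSort (le := le)
      (by
        intro a b c hab hbc
        simp only [le, decide_eq_true_eq] at *
        rcases hab with h | ⟨h, h'⟩ <;> rcases hbc with g | ⟨g, g'⟩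
        · exact Or.inl (h.trans g)
        · exact Or.inl (g ▸ h)
        · exact Or.inl (h ▸ g)
        · exact Or.inr ⟨h.trans g, h'.trans g'⟩)
      (by
        intro a b
        simp only [le, Bool.or_eq_true, decide_eq_true_eq]
        rcases lt_trichotomy (f a) (f b) with h | h | h
        · exact Or.inl (Or.inl h)
        · rcases le_total a.card b.card with g | g
          · exact Or.inl (Or.inr ⟨h, g⟩)
          · exact Or.inr (Or.inr ⟨h.symm, g⟩)
        · exact Or.inr (Or.inl h))
      hL.toFinset.toList
    refine h.imp_of_mem ?_
    intro σ τ hσ hτ hle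
    simp only [List.mem_mergeSort, Finset.mem_toList, Set.Finite.mem_toFinset] at hσ hτ
    simp only [le, decide_eq_true_eq] at hle
    refine ⟨by rcases hle with h | h <;> linarith [h], fun hlt => ?_⟩
    have h1 := hf σ hσ τ hτ hlt.subset
    have h2 := Finset.card_lt_card hlt
    rcases hle with h | ⟨_, h⟩
    · linarith
    · omega

/-- The lower-star filter function is monotone along faces. -/
theorem lowerStar_mono {d : ℕ} (s : Pt d) {σ τ : Finset (Pt d)} (hτ : τ.Nonempty) (h : τ ⊆ σ) :
    lowerStar s τ ≤ lowerStar s σ := by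
  have hσ : σ.Nonempty := hτ.mono h
  simp only [lowerStar, hτ, hσ, dif_pos]
  exact Finset.sup'_mono _ h hτ

/-- Every finite complex has an index filtration compatible with each lower-star filtration. -/
theorem exists_isIndexFiltration_lowerStar {d : ℕ} (K : Cpx d) (hK : K.faces.Finite) (s : Pt d) :
    ∃ l, IsIndexFiltration K.faces (lowerStar s) l :=
  exists_isIndexFiltration hK
    (fun _ _ _ hτ h => lowerStar_mono s (K.nonempty_of_mem_faces hτ) h)

open scoped Classical in
/-- A compatible index filtration.  The augmented persistence diagram does not depend on which
one is taken. -/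
def indexFiltration {d : ℕ} (L : Set (Finset (Pt d))) (f : Finset (Pt d) → ℝ) :
    List (Finset (Pt d)) :=
  if h : ∃ l, IsIndexFiltration L f l then h.choose else []

/-- The subcomplex formed by the first `i` simplices of an index filtration. -/
def stage {d : ℕ} (l : List (Finset (Pt d))) (i : ℕ) : Set (Finset (Pt d)) := {σ | σ ∈ l.take i}

/-- `β_k^{i,j}` of an index filtration. -/
def bettiIJ (F : Type*) [Field F] {d : ℕ} (l : List (Finset (Pt d))) (k i j : ℕ) : ℤ :=
  persistentBetti F (stage l i) (stage l j) k

/-- Multiplicity of the point `(i, j)` in the `k`-dimensional persistence diagram of an index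
filtration, for `1 ≤ i < j`. -/
def mult (F : Type*) [Field F] {d : ℕ} (l : List (Finset (Pt d))) (k i j : ℕ) : ℕ :=
  (bettiIJ F l k i (j - 1) - bettiIJ F l k i j - bettiIJ F l k (i - 1) (j - 1)
    + bettiIJ F l k (i - 1) j).toNat

/-- Multiplicity of the point `(i, ∞)` in the `k`-dimensional persistence diagram of an index
filtration, for `1 ≤ i`. -/
def multTop (F : Type*) [Field F] {d : ℕ} (l : List (Finset (Pt d))) (k i : ℕ) : ℕ :=
  (bettiIJ F l k i l.length - bettiIJ F l k (i - 1) l.length).toNat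

/-- A diagram, graded by dimension: for every `k` a multiset of points (birth, death), where the
death may be `∞`. -/
abbrev Diagram := ℕ → Multiset (ℝ × EReal)

/-- The augmented persistence diagram of the filter function `f`, computed from the index
filtration `l`: the point `(i, j)` of the persistence diagram of `l` becomes `(f σ_i, f σ_j)`, where
`σ_1, σ_2, …` are the entries of `l`. -/
def apdOf (F : Type*) [Field F] {d : ℕ} (f : Finset (Pt d) → ℝ) (l : List (Finset (Pt d))) :
    Diagram := fun k =>
  ∑ i ∈ Finset.Icc 1 l.length,
    (Multiset.replicate (multTop F l k i) (f (l.getD (i - 1) ∅), (⊤ : EReal)) +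
      ∑ j ∈ Finset.Icc (i + 1) l.length,
        Multiset.replicate (mult F l k i j)
          (f (l.getD (i - 1) ∅), ((f (l.getD (j - 1) ∅) : ℝ) : EReal)))

/-- The directional augmented persistence diagram of `K` in direction `s`.  It is also the answer
of the oracle for `K` to the query `s`. -/
def apd (F : Type*) [Field F] {d : ℕ} (K : Cpx d) (s : Pt d) : Diagram :=
  apdOf F (lowerStar s) (indexFiltration K.faces (lowerStar s))

/-- The persistent homology transform: all directional augmented persistence diagrams, indexed by
the sphere of directions. -/
def PHT (F : Type*) [Field F] {d : ℕ} (K : Cpx d) : Metric.sphere (0 : Pt d) 1 → Diagram :=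
  fun s => apd F K s

/-- The restriction of the persistent homology transform of `K` to `S` is a faithful finite
discretization: `S` is a finite set of directions, and no other (finite) simplicial complex has the
same diagrams in the directions in `S`. -/
def IsFaithfulDiscretization (F : Type*) [Field F] {d : ℕ} (K : Cpx d) (S : Set (Pt d)) : Prop :=
  S.Finite ∧ S ⊆ Metric.sphere 0 1 ∧
    ∀ K' : Cpx d, K'.faces.Finite →
      (∀ s : Metric.sphere (0 : Pt d) 1, (s : Pt d) ∈ S → PHT F K' s = PHT F K s) → K' = K

/-! ### Algorithms with an oracle -/

/-- A deterministic algorithm that adaptively asks an oracle questions in `Q`, receives answers in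
`R`, and finally returns an element of `α`. -/
inductive OracleAlg (Q R α : Type) : Type
  | done (a : α) : OracleAlg Q R α
  | ask (q : Q) (next : R → OracleAlg Q R α) : OracleAlg Q R α

namespace OracleAlg

/-- Sequential composition. -/
def andThen {Q R α β : Type} : OracleAlg Q R α → (α → OracleAlg Q R β) → OracleAlg Q R β
  | done a, g => g a
  | ask q next, g => ask q (fun r => andThen (next r) g)

instance (Q R : Type) : Monad (OracleAlg Q R) where
  pure := done
  bind := andThen

/-- A single question. -/
def query {Q R : Type} (q : Q) : OracleAlg Q R R := ask q done

/-- The value returned when the questions are answered by `O`. -/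
def output {Q R α : Type} (O : Q → R) : OracleAlg Q R α → α
  | done a => a
  | ask q next => output O (next (O q))

/-- The list of all questions asked (with repetitions) when they are answered by `O`. -/
def asked {Q R α : Type} (O : Q → R) : OracleAlg Q R α → List Q
  | done _ => []
  | ask q next => q :: asked O (next (O q))

end OracleAlg

/-! ### The reconstruction algorithm -/

/-- An algorithm that queries directional diagrams of an unknown complex in `ℝ^d`. -/
abbrev Alg (d : ℕ) (α : Type) := OracleAlg (Pt d) Diagram α

/-- A rule that finds a direction with prescribed properties whenever there is one. -/
def IsDirectionRule {d : ℕ} (pick : Set (Pt d) → Pt d) : Prop :=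
  ∀ P : Set (Pt d), (∃ s ∈ P, ‖s‖ = 1) → pick P ∈ P ∧ ‖pick P‖ = 1

/-- The smallest gap between two distinct heights in the list `H`. -/
def heightGap (H : List ℝ) : ℝ := sInf {g | ∃ a ∈ H, ∃ b ∈ H, a < b ∧ g = b - a}

/-- The difference between the extreme heights in the list `H`. -/
def heightSpread (H : List ℝ) : ℝ := sSup {g | ∃ a ∈ H, ∃ b ∈ H, g = b - a}

open scoped Classical in
/-- The parameter `ε` of a tilt, for heights `H` in the first and `H'` in the second direction.  The
segment from `(0, a)` to `(1, a')` and the one from `(0, b)` to `(1, b')` with `a < b` and `a' > b'`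
cross at abscissa `(b - a) / ((b - a) + (a' - b'))`.  The leftmost such crossing belongs to the
closest heights in `H` and the extreme heights in `H'`, and `ε` is half its abscissa.  If `H` has no
two distinct heights, then there is no order to preserve, and `ε` is `1 / 4`. -/
def tiltParam (H H' : List ℝ) : ℝ :=
  if ∃ a ∈ H, ∃ b ∈ H, a < b then (heightGap H / (heightGap H + heightSpread H')) / 2 else 1 / 4

/-- The tilt of `s` towards `s'`, where `H` and `H'` list the heights of the vertices in these two
directions; it is normalized to be a unit vector. -/
def tiltOfHeights {d : ℕ} (H H' : List ℝ) (s s' : Pt d) : Pt d :=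
  let t := (1 - tiltParam H H') • s + tiltParam H H' • s'
  ‖t‖⁻¹ • t

/-- The tilt of `s` towards `s'` for known vertices `V`. -/
def tilt {d : ℕ} (V : List (Pt d)) (s s' : Pt d) : Pt d :=
  tiltOfHeights (V.map fun v => ⟪s, v⟫_ℝ) (V.map fun v => ⟪s', v⟫_ℝ) s s'

/-- The births of zero-dimensional points, in ascending order. -/
def sortedBirths (D : Diagram) : List ℝ := ((D 0).map Prod.fst).sort (· ≤ ·)

open scoped Classical in
/-- The number of `k`-dimensional births at height `c` plus the number of `(k-1)`-dimensional deaths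
at height `c`. -/
def simplexCount (D : Diagram) (k : ℕ) (c : ℝ) : ℕ :=
  ((D k).filter (fun p => p.1 = c)).card +
    if k = 0 then 0 else ((D (k - 1)).filter (fun p => p.2 = (c : EReal))).card

/-- The dimension of the complex, read off one of its diagrams: the largest `k` such that there is a
`k`-dimensional birth or a (finite) `(k-1)`-dimensional death. -/
def dimOfDiagram (D : Diagram) : ℕ :=
  sSup {k | D k ≠ 0 ∨ (1 ≤ k ∧ ∃ p ∈ D (k - 1), p.2 ≠ ⊤)}

/-- The `j`-th coordinates (with `j ≥ 1`; the first coordinate has index `0`) of all vertices, listed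
in the order of increasing first coordinate.  `H₁` lists the first coordinates. -/
def findCoord (d : ℕ) (H₁ : List ℝ) (j : ℕ) : Alg d (List ℝ) := do
  let Dj ← OracleAlg.query (basisVec d j)
  let s := tiltOfHeights H₁ (sortedBirths Dj) (basisVec d 0) (basisVec d j)
  let Ds ← OracleAlg.query s
  pure (List.zipWith (fun hs h₁ => (hs - coord s 0 * h₁) / coord s j) (sortedBirths Ds) H₁)

/-- The list of all vertices, from the answer `D₁` to the query `e_1`. -/
def findVertices (d : ℕ) (D₁ : Diagram) : Alg d (List (Pt d)) := do
  let H₁ := sortedBirths D₁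
  let cols ← (List.range' 1 (d - 1)).foldlM
    (fun cols j => do
      let c ← findCoord d H₁ j
      pure (cols ++ [c])) [H₁]
  pure ((List.range H₁.length).map fun m =>
    WithLp.toLp 2 fun i : Fin d => (cols.getD i []).getD m 0)

/-- Given, for the nonempty faces `τ` of a simplex, the number of `k`-simplices at the height of `τ`
in the direction that isolates `τ`, the `k`-indegrees of the faces: the contributions of the
proper faces are subtracted recursively. -/
def indegreeOfCounts {d : ℕ} (δ : Finset (Pt d) → ℤ) (τ : Finset (Pt d)) : ℤ :=
  δ τ - ∑ ρ ∈ τ.powerset.attach, if _h : ρ.1 ≠ τ ∧ ρ.1.Nonempty then indegreeOfCounts δ ρ.1 else 0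
termination_by τ.card
decreasing_by
  exact Finset.card_lt_card
    ((Finset.mem_powerset.1 ρ.2).lt_of_ne _h.1)

open scoped Classical in
/-- The direction used for the nonempty face `τ` of `σ`: `s` itself for `τ = σ`, and otherwise the
tilt of `s` towards a direction that is orthogonal to `τ` and has the other vertices of `σ`
above `τ`. -/
def faceDirection {d : ℕ} (pick : Set (Pt d) → Pt d) (V : List (Pt d)) (σ : Finset (Pt d))
    (s : Pt d) (τ : Finset (Pt d)) : Pt d :=
  if τ = σ then s
  else tilt V s (pick {s' | (∀ u ∈ τ, ∀ w ∈ τ, ⟪s', u⟫_ℝ = ⟪s', w⟫_ℝ) ∧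
    ∀ w ∈ τ, ∀ x ∈ σ, x ∉ τ → ⟪s', w⟫_ℝ < ⟪s', x⟫_ℝ})

open scoped Classical in
/-- The `k`-indegree of `σ` in direction `s`; one diagram is queried for every nonempty face. -/
def indegree {d : ℕ} (pick : Set (Pt d) → Pt d) (V : List (Pt d)) (σ : Finset (Pt d)) (s : Pt d)
    (k : ℕ) : Alg d ℤ := do
  let δ ← (σ.powerset.erase ∅).toList.foldlM
    (fun δ τ => do
      let t := faceDirection pick V σ s τ
      let D ← OracleAlg.query t
      pure (Function.update δ τ (simplexCount D k (lowerStar t τ) : ℤ)))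
    (fun _ => (0 : ℤ))
  pure (indegreeOfCounts δ σ)

/-- The direction that splits the list `A ++ B` of vertices above `v`: it lies in the plane of the
first two coordinates, has the vertices in `A` below and those in `B` above `v`, and no
vertex other than `v` at the height of `v`. -/
def splitDirection {d : ℕ} (pick : Set (Pt d) → Pt d) (V : List (Pt d)) (v : Pt d)
    (A B : List (Pt d)) : Pt d :=
  pick {s | (∀ i : Fin d, 2 ≤ (i : ℕ) → s i = 0) ∧ (∀ w ∈ A, ⟪s, w⟫_ℝ < ⟪s, v⟫_ℝ) ∧
    (∀ w ∈ B, ⟪s, v⟫_ℝ < ⟪s, w⟫_ℝ) ∧ ∀ w ∈ V, w ≠ v → ⟪s, w⟫_ℝ ≠ ⟪s, v⟫_ℝ}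

open scoped Classical in
/-- Binary search in the edge interval at `v` with radially ordered vertices `I` and edge count `c`.
`known` lists the neighbors of `v` found so far; the result is this list with the neighbors in
`I` added. -/
def searchInterval {d : ℕ} (pick : Set (Pt d) → Pt d) (V : List (Pt d)) (v : Pt d)
    (I : List (Pt d)) (c : ℤ) (known : List (Pt d)) : Alg d (List (Pt d)) :=
  if c = 0 then pure known
  else if _h : I.length ≤ 1 then pure (I ++ known)
  else do
    let A := I.take (I.length / 2)
    let B := I.drop (I.length / 2)
    let s := splitDirection pick V v A B
    let m ← indegree pick V {v} s 1
    let cA : ℤ := m - (known.filter (fun w => ⟪s, w⟫_ℝ < ⟪s, v⟫_ℝ)).length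
    let known' ← searchInterval pick V v A cA known
    searchInterval pick V v B (c - cA) known'
termination_by I.length
decreasing_by
  all_goals simp only [List.length_take, List.length_drop]; omega

/-- The slope, in the plane of the first two coordinates, of the vector from `v` to `w`, relative to
the first axis.  For vertices `w` above `v` it increases with the angle from the first axis towards
the second one, so that sorting by it is sorting radially around `v`. -/
def slopeFrom {d : ℕ} (v w : Pt d) : ℝ := (coord w 1 - coord v 1) / (coord w 0 - coord v 0)

open scoped Classical in
/-- Finds the edges that join `v` to vertices above it (with respect to `e_1`).  `E` is the set of
edges found so far, which includes all edges from `v` to vertices below, and `D` is the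
diagram in direction `-e_1`. -/
def findUpEdges {d : ℕ} (pick : Set (Pt d) → Pt d) (V : List (Pt d)) (D : Diagram)
    (E : Finset (Finset (Pt d))) (v : Pt d) : Alg d (Finset (Finset (Pt d))) := do
  let I := (V.filter (fun w => coord v 0 < coord w 0)).mergeSort
    (fun u w => decide (slopeFrom v u ≤ slopeFrom v w))
  let c : ℤ := simplexCount D 1 ⟪-basisVec d 0, v⟫_ℝ
  let known := V.filter (fun w => ({v, w} : Finset (Pt d)) ∈ E ∧ w ≠ v)
  let nbrs ← searchInterval pick V v I c known
  pure (E ∪ (nbrs.map (fun w => ({v, w} : Finset (Pt d)))).toFinset)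

open scoped Classical in
/-- Finds all edges, in a sweep over the vertices in the direction `e_1`. -/
def findEdges {d : ℕ} (pick : Set (Pt d) → Pt d) (V : List (Pt d)) :
    Alg d (Finset (Finset (Pt d))) := do
  let D ← OracleAlg.query (-basisVec d 0)
  let V' := V.mergeSort (fun u w => decide (coord u 0 ≤ coord w 0))
  V'.foldlM (fun E v => findUpEdges pick V D E v) ∅

open scoped Classical in
/-- Tests whether the simplex `σ` and the vertex `v ∉ σ` together span a simplex, by comparing the
indegrees of `σ` in the two directions that bound a wedge around `σ` whose only further
vertex is `v`. -/
def isSimplex {d : ℕ} (pick : Set (Pt d) → Pt d) (V : List (Pt d)) (σ : Finset (Pt d)) (v : Pt d) :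
    Alg d Bool := do
  let k := σ.card
  let T := insert v σ
  let s₁ := pick {s | ∀ u ∈ T, ∀ w ∈ T, ⟪s, u⟫_ℝ = ⟪s, w⟫_ℝ}
  let s₂ := pick {s | (∀ u ∈ T, ∀ w ∈ T, ⟪s, u⟫_ℝ = ⟪s, w⟫_ℝ) ∧
    ∀ q ∈ V, q ∉ T → ∀ u ∈ T, ⟪s, q⟫_ℝ ≠ ⟪s, u⟫_ℝ}
  let sm := tilt V s₁ s₂
  let s₃ := pick {s | (∀ u ∈ σ, ∀ w ∈ σ, ⟪s, u⟫_ℝ = ⟪s, w⟫_ℝ) ∧ ∀ w ∈ σ, ⟪s, w⟫_ℝ < ⟪s, v⟫_ℝ}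
  let sL := tilt V sm s₃
  let sU := -tilt V (-sm) s₃
  let a ← indegree pick V σ sU k
  let b ← indegree pick V σ sL k
  pure (decide (|a - b| = 1))

open scoped Classical in
/-- Adds to the set `X` of simplices found so far all simplices with `i + 1` vertices. -/
def findSimplices {d : ℕ} (pick : Set (Pt d) → Pt d) (V : List (Pt d))
    (X : Finset (Finset (Pt d))) (i : ℕ) : Alg d (Finset (Finset (Pt d))) :=
  (X.filter (fun σ => σ.card = i)).toList.foldlM
    (fun Y σ => (V.filter (fun v => v ∉ σ)).foldlM
      (fun Y v => do
        let b ← isSimplex pick V σ v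
        pure (if b then insert (insert v σ) Y else Y)) Y) X

open scoped Classical in
/-- The reconstruction algorithm: first the vertices, then the edges, then the simplices of
dimension `2, 3, …, κ`. -/
def reconstruct (d : ℕ) (pick : Set (Pt d) → Pt d) : Alg d (Finset (Finset (Pt d))) := do
  let D₁ ← OracleAlg.query (basisVec d 0)
  let V ← findVertices d D₁
  let E ← findEdges pick V
  let X := (V.map (fun v => ({v} : Finset (Pt d)))).toFinset ∪ E
  (List.range' 2 (dimOfDiagram D₁ - 1)).foldlM (fun X i => findSimplices pick V X i) X

/-- The list of directions that the reconstruction algorithm queries for the complex `K`. -/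
def queriedDirections (F : Type*) [Field F] {d : ℕ} (pick : Set (Pt d) → Pt d) (K : Cpx d) :
    List (Pt d) :=
  (reconstruct d pick).asked (apd F K)

end

end PHTRecon

open PHTRecon

namespace PHTRecon

noncomputable section

open scoped InnerProductSpace

/-! ### Simplicial chains -/

/-! Everything rests on one fact: an augmented diagram counts the simplices of each dimension at
each height. When a `k`-simplex enters an index filtration, the chain space in dimension `k` grows
by one. By rank–nullity, either the `k`-cycles or the `(k-1)`-boundaries then grow by one, so the
simplex causes exactly one `k`-birth or one `(k-1)`-death (`birthsAt_add_deathsAt`). The augmented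
diagram keeps the points with birth and death at the same height, so nothing is lost when indices
are replaced by heights (`simplexCount_apdOf`, `simplexCount_apd`). In particular, zero-dimensional
births are the vertex heights, and the dimension of the complex is visible in any single diagram.

The geometric tool is the tilt (`isTilt_tiltOfHeights`). It keeps every strict inequality between
vertex heights in the first direction and lets the second direction break the ties. A tilt of `e_1`
therefore lists the vertices in their `e_1`-order, so births can be matched with vertices and
coordinates solved for. If `s` is orthogonal to `σ` with no other vertex at that height, tilts of
`s` separate the faces of `σ`. A simplex has the height of a face `τ` in the direction for `τ`
exactly when its vertices outside `σ` lie below `σ` and it meets `σ` in a nonempty subset of `τ`.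
The measured counts are thus sums over nonempty subsets of `τ`, and inverting these sums gives the
true indegree (`indegree_output`).

For edges, a split direction turns the number of neighbors in the first half of a radial interval
into an indegree minus a number of known neighbors. This is correct because every neighbor not yet
found outside the interval lies radially beyond it, hence above `v` (`searchInterval_output`). For
higher simplices, the wedge directions agree on which side of `σ` every vertex except `v` lies, so
the two indegrees differ by one exactly when `σ ∪ {v}` is a simplex (`trueIndegree_wedge`).

Faithfulness follows by running the algorithm on a competitor `K'` with the same answers. Since `K'`
need not be in general position, correctness cannot be applied to it at once. The vertex stage,
however, only needs distinct first coordinates, and their distinctness can be read off the diagram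
for `e_1`. Hence `K'` has the same vertices as `K`, inherits general position, has the same
dimension, and must be the common output. -/

theorem precedes_or_precedes {d : ℕ} {u v : Pt d} (h : u ≠ v) : Precedes u v ∨ Precedes v u := by
  unfold Precedes
  refine lt_or_gt_of_ne fun e => h ?_
  ext i
  exact congrFun (toLex.injective e) i

theorem Precedes.asymm {d : ℕ} {u v : Pt d} (h : Precedes u v) : ¬ Precedes v u := by
  unfold Precedes at *
  exact lt_asymm h

open scoped Classical in
/-- The number of vertices of `σ` that precede `v`. -/
def numBefore {d : ℕ} (σ : Finset (Pt d)) (v : Pt d) : ℕ := (σ.filter (fun u => Precedes u v)).card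

open scoped Classical in
theorem numBefore_erase_of_precedes {d : ℕ} {σ : Finset (Pt d)} {v w : Pt d} (hv : v ∈ σ)
    (h : Precedes v w) : numBefore (σ.erase v) w + 1 = numBefore σ w := by
  unfold numBefore
  rw [Finset.filter_erase]
  exact Finset.card_erase_add_one (Finset.mem_filter.2 ⟨hv, h⟩)

open scoped Classical in
theorem numBefore_erase_of_not_precedes {d : ℕ} {σ : Finset (Pt d)} {v w : Pt d}
    (h : ¬ Precedes v w) : numBefore (σ.erase v) w = numBefore σ w := by
  unfold numBefore
  rw [Finset.filter_erase, Finset.erase_eq_of_notMem]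
  simp [h]

theorem boundary_single (F : Type*) [Field F] {d : ℕ} (σ : Finset (Pt d)) (a : F) :
    boundary F d (Finsupp.single σ a) = a • simplexBoundary F σ := by
  simp [boundary]

open scoped Classical in
-- Each codimension-two face arises twice, from deleting `v` then `w` and from deleting `w` then
-- `v`. If `v` precedes `w`, deleting `v` lowers the position of `w` by one, while deleting `w`
-- leaves the position of `v` unchanged. The two signs are therefore opposite, and swapping the pair
-- is the cancelling involution.
theorem boundary_simplexBoundary (F : Type*) [Field F] {d : ℕ} (σ : Finset (Pt d)) :
    boundary F d (simplexBoundary F σ) = 0 := by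
  unfold simplexBoundary
  split_ifs with h1
  · simp
  have key : ∀ v ∈ σ, boundary F d (Finsupp.single (σ.erase v)
      ((-1 : F) ^ (σ.filter (fun u => Precedes u v)).card)) =
      if σ.card = 2 then 0 else ∑ w ∈ σ.erase v, Finsupp.single ((σ.erase v).erase w)
        ((-1 : F) ^ (numBefore σ v + numBefore (σ.erase v) w)) := by
    intro v hv
    rw [boundary_single, simplexBoundary, Finset.card_erase_of_mem hv]
    -- Homology is not reduced: the faces of an edge are vertices, whose boundary is zero by
    -- definition, so edges have no double sum.
    by_cases h2 : σ.card = 2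
    · simp [h2]
    · rw [if_neg (by omega), if_neg h2, Finset.smul_sum]
      refine Finset.sum_congr rfl fun w _ => ?_
      rw [Finsupp.smul_single, smul_eq_mul, pow_add]
      rfl
  rw [map_sum, Finset.sum_congr rfl key]
  by_cases h2 : σ.card = 2
  · simp [h2]
  simp only [h2, if_false]
  rw [Finset.sum_sigma']
  refine Finset.sum_involution (fun p _ => ⟨p.2, p.1⟩) ?_ ?_ ?_ ?_
  · rintro ⟨v, w⟩ h
    simp only [Finset.mem_sigma, Finset.mem_erase] at h
    obtain ⟨hv, hwv, hw⟩ := h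
    have aux : ∀ {v w : Pt d}, v ∈ σ → w ∈ σ → Precedes v w →
        Finsupp.single ((σ.erase v).erase w)
          ((-1 : F) ^ (numBefore σ v + numBefore (σ.erase v) w)) +
        Finsupp.single ((σ.erase w).erase v)
          ((-1 : F) ^ (numBefore σ w + numBefore (σ.erase w) v)) = 0 := by
      intro v w hv hw h
      rw [Finset.erase_right_comm, ← Finsupp.single_add,
        numBefore_erase_of_not_precedes h.asymm, ← numBefore_erase_of_precedes hv h]
      rw [Finsupp.single_eq_zero]
      ring
    rcases precedes_or_precedes hwv with h | h
    · rw [add_comm]; exact aux hw hv h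
    · exact aux hv hw h
  · rintro ⟨v, w⟩ h _ he
    simp only [Finset.mem_sigma, Finset.mem_erase] at h
    simp only [Sigma.mk.injEq, heq_eq_eq] at he
    exact h.2.1 he.1
  · rintro ⟨v, w⟩ h
    simp only [Finset.mem_sigma, Finset.mem_erase] at h ⊢
    exact ⟨h.2.2, Ne.symm h.2.1, h.1⟩
  · intro _ _; rfl

theorem boundary_boundary (F : Type*) [Field F] {d : ℕ} (x : Finset (Pt d) →₀ F) :
    boundary F d (boundary F d x) = 0 := by
  induction x using Finsupp.induction_linear with
  | zero => simp
  | add f g hf hg => simp [hf, hg]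
  | single σ a => rw [boundary_single, map_smul, boundary_simplexBoundary, smul_zero]

/-- A set of simplices that contains the nonempty faces of its members. -/
def FaceClosed {d : ℕ} (L : Set (Finset (Pt d))) : Prop :=
  ∀ σ ∈ L, ∀ τ ⊆ σ, τ.Nonempty → τ ∈ L

/-! ### Dimensions of chain, cycle and boundary spaces -/

section Subspaces

variable (F : Type*) [Field F] {d : ℕ}

theorem finite_chains {L : Set (Finset (Pt d))} (hL : L.Finite) (k : ℕ) :
    Module.Finite F (chains F L k) := by
  have : Finite {σ | σ ∈ L ∧ σ.card = k + 1} := (hL.subset fun _ h => h.1).to_subtype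
  exact Module.Finite.equiv (Finsupp.supportedEquivFinsupp (M := F) (R := F) _).symm

theorem finrank_chains {L : Set (Finset (Pt d))} (hL : L.Finite) (k : ℕ) :
    Module.finrank F (chains F L k) = {σ | σ ∈ L ∧ σ.card = k + 1}.ncard := by
  have h := hL.subset (fun _ h => h.1 : {σ | σ ∈ L ∧ σ.card = k + 1} ⊆ L)
  have := h.fintype
  unfold chains
  rw [LinearEquiv.finrank_eq (Finsupp.supportedEquivFinsupp (M := F) (R := F) _),
    Module.finrank_finsupp_self, ← Nat.card_eq_fintype_card, Nat.card_coe_set_eq]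

theorem finite_cycles {L : Set (Finset (Pt d))} (hL : L.Finite) (k : ℕ) :
    Module.Finite F (cycles F L k) := by
  have := finite_chains F hL k
  exact Submodule.finiteDimensional_of_le (inf_le_left : cycles F L k ≤ chains F L k)

theorem finite_boundaries {L : Set (Finset (Pt d))} (hL : L.Finite) (k : ℕ) :
    Module.Finite F (boundaries F L k) := by
  have := finite_chains F hL (k + 1)
  exact Module.Finite.map _ _

theorem chains_mono {L L' : Set (Finset (Pt d))} (h : L ⊆ L') (k : ℕ) :
    chains F L k ≤ chains F L' k :=
  Finsupp.supported_mono fun _ hσ => ⟨h hσ.1, hσ.2⟩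

theorem cycles_mono {L L' : Set (Finset (Pt d))} (h : L ⊆ L') (k : ℕ) :
    cycles F L k ≤ cycles F L' k := inf_le_inf_right _ (chains_mono F h k)

theorem boundaries_mono {L L' : Set (Finset (Pt d))} (h : L ⊆ L') (k : ℕ) :
    boundaries F L k ≤ boundaries F L' k := Submodule.map_mono (chains_mono F h _)

theorem boundaries_le_cycles {L : Set (Finset (Pt d))} (hL : FaceClosed L) (k : ℕ) :
    boundaries F L k ≤ cycles F L k := by
  refine le_inf ?_ ?_
  · unfold boundaries chains
    rw [Finsupp.supported_eq_span_single, Submodule.map_span, Submodule.span_le]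
    rintro _ ⟨_, ⟨σ, ⟨hσ, hc⟩, rfl⟩, rfl⟩
    rw [boundary_single, one_smul, simplexBoundary, if_neg (by omega)]
    refine Submodule.sum_mem _ fun v hv => Finsupp.single_mem_supported _ _ ?_
    have hc' : (σ.erase v).card = k + 1 := by rw [Finset.card_erase_of_mem hv]; omega
    refine ⟨hL σ hσ _ (Finset.erase_subset _ _) (Finset.card_pos.1 (by omega)), ?_⟩
    exact hc'
  · rintro _ ⟨x, _, rfl⟩
    exact boundary_boundary F x

theorem cycles_zero (L : Set (Finset (Pt d))) : cycles F L 0 = chains F L 0 := by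
  refine inf_eq_left.2 ?_
  unfold chains
  rw [Finsupp.supported_eq_span_single, Submodule.span_le]
  rintro _ ⟨σ, ⟨_, hc⟩, rfl⟩
  simp [boundary_single, simplexBoundary, hc]

/-- Rank–nullity for the restriction of `f` to `Z`. Only `Z` is finite-dimensional here, because the
ambient chain space is spanned by all finite point sets. -/
theorem finrank_map_add_finrank_inf_ker {V W : Type*} [AddCommGroup V] [Module F V]
    [AddCommGroup W] [Module F W] (f : V →ₗ[F] W) (Z : Submodule F V) [Module.Finite F Z] :
    Module.finrank F (Z.map f) + Module.finrank F (Z ⊓ LinearMap.ker f : Submodule F V) =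
      Module.finrank F Z := by
  have h := (f.domRestrict Z).finrank_range_add_finrank_ker
  rw [LinearMap.range_domRestrict, LinearMap.ker_domRestrict] at h
  rw [← h, ← Submodule.map_comap_subtype, Submodule.finrank_map_subtype_eq]

theorem finrank_chains_succ {L : Set (Finset (Pt d))} (hL : L.Finite) (k : ℕ) :
    Module.finrank F (chains F L (k + 1)) =
      Module.finrank F (boundaries F L k) + Module.finrank F (cycles F L (k + 1)) := by
  have := finite_chains F hL (k + 1)
  exact (finrank_map_add_finrank_inf_ker F (boundary F d) (chains F L (k + 1))).symm

theorem persistentBetti_add {L : Set (Finset (Pt d))} (hL : L.Finite)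
    (L' : Set (Finset (Pt d))) (k : ℕ) :
    persistentBetti F L L' k +
      Module.finrank F (cycles F L k ⊓ boundaries F L' k : Submodule F _) =
      Module.finrank F (cycles F L k) := by
  have := finite_cycles F hL k
  have h := finrank_map_add_finrank_inf_ker F (boundaries F L' k).mkQ (cycles F L k)
  rwa [Submodule.ker_mkQ] at h

/-- The dimension formula for `A + B` and `A ⊓ B`. This inequality is what makes the multiplicities
of a persistence diagram nonnegative. -/
theorem finrank_modular {V : Type*} [AddCommGroup V] [Module F V] {A B X Y : Submodule F V}
    [Module.Finite F X] (hA : A ≤ X) (hB : B ≤ X) (hY : A ⊓ B ≤ Y) [Module.Finite F Y] :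
    Module.finrank F A + Module.finrank F B ≤ Module.finrank F X + Module.finrank F Y := by
  have := Submodule.finiteDimensional_of_le hA
  have := Submodule.finiteDimensional_of_le hB
  rw [← Submodule.finrank_sup_add_finrank_inf_eq]
  exact add_le_add (Submodule.finrank_mono (sup_le hA hB)) (Submodule.finrank_mono hY)

end Subspaces

/-! ### Counting simplices with a persistence diagram -/

section Filtration

variable (F : Type*) [Field F] {d : ℕ}

theorem finite_stage (l : List (Finset (Pt d))) (i : ℕ) : (stage l i).Finite :=
  List.finite_toSet _

theorem stage_mono (l : List (Finset (Pt d))) {i j : ℕ} (h : i ≤ j) : stage l i ⊆ stage l j :=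
  fun _ hσ => (List.take_sublist_take_left h).subset hσ

theorem stage_zero (l : List (Finset (Pt d))) : stage l 0 = ∅ := by simp [stage]

theorem stage_succ (l : List (Finset (Pt d))) {i : ℕ} (h : i < l.length) :
    stage l (i + 1) = insert l[i] (stage l i) := by
  ext σ
  change σ ∈ l.take (i + 1) ↔ σ = l[i] ∨ σ ∈ l.take i
  rw [List.take_succ_eq_append_getElem h, List.mem_append, List.mem_singleton, or_comm]

theorem getElem_notMem_stage {l : List (Finset (Pt d))} (hl : l.Nodup) {i : ℕ}
    (h : i < l.length) : l[i] ∉ stage l i := by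
  intro hm
  obtain ⟨j, hj, e⟩ := List.mem_take_iff_getElem.1 hm
  have := (hl.getElem_inj_iff).1 e
  omega

/-- Every proper face of a simplex is forced to an earlier index, so each prefix of the filtration
is a subcomplex. -/
theorem faceClosed_stage {L : Set (Finset (Pt d))} (hL : FaceClosed L)
    {f : Finset (Pt d) → ℝ} {l : List (Finset (Pt d))} (hl : IsIndexFiltration L f l) (i : ℕ) :
    FaceClosed (stage l i) := by
  intro σ hσ τ hτ hne
  obtain ⟨a, ha, rfl⟩ := List.mem_take_iff_getElem.1 hσ
  have hτL := hL _ ((hl.2.1 _).1 (List.getElem_mem _)) τ hτ hne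
  obtain ⟨b, hb, rfl⟩ := List.mem_iff_getElem.1 ((hl.2.1 _).2 hτL)
  refine List.mem_take_iff_getElem.2 ⟨b, ?_, rfl⟩
  rcases le_or_gt b a with h | h
  · omega
  · have h3 := (List.pairwise_iff_getElem.1 hl.2.2 a b (by omega) hb h).2
    have := (hl.1.getElem_inj_iff).1 (hτ.eq_of_not_ssubset h3)
    omega

theorem chains_congr {L L' : Set (Finset (Pt d))} {k : ℕ}
    (h : ∀ σ, σ.card = k + 1 → (σ ∈ L ↔ σ ∈ L')) : chains F L k = chains F L' k := by
  unfold chains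
  congr 1
  ext σ
  exact ⟨fun hσ => ⟨(h σ hσ.2).1 hσ.1, hσ.2⟩, fun hσ => ⟨(h σ hσ.2).2 hσ.1, hσ.2⟩⟩

theorem chains_stage_succ {l : List (Finset (Pt d))} {i k : ℕ} (h : i < l.length)
    (hk : l[i].card ≠ k + 1) : chains F (stage l (i + 1)) k = chains F (stage l i) k := by
  refine chains_congr F fun σ hσ => ?_
  rw [stage_succ l h]
  refine ⟨fun hm => hm.resolve_left ?_, Or.inr⟩
  rintro rfl
  exact hk hσ

theorem finrank_chains_stage_succ {l : List (Finset (Pt d))} (hl : l.Nodup) {i k : ℕ}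
    (h : i < l.length) (hk : l[i].card = k + 1) :
    Module.finrank F (chains F (stage l (i + 1)) k) =
      Module.finrank F (chains F (stage l i) k) + 1 := by
  rw [finrank_chains F (finite_stage l _), finrank_chains F (finite_stage l _),
    ← Set.ncard_insert_of_notMem (a := l[i]) (fun hm => getElem_notMem_stage hl h hm.1)
      ((finite_stage l i).subset fun _ hm => hm.1)]
  congr 1
  ext σ
  rw [stage_succ l h]
  simp only [Set.mem_insert_iff, Set.mem_ofPred_eq]
  constructor
  · rintro ⟨rfl | h1, h2⟩
    · exact Or.inl rfl
    · exact Or.inr ⟨h1, h2⟩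
  · rintro (rfl | h1)
    · exact ⟨Or.inl rfl, hk⟩
    · exact ⟨Or.inr h1.1, h1.2⟩

theorem bettiIJ_eq (l : List (Finset (Pt d))) (k i j : ℕ) :
    bettiIJ F l k i j = (Module.finrank F (cycles F (stage l i) k) : ℤ) -
      Module.finrank F (cycles F (stage l i) k ⊓ boundaries F (stage l j) k : Submodule F _) := by
  unfold bettiIJ
  have := persistentBetti_add F (finite_stage l i) (stage l j) k
  omega

theorem bettiIJ_zero (l : List (Finset (Pt d))) (k j : ℕ) : bettiIJ F l k 0 j = 0 := by
  have h := persistentBetti_add F (finite_stage l 0) (stage l j) k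
  have h2 : Module.finrank F (cycles F (stage l 0) k) ≤ Module.finrank F (chains F (stage l 0) k) :=
    have := finite_chains F (finite_stage l 0) k
    Submodule.finrank_mono inf_le_left
  rw [finrank_chains F (finite_stage l 0)] at h2
  simp only [stage_zero, Set.mem_empty_iff_false, false_and, Set.ofPred_false,
    Set.ncard_empty, nonpos_iff_eq_zero] at h2
  rw [stage_zero] at h h2
  unfold bettiIJ
  rw [stage_zero]
  omega

/-- The truncation in `mult` loses nothing. In terms of dimensions the alternating sum is `dim X -
dim A - dim B + dim Y`, for intersections of the cycles at `i` or `i - 1` with the boundaries at `j`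
or `j - 1`, and `finrank_modular` bounds it below by zero. -/
theorem cast_mult (l : List (Finset (Pt d))) (k i j : ℕ) :
    (mult F l k i j : ℤ) = bettiIJ F l k i (j - 1) - bettiIJ F l k i j
      - bettiIJ F l k (i - 1) (j - 1) + bettiIJ F l k (i - 1) j := by
  refine Int.toNat_of_nonneg ?_
  simp only [bettiIJ_eq]
  have hz := cycles_mono F (stage_mono l (Nat.sub_le i 1)) k
  have hb := boundaries_mono F (stage_mono l (Nat.sub_le j 1)) k
  have := finite_boundaries F (finite_stage l j) k
  have := finite_boundaries F (finite_stage l (j - 1)) k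
  have h := finrank_modular F
    (A := cycles F (stage l (i - 1)) k ⊓ boundaries F (stage l j) k)
    (B := cycles F (stage l i) k ⊓ boundaries F (stage l (j - 1)) k)
    (X := cycles F (stage l i) k ⊓ boundaries F (stage l j) k)
    (Y := cycles F (stage l (i - 1)) k ⊓ boundaries F (stage l (j - 1)) k)
    (inf_le_inf_right _ hz) (inf_le_inf_left _ hb)
    (le_inf (inf_le_left.trans inf_le_left) (inf_le_right.trans inf_le_right))
  omega

theorem cast_multTop (l : List (Finset (Pt d))) (k i : ℕ) :
    (multTop F l k i : ℤ) = bettiIJ F l k i l.length - bettiIJ F l k (i - 1) l.length := by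
  refine Int.toNat_of_nonneg ?_
  simp only [bettiIJ_eq]
  have hz := cycles_mono F (stage_mono l (Nat.sub_le i 1)) k
  have := finite_cycles F (finite_stage l i) k
  have := finite_boundaries F (finite_stage l l.length) k
  have h := finrank_modular F
    (A := cycles F (stage l (i - 1)) k)
    (B := cycles F (stage l i) k ⊓ boundaries F (stage l l.length) k)
    (X := cycles F (stage l i) k)
    (Y := cycles F (stage l (i - 1)) k ⊓ boundaries F (stage l l.length) k)
    hz inf_le_left (le_inf inf_le_left (inf_le_right.trans inf_le_right))
  omega

theorem sum_Icc_sub (g : ℕ → ℤ) {i n : ℕ} (h : i ≤ n) :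
    ∑ j ∈ Finset.Icc (i + 1) n, (g (j - 1) - g j) = g i - g n := by
  induction n, h using Nat.le_induction with
  | base => simp
  | succ n hn ih => rw [Finset.sum_Icc_succ_top (by omega), ih]; simp

/-- The number of `k`-dimensional points that are born at the index `i`. -/
def birthsAt (l : List (Finset (Pt d))) (k i : ℕ) : ℕ :=
  multTop F l k i + ∑ j ∈ Finset.Icc (i + 1) l.length, mult F l k i j

/-- The number of `k`-dimensional points that die at the index `j`. -/
def deathsAt (l : List (Finset (Pt d))) (k j : ℕ) : ℕ :=
  ∑ i ∈ Finset.Icc 1 (j - 1), mult F l k i j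

/-- The sum over finite deaths telescopes, and the points that never die supply its missing last
term. -/
theorem cast_birthsAt (l : List (Finset (Pt d))) (k : ℕ) {i : ℕ} (h : i ≤ l.length) :
    (birthsAt F l k i : ℤ) = bettiIJ F l k i i - bettiIJ F l k (i - 1) i := by
  unfold birthsAt
  push_cast
  have := sum_Icc_sub (fun j => bettiIJ F l k i j - bettiIJ F l k (i - 1) j) h
  rw [cast_multTop, Finset.sum_congr rfl (g := fun j =>
    (bettiIJ F l k i (j - 1) - bettiIJ F l k (i - 1) (j - 1)) -
    (bettiIJ F l k i j - bettiIJ F l k (i - 1) j)) (fun j _ => by rw [cast_mult]; ring), this]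
  ring

/-- The sum over births telescopes down to index zero, where the subcomplex is empty and the Betti
number vanishes. -/
theorem cast_deathsAt (l : List (Finset (Pt d))) (k j : ℕ) :
    (deathsAt F l k j : ℤ) = bettiIJ F l k (j - 1) (j - 1) - bettiIJ F l k (j - 1) j := by
  unfold deathsAt
  push_cast
  have := sum_Icc_sub (fun i => bettiIJ F l k i j - bettiIJ F l k i (j - 1)) (Nat.zero_le (j - 1))
  simp only [zero_add, bettiIJ_zero] at this
  rw [Finset.sum_congr rfl (g := fun i =>
    (bettiIJ F l k (i - 1) j - bettiIJ F l k (i - 1) (j - 1)) -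
    (bettiIJ F l k i j - bettiIJ F l k i (j - 1))) (fun j _ => by rw [cast_mult]; ring), this]
  ring

variable {L : Set (Finset (Pt d))} {f : Finset (Pt d) → ℝ} {l : List (Finset (Pt d))}

theorem birthsAt_of_card_ne {i k : ℕ} (h : i < l.length) (hk : l[i].card ≠ k + 1) :
    birthsAt F l k (i + 1) = 0 := by
  have h1 := cast_birthsAt F l k (i := i + 1) h
  have h2 : cycles F (stage l (i + 1)) k = cycles F (stage l i) k := by
    unfold cycles; rw [chains_stage_succ F h hk]
  simp only [bettiIJ_eq, Nat.add_sub_cancel] at h1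
  rw [h2] at h1
  omega

/-- A new `k`-simplex leaves the `k`-boundaries unchanged, so the new persistent classes are exactly
the growth of the cycle space. -/
theorem birthsAt_of_card_eq (hL : FaceClosed L) (hl : IsIndexFiltration L f l) {i k : ℕ}
    (h : i < l.length) (hk : l[i].card = k + 1) :
    birthsAt F l k (i + 1) + Module.finrank F (cycles F (stage l i) k) =
      Module.finrank F (cycles F (stage l (i + 1)) k) := by
  have h1 := cast_birthsAt F l k (i := i + 1) h
  have h2 : boundaries F (stage l (i + 1)) k = boundaries F (stage l i) k := by
    unfold boundaries; rw [chains_stage_succ F h (by omega)]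
  have h3 := boundaries_le_cycles F (faceClosed_stage hL hl i) k
  have h4 := h3.trans (cycles_mono F (stage_mono l (Nat.le_succ i)) k)
  simp only [bettiIJ_eq, Nat.add_sub_cancel] at h1
  rw [h2, inf_eq_right.2 h3, inf_eq_right.2 h4] at h1
  omega

theorem deathsAt_of_card_ne {j k : ℕ} (h : j < l.length) (hk : l[j].card ≠ k + 2) :
    deathsAt F l k (j + 1) = 0 := by
  have h1 := cast_deathsAt F l k (j + 1)
  have h2 : boundaries F (stage l (j + 1)) k = boundaries F (stage l j) k := by
    unfold boundaries; rw [chains_stage_succ F h hk]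
  simp only [bettiIJ_eq, Nat.add_sub_cancel] at h1
  rw [h2] at h1
  omega

/-- A new `(k+1)`-simplex leaves the `k`-cycles unchanged, so the classes that die are exactly the
growth of the boundary space. -/
theorem deathsAt_of_card_eq (hL : FaceClosed L) (hl : IsIndexFiltration L f l) {j k : ℕ}
    (h : j < l.length) (hk : l[j].card = k + 2) :
    deathsAt F l k (j + 1) + Module.finrank F (boundaries F (stage l j) k) =
      Module.finrank F (boundaries F (stage l (j + 1)) k) := by
  have h1 := cast_deathsAt F l k (j + 1)
  have h2 : cycles F (stage l (j + 1)) k = cycles F (stage l j) k := by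
    unfold cycles; rw [chains_stage_succ F h (by omega)]
  have h3 := boundaries_le_cycles F (faceClosed_stage hL hl j) k
  have h4 := boundaries_le_cycles F (faceClosed_stage hL hl (j + 1)) k
  rw [h2] at h4
  simp only [bettiIJ_eq, Nat.add_sub_cancel] at h1
  rw [inf_eq_right.2 h3, inf_eq_right.2 h4] at h1
  omega

/-- Rank–nullity splits the growth by one of the `k`-chains into the growth of the `k`-cycles, which
are births, and that of the `(k-1)`-boundaries, which are deaths. Vertices always give births, since
all their chains are cycles. -/
theorem birthsAt_add_deathsAt (hL : FaceClosed L) (hl : IsIndexFiltration L f l) {i k : ℕ}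
    (h : i < l.length) :
    birthsAt F l k (i + 1) + (if k = 0 then 0 else deathsAt F l (k - 1) (i + 1)) =
      if l[i].card = k + 1 then 1 else 0 := by
  by_cases hk : l[i].card = k + 1
  · rw [if_pos hk]
    have h1 := birthsAt_of_card_eq F hL hl h hk
    have h2 := finrank_chains_stage_succ F hl.1 h hk
    cases k with
    | zero =>
      rw [cycles_zero, cycles_zero] at h1
      simp only [if_true]
      omega
    | succ k =>
      have h3 := deathsAt_of_card_eq F hL hl h hk
      rw [finrank_chains_succ F (finite_stage l _), finrank_chains_succ F (finite_stage l _)] at h2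
      simp only [Nat.add_sub_cancel, Nat.succ_ne_zero, if_false]
      omega
  · rw [if_neg hk, birthsAt_of_card_ne F h hk]
    split_ifs with h0
    · rfl
    · rw [deathsAt_of_card_ne F h (by omega)]

theorem countP_replicate {α : Type*} (p : α → Prop) [DecidablePred p] (n : ℕ) (a : α) :
    Multiset.countP p (Multiset.replicate n a) = if p a then n else 0 := by
  rw [← Multiset.coe_replicate, Multiset.coe_countP, List.countP_replicate]
  simp

open scoped Classical in
theorem card_filter_birth (f : Finset (Pt d) → ℝ) (l : List (Finset (Pt d))) (k : ℕ) (c : ℝ) :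
    ((apdOf F f l k).filter (fun p => p.1 = c)).card =
      ∑ i ∈ Finset.Icc 1 l.length, if f (l.getD (i - 1) ∅) = c then birthsAt F l k i else 0 := by
  unfold apdOf
  rw [← Multiset.countP_eq_card_filter, ← Multiset.coe_countPAddMonoidHom, map_sum]
  refine Finset.sum_congr rfl fun i _ => ?_
  rw [map_add, map_sum]
  simp only [Multiset.coe_countPAddMonoidHom, countP_replicate]
  split_ifs with h
  · rfl
  · simp

open scoped Classical in
theorem card_filter_death (f : Finset (Pt d) → ℝ) (l : List (Finset (Pt d))) (k : ℕ) (c : ℝ) :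
    ((apdOf F f l k).filter (fun p => p.2 = (c : EReal))).card =
      ∑ j ∈ Finset.Icc 1 l.length, if f (l.getD (j - 1) ∅) = c then deathsAt F l k j else 0 := by
  unfold apdOf
  rw [← Multiset.countP_eq_card_filter, ← Multiset.coe_countPAddMonoidHom, map_sum]
  simp only [map_add, map_sum, Multiset.coe_countPAddMonoidHom, countP_replicate,
    EReal.top_ne_coe, if_false, zero_add, EReal.coe_eq_coe_iff]
  rw [Finset.sum_comm' (t' := Finset.Icc 1 l.length) (s' := fun j => Finset.Icc 1 (j - 1))]
  · refine Finset.sum_congr rfl fun j _ => ?_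
    unfold deathsAt
    split_ifs with h
    · rfl
    · simp
  · intro i j
    simp only [Finset.mem_Icc]
    omega

/-- Each index contributes one event in the dimension of its simplex and none in any other.
Relabelling indices by heights groups these events, and points on the diagonal are retained, so the
events at height `c` correspond one to one to the simplices at height `c`. -/
theorem simplexCount_apdOf (hL : FaceClosed L) (hl : IsIndexFiltration L f l) (k : ℕ) (c : ℝ) :
    simplexCount (apdOf F f l) k c = {σ | σ ∈ L ∧ σ.card = k + 1 ∧ f σ = c}.ncard := by
  classical
  unfold simplexCount
  rw [card_filter_birth, card_filter_death]
  have h1 : {σ | σ ∈ L ∧ σ.card = k + 1 ∧ f σ = c} =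
      ↑(l.toFinset.filter (fun σ => σ.card = k + 1 ∧ f σ = c)) := by
    ext σ
    simp [hl.2.1]
  rw [h1, Set.ncard_coe_finset, Finset.card_filter, List.sum_toFinset _ hl.1,
    ← Fin.sum_univ_fun_getElem]
  have h2 : ∀ g : ℕ → ℕ, ∑ i ∈ Finset.Icc 1 l.length, g i = ∑ i : Fin l.length, g (i + 1) := by
    intro g
    rw [← Finset.sum_range (fun i => g (i + 1)), Finset.range_eq_Ico,
      Finset.sum_Ico_add' g 0 l.length 1]
    rfl
  rw [h2, h2]
  have h3 : ∀ i : Fin l.length, (if l[(i : ℕ)].card = k + 1 ∧ f l[(i : ℕ)] = c then 1 else 0) =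
      (if f (l.getD (i + 1 - 1) ∅) = c then birthsAt F l k (i + 1) else 0) +
      (if k = 0 then 0 else
        if f (l.getD (i + 1 - 1) ∅) = c then deathsAt F l (k - 1) (i + 1) else 0) := by
    intro i
    have := birthsAt_add_deathsAt F hL hl (k := k) i.2
    have e : l.getD (i + 1 - 1) ∅ = l[(i : ℕ)] := by simp
    rw [e]
    split_ifs at * <;> simp_all
  rw [Finset.sum_congr rfl fun i _ => h3 i, Finset.sum_add_distrib]
  split_ifs <;> simp

theorem death_of_mem_apdOf {f : Finset (Pt d) → ℝ} {l : List (Finset (Pt d))} {k : ℕ}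
    {p : ℝ × EReal} (hp : p ∈ apdOf F f l k) : p.2 = ⊤ ∨ ∃ c : ℝ, p.2 = c := by
  unfold apdOf at hp
  simp only [Multiset.mem_sum, Multiset.mem_add] at hp
  obtain ⟨i, _, h | ⟨j, _, h⟩⟩ := hp
  · exact Or.inl (by rw [Multiset.eq_of_mem_replicate h])
  · exact Or.inr ⟨_, by rw [Multiset.eq_of_mem_replicate h]⟩

end Filtration

/-! ### What the directional diagrams of a complex reveal -/

section Complex

variable (F : Type*) [Field F] {d : ℕ} {K : Cpx d}

theorem faceClosed_faces (K : Cpx d) : FaceClosed K.faces := fun _ hσ _ h hne =>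
  K.down_closed hσ h hne

theorem isIndexFiltration_indexFiltration (hK : K.faces.Finite) (s : Pt d) :
    IsIndexFiltration K.faces (lowerStar s) (indexFiltration K.faces (lowerStar s)) := by
  have h := exists_isIndexFiltration_lowerStar K hK s
  unfold indexFiltration
  rw [dif_pos h]
  exact h.choose_spec

theorem simplexCount_apd (hK : K.faces.Finite) (s : Pt d) (k : ℕ) (c : ℝ) :
    simplexCount (apd F K s) k c =
      {σ | σ ∈ K.faces ∧ σ.card = k + 1 ∧ lowerStar s σ = c}.ncard :=
  simplexCount_apdOf F (faceClosed_faces K) (isIndexFiltration_indexFiltration hK s) k c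

/-- Any birth or finite death makes the simplex count positive at its height, and a simplex makes
the count positive at its own height. The dimension is therefore visible in every direction. -/
theorem apd_ne_zero_iff (hK : K.faces.Finite) (s : Pt d) (k : ℕ) :
    (apd F K s k ≠ 0 ∨ (1 ≤ k ∧ ∃ p ∈ apd F K s (k - 1), p.2 ≠ ⊤)) ↔
      ∃ σ ∈ K.faces, σ.card = k + 1 := by
  classical
  have hfin : ∀ c, {σ | σ ∈ K.faces ∧ σ.card = k + 1 ∧ lowerStar s σ = c}.Finite :=
    fun c => hK.subset fun _ h => h.1
  constructor
  · intro h
    suffices ∃ c, simplexCount (apd F K s) k c ≠ 0 by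
      obtain ⟨c, hc⟩ := this
      rw [simplexCount_apd F hK, Ne, Set.ncard_eq_zero (hfin c)] at hc
      obtain ⟨σ, h1, h2, _⟩ := Set.nonempty_iff_ne_empty.2 hc
      exact ⟨σ, h1, h2⟩
    rcases h with h | ⟨hk, p, hp, hp2⟩
    · obtain ⟨p, hp⟩ := Multiset.exists_mem_of_ne_zero h
      refine ⟨p.1, fun h0 => ?_⟩
      have := (Nat.add_eq_zero_iff.1 h0).1
      rw [Multiset.card_eq_zero] at this
      exact Multiset.notMem_zero p (this ▸ Multiset.mem_filter.2 ⟨hp, rfl⟩)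
    · obtain ⟨c, hc⟩ := (death_of_mem_apdOf F hp).resolve_left hp2
      refine ⟨c, fun h0 => ?_⟩
      have := (Nat.add_eq_zero_iff.1 h0).2
      rw [if_neg (by omega), Multiset.card_eq_zero] at this
      exact Multiset.notMem_zero p (this ▸ Multiset.mem_filter.2 ⟨hp, hc⟩)
  · rintro ⟨σ, h1, h2⟩
    by_contra! h
    have hpos : simplexCount (apd F K s) k (lowerStar s σ) ≠ 0 := by
      rw [simplexCount_apd F hK, Ne, Set.ncard_eq_zero (hfin _)]
      exact Set.nonempty_iff_ne_empty.1 ⟨σ, h1, h2, rfl⟩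
    apply hpos
    unfold simplexCount
    rw [h.1]
    simp only [Multiset.filter_zero, Multiset.card_zero, zero_add, ite_eq_left_iff,
      Multiset.card_eq_zero, Multiset.filter_eq_nil]
    intro hk p hp he
    rw [h.2 (by omega) p hp] at he
    exact EReal.top_ne_coe _ he

theorem dimOfDiagram_apd (hK : K.faces.Finite) (s : Pt d) {κ : ℕ} (h : HasDim K κ) :
    dimOfDiagram (apd F K s) = κ := by
  unfold dimOfDiagram
  simp only [apd_ne_zero_iff F hK s]
  exact h.csSup_eq

theorem card_le_of_hasDim {κ : ℕ} (h : HasDim K κ) {σ : Finset (Pt d)} (hσ : σ ∈ K.faces) :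
    σ.card ≤ κ + 1 := by
  have h0 := Finset.card_pos.2 (K.nonempty_of_mem_faces hσ)
  have h1 : σ.card - 1 ≤ κ := (show IsGreatest _ _ from h).2 ⟨σ, hσ, by omega⟩
  omega

theorem hasDim_congr {K' : Cpx d} (hK : K.faces.Finite) (hK' : K'.faces.Finite) {s : Pt d}
    (h : apd F K' s = apd F K s) {κ : ℕ} (hκ : HasDim K κ) : HasDim K' κ := by
  unfold HasDim at *
  simp only [← apd_ne_zero_iff F hK s, ← apd_ne_zero_iff F hK' s, h] at *
  exact hκ

@[simp]
theorem lowerStar_singleton (s v : Pt d) : lowerStar s {v} = ⟪s, v⟫_ℝ := by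
  simp [lowerStar]

theorem finite_vertices (hK : K.faces.Finite) : K.vertices.Finite := by
  have : K.vertices = (fun v => ({v} : Finset (Pt d))) ⁻¹' K.faces := rfl
  rw [this]
  exact hK.preimage (Finset.singleton_injective.injOn)

/-- In dimension zero there are no deaths of lower dimension to count, so the vertices at a height
are exactly the births there, with multiplicity. -/
theorem map_fst_apd_zero (hK : K.faces.Finite) (s : Pt d) :
    (apd F K s 0).map Prod.fst = (finite_vertices hK).toFinset.val.map (fun v => ⟪s, v⟫_ℝ) := by
  classical
  ext c
  rw [Multiset.count_map, Multiset.count_map]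
  have h := simplexCount_apd F hK s 0 c
  unfold simplexCount at h
  rw [if_pos rfl, add_zero] at h
  simp only [eq_comm (a := c)]
  refine h.trans ?_
  have h2 : {σ | σ ∈ K.faces ∧ σ.card = 0 + 1 ∧ lowerStar s σ = c} =
      (fun v => ({v} : Finset (Pt d))) ''
        ((finite_vertices hK).toFinset.filter (fun v => ⟪s, v⟫_ℝ = c)) := by
    ext σ
    simp only [zero_add, Finset.card_eq_one, Set.mem_ofPred_eq, Finset.coe_filter,
      Set.Finite.mem_toFinset, Set.mem_image]
    constructor
    · rintro ⟨h1, ⟨v, rfl⟩, h3⟩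
      exact ⟨v, ⟨h1, by simpa using h3⟩, rfl⟩
    · rintro ⟨v, ⟨h1, h3⟩, rfl⟩
      exact ⟨h1, ⟨v, rfl⟩, by simpa using h3⟩
  rw [h2, Set.ncard_image_of_injective _ Finset.singleton_injective, Set.ncard_coe_finset]
  rfl

end Complex

/-! ### Tilts -/

theorem finite_heightDiffs (H : List ℝ) (p : ℝ → ℝ → Prop) :
    {g | ∃ a ∈ H, ∃ b ∈ H, p a b ∧ g = b - a}.Finite := by
  have h : {x : ℝ | x ∈ H}.Finite := List.finite_toSet H
  refine ((h.prod h).image fun x => x.2 - x.1).subset ?_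
  rintro g ⟨a, ha, b, hb, _, rfl⟩
  exact ⟨(a, b), ⟨ha, hb⟩, rfl⟩

theorem heightGap_le {H : List ℝ} {a b : ℝ} (ha : a ∈ H) (hb : b ∈ H) (h : a < b) :
    heightGap H ≤ b - a :=
  csInf_le (finite_heightDiffs H (· < ·)).bddBelow ⟨a, ha, b, hb, h, rfl⟩

theorem heightGap_pos {H : List ℝ} (h : ∃ a ∈ H, ∃ b ∈ H, a < b) : 0 < heightGap H := by
  obtain ⟨a, ha, b, hb, hab⟩ := h
  have hne : {g | ∃ a ∈ H, ∃ b ∈ H, a < b ∧ g = b - a}.Nonempty := ⟨_, a, ha, b, hb, hab, rfl⟩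
  obtain ⟨a, _, b, _, hab, h⟩ := hne.csInf_mem (finite_heightDiffs H (· < ·))
  unfold heightGap
  rw [h]
  linarith

theorem le_heightSpread {H : List ℝ} {a b : ℝ} (ha : a ∈ H) (hb : b ∈ H) :
    b - a ≤ heightSpread H := by
  have h := (finite_heightDiffs H fun _ _ => True).bddAbove
  simp only [true_and] at h
  exact le_csSup h ⟨a, ha, b, hb, rfl⟩

theorem heightSpread_nonneg (H : List ℝ) : 0 ≤ heightSpread H := by
  rcases H with _ | ⟨a, H⟩
  · simp [heightSpread]
  · have := le_heightSpread (H := a :: H) (a := a) (b := a) (by simp) (by simp)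
    linarith

theorem tiltParam_pos (H H' : List ℝ) : 0 < tiltParam H H' := by
  unfold tiltParam
  split_ifs with h
  · have := heightGap_pos h
    have := heightSpread_nonneg H'
    positivity
  · norm_num

theorem tiltParam_le (H H' : List ℝ) : tiltParam H H' ≤ 1 / 2 := by
  unfold tiltParam
  split_ifs with h
  · have h1 := heightGap_pos h
    have h2 := heightSpread_nonneg H'
    have : heightGap H / (heightGap H + heightSpread H') ≤ 1 := div_le_one_of_le₀ (by linarith)
      (by linarith)
    linarith
  · norm_num

theorem tiltParam_congr {H₁ H₂ H₁' H₂' : List ℝ} (h : ∀ x, x ∈ H₁ ↔ x ∈ H₂)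
    (h' : ∀ x, x ∈ H₁' ↔ x ∈ H₂') : tiltParam H₁ H₁' = tiltParam H₂ H₂' := by
  unfold tiltParam heightGap heightSpread
  simp only [h, h']

/-- With gap `g` and spread `r`, the parameter satisfies `ε (g + r) = g / 2`. The new difference of
heights is at least `(1 - ε) g - ε r = g / 2 > 0`. -/
theorem tiltOfHeights_order {H H' : List ℝ} {a b a' b' : ℝ} (ha : a ∈ H) (hb : b ∈ H)
    (ha' : a' ∈ H') (hb' : b' ∈ H') (h : a < b) :
    (1 - tiltParam H H') * a + tiltParam H H' * a' <
      (1 - tiltParam H H') * b + tiltParam H H' * b' := by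
  have h0 : ∃ a ∈ H, ∃ b ∈ H, a < b := ⟨a, ha, b, hb, h⟩
  have h1 := heightGap_pos h0
  have h2 := heightSpread_nonneg H'
  have h3 := heightGap_le ha hb h
  have h4 := le_heightSpread hb' ha'
  have h5 := tiltParam_le H H'
  have h6 := tiltParam_pos H H'
  have h7 : tiltParam H H' * (heightGap H + heightSpread H') = heightGap H / 2 := by
    unfold tiltParam
    rw [if_pos h0]
    field_simp
  nlinarith [mul_le_mul_of_nonneg_left h3 (by linarith : 0 ≤ 1 - tiltParam H H'),
    mul_le_mul_of_nonneg_left h4 h6.le]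

/-- The unit vector `t` lies strictly between `s` and `s'`, and preserves the order in which `s`
sweeps over `V`. -/
structure IsTilt {d : ℕ} (V : Set (Pt d)) (s s' t : Pt d) : Prop where
  norm_eq : ‖t‖ = 1
  combination : ∃ a b : ℝ, 0 < a ∧ 0 < b ∧ t = a • s + b • s'
  lt_of_lt : ∀ u ∈ V, ∀ w ∈ V, ⟪s, u⟫_ℝ < ⟪s, w⟫_ℝ → ⟪t, u⟫_ℝ < ⟪t, w⟫_ℝ

theorem IsTilt.eq_of_eq {d : ℕ} {V : Set (Pt d)} {s s' t : Pt d} (h : IsTilt V s s' t)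
    {u w : Pt d} (h1 : ⟪s, u⟫_ℝ = ⟪s, w⟫_ℝ) (h2 : ⟪s', u⟫_ℝ = ⟪s', w⟫_ℝ) :
    ⟪t, u⟫_ℝ = ⟪t, w⟫_ℝ := by
  obtain ⟨a, b, _, _, rfl⟩ := h.combination
  simp only [inner_add_left, real_inner_smul_left, h1, h2]

theorem IsTilt.lt_of_eq {d : ℕ} {V : Set (Pt d)} {s s' t : Pt d} (h : IsTilt V s s' t)
    {u w : Pt d} (h1 : ⟪s, u⟫_ℝ = ⟪s, w⟫_ℝ) (h2 : ⟪s', u⟫_ℝ < ⟪s', w⟫_ℝ) :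
    ⟪t, u⟫_ℝ < ⟪t, w⟫_ℝ := by
  obtain ⟨a, b, _, hb, rfl⟩ := h.combination
  simp only [inner_add_left, real_inner_smul_left, h1]
  linarith [mul_lt_mul_of_pos_left h2 hb]

theorem isTilt_tiltOfHeights {d : ℕ} {V : Set (Pt d)} {s s' : Pt d} (hs : ‖s‖ = 1)
    (hs' : ‖s'‖ = 1) {H H' : List ℝ} (hH : ∀ x, x ∈ H ↔ ∃ v ∈ V, ⟪s, v⟫_ℝ = x)
    (hH' : ∀ x, x ∈ H' ↔ ∃ v ∈ V, ⟪s', v⟫_ℝ = x) : IsTilt V s s' (tiltOfHeights H H' s s') := by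
  set ε := tiltParam H H' with hε
  have hpos : 0 < ε := tiltParam_pos H H'
  have hle : ε ≤ 1 / 2 := tiltParam_le H H'
  have key : ∀ u ∈ V, ∀ w ∈ V, ⟪s, u⟫_ℝ < ⟪s, w⟫_ℝ →
      ⟪(1 - ε) • s + ε • s', u⟫_ℝ < ⟪(1 - ε) • s + ε • s', w⟫_ℝ := by
    intro u hu w hw h
    simp only [inner_add_left, real_inner_smul_left]
    exact tiltOfHeights_order ((hH _).2 ⟨u, hu, rfl⟩) ((hH _).2 ⟨w, hw, rfl⟩)
      ((hH' _).2 ⟨u, hu, rfl⟩) ((hH' _).2 ⟨w, hw, rfl⟩) h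
  -- Normalization needs a nonzero combination. A strict height difference that survives proves
  -- this; if there is none, `ε = 1 / 4` gives the two summands different lengths, so they cannot
  -- cancel even when `s' = -s`.
  have hne : (1 - ε) • s + ε • s' ≠ 0 := by
    intro h0
    by_cases hex : ∃ a ∈ H, ∃ b ∈ H, a < b
    · obtain ⟨a, ha, b, hb, hab⟩ := hex
      obtain ⟨u, hu, rfl⟩ := (hH _).1 ha
      obtain ⟨w, hw, rfl⟩ := (hH _).1 hb
      have := key u hu w hw hab
      simp [h0] at this
    · have h1 : ε = 1 / 4 := by rw [hε, tiltParam, if_neg hex]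
      have h2 := congrArg norm (eq_neg_of_add_eq_zero_left h0)
      rw [norm_neg, norm_smul, norm_smul, hs, hs', h1] at h2
      norm_num at h2
  have hn : 0 < ‖(1 - ε) • s + ε • s'‖⁻¹ := inv_pos.2 (norm_pos_iff.2 hne)
  refine ⟨?_, ⟨‖(1 - ε) • s + ε • s'‖⁻¹ * (1 - ε), ‖(1 - ε) • s + ε • s'‖⁻¹ * ε,
    mul_pos hn (by linarith), mul_pos hn hpos, ?_⟩, ?_⟩
  · unfold tiltOfHeights
    rw [norm_smul, norm_inv, norm_norm]
    exact inv_mul_cancel₀ (norm_ne_zero_iff.2 hne)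
  · unfold tiltOfHeights
    simp only [smul_add, smul_smul]
    rfl
  · intro u hu w hw h
    change ⟪‖(1 - ε) • s + ε • s'‖⁻¹ • ((1 - ε) • s + ε • s'), u⟫_ℝ <
      ⟪‖(1 - ε) • s + ε • s'‖⁻¹ • ((1 - ε) • s + ε • s'), w⟫_ℝ
    rw [real_inner_smul_left, real_inner_smul_left]
    exact mul_lt_mul_of_pos_left (key u hu w hw h) hn

theorem isTilt_tilt {d : ℕ} (V : List (Pt d)) {s s' : Pt d} (hs : ‖s‖ = 1) (hs' : ‖s'‖ = 1) :
    IsTilt {v | v ∈ V} s s' (tilt V s s') :=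
  isTilt_tiltOfHeights hs hs' (by simp) (by simp)

/-! ### Running oracle algorithms -/

namespace OracleAlg

variable {Q R α β : Type} (O : Q → R)

theorem output_bind (x : OracleAlg Q R α) (g : α → OracleAlg Q R β) :
    (x >>= g).output O = (g (x.output O)).output O := by
  change (x.andThen g).output O = _
  induction x with
  | done a => rfl
  | ask q next ih => exact ih _

theorem asked_bind (x : OracleAlg Q R α) (g : α → OracleAlg Q R β) :
    (x >>= g).asked O = x.asked O ++ (g (x.output O)).asked O := by
  change (x.andThen g).asked O = _
  induction x with
  | done a => rfl
  | ask q next ih => exact congrArg (q :: ·) (ih _)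

@[simp]
theorem output_pure (a : α) : (pure a : OracleAlg Q R α).output O = a := rfl

@[simp]
theorem asked_pure (a : α) : (pure a : OracleAlg Q R α).asked O = [] := rfl

@[simp]
theorem output_query (q : Q) : (query q : OracleAlg Q R R).output O = O q := rfl

@[simp]
theorem asked_query (q : Q) : (query q : OracleAlg Q R R).asked O = [q] := rfl

theorem output_foldlM (f : β → α → OracleAlg Q R β) (b : β) (l : List α) :
    (l.foldlM f b).output O = l.foldl (fun b a => (f b a).output O) b := by
  induction l generalizing b with
  | nil => rfl
  | cons a l ih => rw [List.foldlM_cons, output_bind, ih]; rfl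

/-- The hypothesis is uniform in the accumulator, so the number of questions can be bounded without
knowing that the intermediate results are correct. -/
theorem length_asked_foldlM_le {f : β → α → OracleAlg Q R β} {l : List α} {n : ℕ}
    (h : ∀ b, ∀ a ∈ l, ((f b a).asked O).length ≤ n) (b : β) :
    ((l.foldlM f b).asked O).length ≤ l.length * n := by
  induction l generalizing b with
  | nil => simp
  | cons a l ih =>
    rw [List.foldlM_cons, asked_bind, List.length_append, List.length_cons]
    have h1 := h b a (by simp)
    have h2 := ih (fun b a ha => h b a (by simp [ha])) ((f b a).output O)
    linarith

theorem forall_asked_foldlM {f : β → α → OracleAlg Q R β} {l : List α} {P : Q → Prop}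
    (h : ∀ b, ∀ a ∈ l, ∀ q ∈ (f b a).asked O, P q) (b : β) :
    ∀ q ∈ (l.foldlM f b).asked O, P q := by
  induction l generalizing b with
  | nil => simp
  | cons a l ih =>
    rw [List.foldlM_cons, asked_bind]
    intro q hq
    rcases List.mem_append.1 hq with hq | hq
    · exact h b a (by simp) q hq
    · exact ih (fun b a ha => h b a (by simp [ha])) _ q hq

/-- An adaptive run depends on the oracle only through the answers along its own path, so agreement
on the questions asked in one run forces the other run to be identical. This is what turns
reconstruction into faithfulness. -/
theorem congr_oracle {O O' : Q → R} {x : OracleAlg Q R α} (h : ∀ q ∈ x.asked O, O' q = O q) :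
    x.output O' = x.output O ∧ x.asked O' = x.asked O := by
  induction x with
  | done a => exact ⟨rfl, rfl⟩
  | ask q next ih =>
    have hq : O' q = O q := h q (by simp [asked])
    have := ih (O q) fun r hr => h r (by simp [asked, hr])
    simp only [output, asked, hq, this, and_self]

end OracleAlg

/-! ### Existence of directions -/

/-- All points of `T` have the same height in direction `s`. -/
def IsLevel {d : ℕ} (s : Pt d) (T : Finset (Pt d)) : Prop :=
  ∀ u ∈ T, ∀ w ∈ T, ⟪s, u⟫_ℝ = ⟪s, w⟫_ℝ

/-- Differences to a base point of an affinely independent set are linearly independent. A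
functional may thus be prescribed on them, extended to the whole space, and represented by a vector.
-/
theorem exists_inner_sub_eq {d : ℕ} {T : Finset (Pt d)}
    (hT : AffineIndependent ℝ ((↑) : T → Pt d)) {p : Pt d} (hp : p ∈ T) (g : Pt d → ℝ) :
    ∃ s : Pt d, ∀ v ∈ T, ⟪s, v⟫_ℝ - ⟪s, p⟫_ℝ = g v - g p := by
  have hli := (affineIndependent_iff_linearIndependent_vsub ℝ _ (⟨p, hp⟩ : T)).1 hT
  obtain ⟨φ, hφ⟩ := LinearMap.exists_extend
    ((Module.Basis.span hli).constr ℝ (fun i => g i.1 - g p))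
  refine ⟨(InnerProductSpace.toDual ℝ (Pt d)).symm (LinearMap.toContinuousLinearMap φ), ?_⟩
  intro v hv
  rw [← inner_sub_right, InnerProductSpace.toDual_symm_apply,
    LinearMap.coe_toContinuousLinearMap']
  by_cases h : v = p
  · simp [h]
  · let i : {x : T // x ≠ ⟨p, hp⟩} := ⟨⟨v, hv⟩, fun e => h (congrArg Subtype.val e)⟩
    have h1 := LinearMap.congr_fun hφ (Module.Basis.span hli i)
    rw [Module.Basis.constr_basis, LinearMap.comp_apply, Submodule.subtype_apply,
      Module.Basis.span_apply] at h1
    exact h1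

theorem norm_inv_norm_smul {d : ℕ} {s : Pt d} (hs : s ≠ 0) : ‖‖s‖⁻¹ • s‖ = 1 := by
  rw [norm_smul, norm_inv, norm_norm]
  exact inv_mul_cancel₀ (norm_ne_zero_iff.2 hs)

/-- Prescribe height `0` on `τ` and `1` on the rest of `σ`. That `τ` is a proper face makes the
direction nonzero. -/
theorem exists_level_below {d : ℕ} {σ τ : Finset (Pt d)}
    (hσ : AffineIndependent ℝ ((↑) : σ → Pt d)) (hτ : τ.Nonempty) (h : τ ⊂ σ) :
    ∃ s : Pt d, (IsLevel s τ ∧ ∀ w ∈ τ, ∀ x ∈ σ, x ∉ τ → ⟪s, w⟫_ℝ < ⟪s, x⟫_ℝ) ∧ ‖s‖ = 1 := by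
  classical
  obtain ⟨p, hp⟩ := hτ
  obtain ⟨s, hs⟩ := exists_inner_sub_eq hσ (h.subset hp) (fun v => if v ∈ τ then 0 else 1)
  simp only [hp, if_true, sub_zero] at hs
  have h1 : ∀ w ∈ τ, ⟪s, w⟫_ℝ = ⟪s, p⟫_ℝ := fun w hw => by
    have := hs w (h.subset hw)
    rw [if_pos hw] at this
    linarith
  have h2 : ∀ x ∈ σ, x ∉ τ → ⟪s, p⟫_ℝ < ⟪s, x⟫_ℝ := fun x hx hxτ => by
    have := hs x hx
    rw [if_neg hxτ] at this
    linarith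
  have hne : s ≠ 0 := by
    rintro rfl
    obtain ⟨x, hx, hxτ⟩ := Finset.exists_of_ssubset h
    simpa using h2 x hx hxτ
  refine ⟨‖s‖⁻¹ • s, ⟨fun u hu w hw => ?_, fun w hw x hx hxτ => ?_⟩, norm_inv_norm_smul hne⟩
  · rw [real_inner_smul_left, real_inner_smul_left, h1 u hu, h1 w hw]
  · rw [real_inner_smul_left, real_inner_smul_left, h1 w hw]
    exact mul_lt_mul_of_pos_left (h2 x hx hxτ) (inv_pos.2 (norm_pos_iff.2 hne))

/-- Being level on `T` imposes at most `d - 1` linear conditions on a `d`-dimensional space. -/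
theorem exists_level_ne_zero {d : ℕ} {T : Finset (Pt d)} (hT : T.Nonempty) (hc : T.card ≤ d) :
    ∃ s : Pt d, IsLevel s T ∧ s ≠ 0 := by
  classical
  obtain ⟨p, hp⟩ := hT
  let f : Pt d →ₗ[ℝ] (T.erase p → ℝ) :=
    LinearMap.pi fun v => ((innerₗ (Pt d)).flip (v.1 - p))
  have hf : LinearMap.ker f ≠ ⊥ := by
    apply LinearMap.ker_ne_bot_of_finrank_lt
    have := Finset.card_pos.2 ⟨p, hp⟩
    simp [Finset.card_erase_of_mem hp]
    omega
  obtain ⟨s, hs, hne⟩ := Submodule.exists_mem_ne_zero_of_ne_bot hf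
  have h1 : ∀ u ∈ T, ⟪s, u⟫_ℝ = ⟪s, p⟫_ℝ := by
    intro u hu
    by_cases e : u = p
    · rw [e]
    · have := congrFun (LinearMap.mem_ker.1 hs) ⟨u, Finset.mem_erase.2 ⟨e, hu⟩⟩
      simp only [f, LinearMap.pi_apply, LinearMap.flip_apply, innerₗ_apply_apply, inner_sub_right,
        Pi.zero_apply] at this
      linarith
  exact ⟨s, fun u hu w hw => by rw [h1 u hu, h1 w hw], hne⟩

/-- The directions that are level on `T` form a subspace. By affine independence of `T ∪ {q}`, each
further vertex `q` excludes only a proper subspace of it, and a real vector space is not a finite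
union of proper subspaces. -/
theorem exists_level_isolating {d : ℕ} {T : Finset (Pt d)} {V : Set (Pt d)} (hV : V.Finite)
    (hgp : ∀ S : Finset (Pt d), ↑S ⊆ V → S.card ≤ d + 1 → AffineIndependent ℝ ((↑) : S → Pt d))
    (hTV : ↑T ⊆ V) (hT : T.Nonempty) (hc : T.card ≤ d) :
    ∃ s : Pt d, (IsLevel s T ∧ ∀ q ∈ V, q ∉ T → ∀ u ∈ T, ⟪s, q⟫_ℝ ≠ ⟪s, u⟫_ℝ) ∧ ‖s‖ = 1 := by
  classical
  suffices ∃ s : Pt d, (IsLevel s T ∧ ∀ q ∈ V, q ∉ T → ∀ u ∈ T, ⟪s, q⟫_ℝ ≠ ⟪s, u⟫_ℝ) ∧ s ≠ 0 by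
    obtain ⟨s, ⟨h1, h2⟩, hne⟩ := this
    have hn := inv_ne_zero (norm_ne_zero_iff.2 hne)
    refine ⟨‖s‖⁻¹ • s, ⟨fun u hu w hw => ?_, fun q hq hqT u hu => ?_⟩, norm_inv_norm_smul hne⟩
    · rw [real_inner_smul_left, real_inner_smul_left, h1 u hu w hw]
    · rw [real_inner_smul_left, real_inner_smul_left]
      exact fun e => h2 q hq hqT u hu (mul_left_cancel₀ hn e)
  -- A further vertex also certifies that the direction is nonzero. If there is none, nonvanishing
  -- has to come from a dimension count.
  by_cases hVT : ∃ q ∈ V, q ∉ T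
  · obtain ⟨p, hp⟩ := hT
    let W : Submodule ℝ (Pt d) := ⨅ v : T, LinearMap.ker ((innerₗ (Pt d)).flip (v.1 - p))
    have hW : ∀ s, s ∈ W ↔ ∀ v ∈ T, ⟪s, v⟫_ℝ = ⟪s, p⟫_ℝ := by
      intro s
      simp only [W, Submodule.mem_iInf, LinearMap.mem_ker, LinearMap.flip_apply,
        innerₗ_apply_apply, inner_sub_right, sub_eq_zero, Subtype.forall]
    have : Finite {q // q ∈ V ∧ q ∉ T} := (hV.subset fun _ h => h.1).to_subtype
    obtain ⟨s, hs, hs2⟩ := Module.Dual.exists_forall_mem_ne_zero_of_forall_exists W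
      (fun q : {q // q ∈ V ∧ q ∉ T} => (innerₗ (Pt d)).flip (q.1 - p)) (by
        rintro ⟨q, hq, hqT⟩
        obtain ⟨s, hs⟩ := exists_inner_sub_eq (T := insert q T)
          (hgp _ (by rw [Finset.coe_insert]; exact Set.insert_subset hq hTV)
            (by rw [Finset.card_insert_of_notMem hqT]; omega))
          (Finset.mem_insert_of_mem hp) (fun v => if v ∈ T then 0 else 1)
        refine ⟨s, (hW s).2 fun v hv => ?_, ?_⟩
        · have := hs v (Finset.mem_insert_of_mem hv)
          rw [if_pos hv, if_pos hp] at this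
          linarith
        · have := hs q (Finset.mem_insert_self _ _)
          rw [if_neg hqT, if_pos hp] at this
          simp only [LinearMap.flip_apply, innerₗ_apply_apply, inner_sub_right]
          linarith)
    rw [hW] at hs
    have h3 : ∀ q ∈ V, q ∉ T → ∀ u ∈ T, ⟪s, q⟫_ℝ ≠ ⟪s, u⟫_ℝ := by
      intro q hq hqT u hu e
      apply hs2 ⟨q, hq, hqT⟩
      simp only [LinearMap.flip_apply, innerₗ_apply_apply, inner_sub_right]
      rw [e, hs u hu, sub_self]
    refine ⟨s, ⟨fun u hu w hw => by rw [hs u hu, hs w hw], h3⟩, ?_⟩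
    rintro rfl
    obtain ⟨q, hq, hqT⟩ := hVT
    simpa using h3 q hq hqT p hp
  · push Not at hVT
    obtain ⟨s, h1, h2⟩ := exists_level_ne_zero hT hc
    exact ⟨s, ⟨h1, fun q hq hqT => absurd (hVT q hq) hqT⟩, h2⟩

/-! ### The plane of the first two coordinates -/

theorem coord_of_lt {d j : ℕ} (h : j < d) (x : Pt d) : coord x j = x ⟨j, h⟩ := dif_pos h

theorem inner_basisVec {d : ℕ} (j : ℕ) (x : Pt d) : ⟪basisVec d j, x⟫_ℝ = coord x j := by
  unfold basisVec coord
  split_ifs with h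
  · simp [EuclideanSpace.inner_single_left]
  · simp

theorem norm_basisVec {d j : ℕ} (h : j < d) : ‖basisVec d j‖ = 1 := by
  unfold basisVec
  rw [dif_pos h]
  simp

theorem inner_eq_of_planar {d : ℕ} (hd : 2 ≤ d) {s : Pt d}
    (hs : ∀ i : Fin d, 2 ≤ (i : ℕ) → s i = 0) (x : Pt d) :
    ⟪s, x⟫_ℝ = coord s 0 * coord x 0 + coord s 1 * coord x 1 := by
  obtain ⟨n, rfl⟩ : ∃ n, d = n + 2 := ⟨d - 2, by omega⟩
  rw [PiLp.inner_apply, Fin.sum_univ_succ, Fin.sum_univ_succ, Finset.sum_eq_zero, add_zero,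
    coord_of_lt (by omega), coord_of_lt (by omega), coord_of_lt (by omega), coord_of_lt (by omega)]
  · simp only [RCLike.inner_apply, conj_trivial]
    rw [mul_comm, add_comm, mul_comm, add_comm]
    rfl
  · intro i _
    rw [hs _ (by simp)]
    simp

theorem coord_one_sub {d : ℕ} {v w : Pt d} (h : coord w 0 ≠ coord v 0) :
    coord w 1 - coord v 1 = slopeFrom v w * (coord w 0 - coord v 0) := by
  unfold slopeFrom
  rw [div_mul_cancel₀ _ (sub_ne_zero.2 h)]

theorem inner_sub_inner_of_planar {d : ℕ} (hd : 2 ≤ d) {s : Pt d}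
    (hs : ∀ i : Fin d, 2 ≤ (i : ℕ) → s i = 0) {v w : Pt d} (h : coord w 0 ≠ coord v 0) :
    ⟪s, w⟫_ℝ - ⟪s, v⟫_ℝ =
      (coord w 0 - coord v 0) * (coord s 0 + coord s 1 * slopeFrom v w) := by
  rw [inner_eq_of_planar hd hs, inner_eq_of_planar hd hs]
  have := coord_one_sub h
  linear_combination coord s 1 * this

/-- Equal slopes from `v` would put three projected vertices on a line. Hence the radial order
around `v` has no ties. -/
theorem slopeFrom_injOn {d : ℕ} {V : Set (Pt d)} (hd : 2 ≤ d) (hV : GeneralPosition V)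
    {v u w : Pt d} (hv : v ∈ V) (hu : u ∈ V) (hw : w ∈ V) (hvu : coord u 0 ≠ coord v 0)
    (hvw : coord w 0 ≠ coord v 0) (h : slopeFrom v u = slopeFrom v w) : u = w := by
  by_contra hne
  apply hV.proj_not_collinear hd v hv u hu w hw (fun e => hvu (by rw [e])) hne
    (fun e => hvw (by rw [e]))
  rw [collinear_iff_of_mem (p₀ := proj₂ v) (by simp)]
  have key : ∀ x : Pt d, coord x 0 ≠ coord v 0 → slopeFrom v x = slopeFrom v w →
      proj₂ x = (coord x 0 - coord v 0) • (!₂[1, slopeFrom v w] : EuclideanSpace ℝ (Fin 2)) +ᵥ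
        proj₂ v := by
    intro x hx e
    have h1 := coord_one_sub hx
    rw [e] at h1
    ext i
    fin_cases i
    · simp [proj₂]
    · simp [proj₂]
      linarith
  refine ⟨!₂[1, slopeFrom v w], ?_⟩
  intro p hp
  simp only [Set.mem_insert_iff, Set.mem_singleton_iff] at hp
  rcases hp with rfl | rfl | rfl
  · exact ⟨0, by simp⟩
  · exact ⟨_, key u hvu h⟩
  · exact ⟨_, key w hvw rfl⟩

theorem exists_splitDirection {d : ℕ} (hd : 2 ≤ d) {V : List (Pt d)}
    (hinj : ∀ u ∈ V, ∀ w ∈ V, coord u 0 = coord w 0 → u = w) {v : Pt d} (hv : v ∈ V)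
    {A B : List (Pt d)} (hA : ∀ w ∈ A, coord v 0 < coord w 0) (hB : ∀ w ∈ B, coord v 0 < coord w 0)
    (hAB : ∀ a ∈ A, ∀ b ∈ B, slopeFrom v a < slopeFrom v b) (hAne : A ≠ []) (hBne : B ≠ []) :
    ∃ s : Pt d, ((∀ i : Fin d, 2 ≤ (i : ℕ) → s i = 0) ∧ (∀ w ∈ A, ⟪s, w⟫_ℝ < ⟪s, v⟫_ℝ) ∧
      (∀ w ∈ B, ⟪s, v⟫_ℝ < ⟪s, w⟫_ℝ) ∧ ∀ w ∈ V, w ≠ v → ⟪s, w⟫_ℝ ≠ ⟪s, v⟫_ℝ) ∧ ‖s‖ = 1 := by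
  obtain ⟨a, ha, ha'⟩ := Set.exists_max_image {w | w ∈ A} (slopeFrom v) (List.finite_toSet A)
    (List.exists_mem_of_ne_nil A hAne)
  obtain ⟨b, hb, hb'⟩ := Set.exists_min_image {w | w ∈ B} (slopeFrom v) (List.finite_toSet B)
    (List.exists_mem_of_ne_nil B hBne)
  -- The direction will be proportional to `(-α, 1, 0, …)`, for which the height of `w` relative to
  -- `v` is a positive multiple of `(coord w 0 - coord v 0) * (slopeFrom v w - α)`. Thus `α` must
  -- separate the slopes of `A` from those of `B`, and must avoid the finitely many slopes of all
  -- vertices so that none ties with `v`, including those below `v`.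
  obtain ⟨α, hα, hαV⟩ := (Set.Ioo_infinite (hAB a ha b hb)).exists_notMem_finite
    ((List.finite_toSet V).image (slopeFrom v))
  let s : Pt d := WithLp.toLp 2 fun i => if (i : ℕ) = 0 then -α else if (i : ℕ) = 1 then 1 else 0
  have hs : ∀ i : Fin d, 2 ≤ (i : ℕ) → s i = 0 := by
    intro i hi
    change (if (i : ℕ) = 0 then -α else if (i : ℕ) = 1 then 1 else 0) = 0
    rw [if_neg (by omega), if_neg (by omega)]
  have h0 : coord s 0 = -α := by rw [coord_of_lt (by omega)]; rfl
  have h1 : coord s 1 = 1 := by rw [coord_of_lt (by omega)]; rfl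
  have key : ∀ w, coord w 0 ≠ coord v 0 →
      ⟪s, w⟫_ℝ - ⟪s, v⟫_ℝ = (coord w 0 - coord v 0) * (slopeFrom v w - α) := by
    intro w hw
    rw [inner_sub_inner_of_planar hd hs hw, h0, h1]
    ring
  have hne : s ≠ 0 := by
    intro e
    rw [e, coord_of_lt (by omega)] at h1
    simp at h1
  have hn : 0 < ‖s‖⁻¹ := inv_pos.2 (norm_pos_iff.2 hne)
  refine ⟨‖s‖⁻¹ • s, ⟨fun i hi => ?_, fun w hw => ?_, fun w hw => ?_, fun w hw hwv => ?_⟩,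
    norm_inv_norm_smul hne⟩
  · rw [PiLp.smul_apply, hs i hi, smul_zero]
  · rw [real_inner_smul_left, real_inner_smul_left]
    refine mul_lt_mul_of_pos_left ?_ hn
    have h2 := hA w hw
    have h3 := key w h2.ne'
    have h4 := ha' w hw
    nlinarith [mul_pos (sub_pos.2 h2) (by linarith [hα.1] : 0 < α - slopeFrom v w)]
  · rw [real_inner_smul_left, real_inner_smul_left]
    refine mul_lt_mul_of_pos_left ?_ hn
    have h2 := hB w hw
    have h3 := key w h2.ne'
    have h4 := hb' w hw
    nlinarith [mul_pos (sub_pos.2 h2) (by linarith [hα.2] : 0 < slopeFrom v w - α)]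
  · rw [real_inner_smul_left, real_inner_smul_left]
    intro e
    have h2 : coord w 0 ≠ coord v 0 := fun e => hwv (hinj w hw v hv e)
    have h3 := key w h2
    rw [mul_left_cancel₀ hn.ne' e, sub_self] at h3
    rcases mul_eq_zero.1 h3.symm with h | h
    · exact h2 (sub_eq_zero.1 h)
    · exact hαV ⟨w, hw, sub_eq_zero.1 h⟩

/-! ### The vertices -/

section Vertices

variable (F : Type*) [Field F] {d : ℕ} {K : Cpx d}

/-- `vs` lists the vertices of `K`, each once. -/
def ListsVertices (K : Cpx d) (vs : List (Pt d)) : Prop := vs.Nodup ∧ ∀ v, v ∈ vs ↔ v ∈ K.vertices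

theorem ListsVertices.length_eq {vs : List (Pt d)} (h : ListsVertices K vs) :
    vs.length = K.vertices.ncard := by
  classical
  have : K.vertices = ↑vs.toFinset := by
    ext v
    simp [h.2]
  rw [this, Set.ncard_coe_finset, List.toFinset_card_of_nodup h.1]

theorem ListsVertices.coe_eq {vs : List (Pt d)} (h : ListsVertices K vs) (hK : K.faces.Finite) :
    (vs : Multiset (Pt d)) = (finite_vertices hK).toFinset.val := by
  rw [Multiset.Nodup.ext (Multiset.coe_nodup.2 h.1) (Finset.nodup _)]
  intro v
  rw [Multiset.mem_coe, h.2]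
  simp

theorem mem_sortedBirths (hK : K.faces.Finite) (s : Pt d) (x : ℝ) :
    x ∈ sortedBirths (apd F K s) ↔ ∃ v ∈ K.vertices, ⟪s, v⟫_ℝ = x := by
  unfold sortedBirths
  rw [Multiset.mem_sort, map_fst_apd_zero F hK]
  simp

/-- The births are the vertex heights as a multiset, and a sorted list of reals is determined by its
multiset. Ties are harmless because only the heights are listed. -/
theorem sortedBirths_eq_map (hK : K.faces.Finite) {s : Pt d} {vs : List (Pt d)}
    (h : ListsVertices K vs) (hs : vs.Pairwise (fun u w => ⟪s, u⟫_ℝ ≤ ⟪s, w⟫_ℝ)) :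
    sortedBirths (apd F K s) = vs.map (fun v => ⟪s, v⟫_ℝ) := by
  unfold sortedBirths
  rw [map_fst_apd_zero F hK, ← h.coe_eq hK]
  refine List.Perm.eq_of_pairwise (le := (· ≤ ·)) (fun a b _ _ => le_antisymm)
    (Multiset.pairwise_sort _ _) (List.pairwise_map.2 hs) ?_
  rw [← Multiset.coe_eq_coe, Multiset.sort_eq]
  rfl

theorem exists_sorted_listsVertices (hK : K.faces.Finite)
    (hinj : Set.InjOn (fun v => ⟪basisVec d 0, v⟫_ℝ) K.vertices) :
    ∃ vs, ListsVertices K vs ∧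
      vs.Pairwise (fun u w => ⟪basisVec d 0, u⟫_ℝ < ⟪basisVec d 0, w⟫_ℝ) := by
  classical
  let vs := (finite_vertices hK).toFinset.toList.mergeSort
    (fun u w => decide (⟪basisVec d 0, u⟫_ℝ ≤ ⟪basisVec d 0, w⟫_ℝ))
  have hvs : ListsVertices K vs :=
    ⟨(List.mergeSort_perm _ _).nodup_iff.2 (Finset.nodup_toList _), fun v => by simp [vs]⟩
  refine ⟨vs, hvs, ?_⟩
  have h := List.pairwise_mergeSort
    (le := fun u w => decide (⟪basisVec d 0, u⟫_ℝ ≤ ⟪basisVec d 0, w⟫_ℝ))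
    (by intro a b c; simpa using le_trans) (by intro a b; simpa using le_total _ _)
    (finite_vertices hK).toFinset.toList
  refine (h.and hvs.1).imp_of_mem ?_
  intro u w hu hw ⟨h1, h2⟩
  rw [decide_eq_true_eq] at h1
  exact h1.lt_of_ne fun e => h2 (hinj ((hvs.2 u).1 hu) ((hvs.2 w).1 hw) e)

theorem coord_smul_add_smul (a b : ℝ) (x y : Pt d) (j : ℕ) :
    coord (a • x + b • y) j = a * coord x j + b * coord y j := by
  unfold coord
  split_ifs <;> simp

theorem coord_basisVec {i j : ℕ} (hi : i < d) : coord (basisVec d i) j = if i = j then 1 else 0 := by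
  unfold coord basisVec
  rw [dif_pos hi]
  split_ifs with h1 h2 h2
  · subst h2; simp
  · have : (⟨j, h1⟩ : Fin d) ≠ ⟨i, hi⟩ := fun e => h2 (Fin.mk.inj e).symm
    simp [this]
  · omega
  · rfl

theorem findCoord_spec (hK : K.faces.Finite) {vs : List (Pt d)} (h : ListsVertices K vs)
    (hs : vs.Pairwise (fun u w => ⟪basisVec d 0, u⟫_ℝ < ⟪basisVec d 0, w⟫_ℝ)) {j : ℕ} (hj : 1 ≤ j)
    (hjd : j < d) :
    (findCoord d (vs.map (fun v => coord v 0)) j).output (apd F K) =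
      vs.map (fun v => coord v j) ∧
    (∀ q ∈ (findCoord d (vs.map (fun v => coord v 0)) j).asked (apd F K), ‖q‖ = 1) ∧
    ((findCoord d (vs.map (fun v => coord v 0)) j).asked (apd F K)).length = 2 := by
  set s := tiltOfHeights (vs.map (fun v => coord v 0)) (sortedBirths (apd F K (basisVec d j)))
    (basisVec d 0) (basisVec d j) with hsdef
  have ht : IsTilt K.vertices (basisVec d 0) (basisVec d j) s := by
    refine isTilt_tiltOfHeights (norm_basisVec (by omega)) (norm_basisVec hjd) (fun x => ?_)
      (mem_sortedBirths F hK _)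
    simp [h.2, inner_basisVec]
  have hsort : sortedBirths (apd F K s) = vs.map (fun v => ⟪s, v⟫_ℝ) :=
    sortedBirths_eq_map F hK h (hs.imp_of_mem fun hu hw hlt =>
      (ht.lt_of_lt _ ((h.2 _).1 hu) _ ((h.2 _).1 hw) hlt).le)
  have hout : (findCoord d (vs.map (fun v => coord v 0)) j).output (apd F K) =
      List.zipWith (fun hs h₁ => (hs - coord s 0 * h₁) / coord s j) (sortedBirths (apd F K s))
        (vs.map (fun v => coord v 0)) := rfl
  have hask : (findCoord d (vs.map (fun v => coord v 0)) j).asked (apd F K) =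
      [basisVec d j, s] := rfl
  refine ⟨?_, ?_, ?_⟩
  · rw [hout, hsort, List.zipWith_map, List.zipWith_self]
    refine List.map_congr_left fun v _ => ?_
    -- The tilt is `a • e_1 + b • e_j`, so its two relevant coordinates are `a` and `b`. Since `b >
    -- 0`, the height equation can be solved for the `j`-th coordinate of the vertex.
    obtain ⟨a, b, ha, hb, e⟩ := ht.combination
    rw [e, coord_smul_add_smul, coord_smul_add_smul, coord_basisVec (by omega),
      coord_basisVec (by omega), coord_basisVec (by omega), coord_basisVec (by omega),
      if_pos rfl, if_neg (by omega), if_neg (by omega), if_pos rfl, inner_add_left,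
      real_inner_smul_left, real_inner_smul_left, inner_basisVec, inner_basisVec]
    field_simp
    ring
  · rw [hask]
    intro q hq
    simp only [List.mem_cons, List.not_mem_nil, or_false] at hq
    rcases hq with rfl | rfl
    · exact norm_basisVec hjd
    · exact ht.norm_eq
  · rw [hask]; rfl

theorem foldl_append_singleton {α β : Type*} (f : α → β) (l : List α) (b : List β) :
    l.foldl (fun b a => b ++ [f a]) b = b ++ l.map f := by
  induction l generalizing b with
  | nil => simp
  | cons a l ih => simp [ih]

/-- Only distinct first coordinates are needed: tilts of `e_1` preserve the vertex order, so all
columns list the vertices in the same order. Demanding no other part of general position is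
essential when this is applied to a competing complex. -/
theorem findVertices_spec (hd : 1 ≤ d) (hK : K.faces.Finite)
    (hinj : Set.InjOn (fun v => ⟪basisVec d 0, v⟫_ℝ) K.vertices) :
    ListsVertices K ((findVertices d (apd F K (basisVec d 0))).output (apd F K)) ∧
    (∀ q ∈ (findVertices d (apd F K (basisVec d 0))).asked (apd F K), ‖q‖ = 1) ∧
    ((findVertices d (apd F K (basisVec d 0))).asked (apd F K)).length ≤ (d - 1) * 2 := by
  obtain ⟨vs, h, hs⟩ := exists_sorted_listsVertices hK hinj
  have hH : sortedBirths (apd F K (basisVec d 0)) = vs.map (fun v => coord v 0) := by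
    rw [sortedBirths_eq_map F hK h (hs.imp fun h => h.le)]
    simp only [inner_basisVec]
  have hcol : ∀ j ∈ List.range' 1 (d - 1), 1 ≤ j ∧ j < d := by
    intro j hj
    rw [List.mem_range'_1] at hj
    omega
  unfold findVertices
  rw [hH]
  simp only [OracleAlg.output_bind, OracleAlg.asked_bind, OracleAlg.asked_pure, List.append_nil,
    OracleAlg.output_pure, OracleAlg.output_foldlM]
  refine ⟨?_, ?_, ?_⟩
  · rw [List.foldl_ext _ (fun cols j => cols ++ [vs.map (fun v => coord v j)]) _
      (fun cols j hj => by rw [(findCoord_spec F hK h hs (hcol j hj).1 (hcol j hj).2).1]),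
      foldl_append_singleton]
    have hr : [vs.map (fun v => coord v 0)] ++
        (List.range' 1 (d - 1)).map (fun j => vs.map (fun v => coord v j)) =
        (List.range d).map (fun j => vs.map (fun v => coord v j)) := by
      obtain ⟨n, rfl⟩ : ∃ n, d = n + 1 := ⟨d - 1, by omega⟩
      rw [List.range_eq_range', List.range'_succ]
      rfl
    rw [hr]
    convert h
    refine List.ext_getElem (by simp) fun m h1 h2 => ?_
    ext i
    simp [coord, List.getElem?_eq_getElem h2]
  · refine OracleAlg.forall_asked_foldlM _ (fun cols j hj => ?_) _
    rw [OracleAlg.asked_bind, OracleAlg.asked_pure, List.append_nil]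
    exact (findCoord_spec F hK h hs (hcol j hj).1 (hcol j hj).2).2.1
  · refine (OracleAlg.length_asked_foldlM_le _ (n := 2) (fun cols j hj => ?_) _).trans ?_
    · rw [OracleAlg.asked_bind, OracleAlg.asked_pure, List.append_nil]
      exact (findCoord_spec F hK h hs (hcol j hj).1 (hcol j hj).2).2.2.le
    · simp

end Vertices

/-! ### Indegrees -/

theorem lowerStar_eq_iff {d : ℕ} {s : Pt d} {α : Finset (Pt d)} (hα : α.Nonempty) {c : ℝ} :
    lowerStar s α = c ↔ (∀ w ∈ α, ⟪s, w⟫_ℝ ≤ c) ∧ ∃ w ∈ α, ⟪s, w⟫_ℝ = c := by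
  unfold lowerStar
  rw [dif_pos hα]
  constructor
  · rintro rfl
    obtain ⟨w, hw, e⟩ := Finset.exists_mem_eq_sup' hα (fun v => ⟪s, v⟫_ℝ)
    exact ⟨fun w hw => Finset.le_sup' (fun v => ⟪s, v⟫_ℝ) hw, w, hw, e.symm⟩
  · rintro ⟨h, w, hw, rfl⟩
    exact le_antisymm (Finset.sup'_le _ _ h) (Finset.le_sup' (fun v => ⟪s, v⟫_ℝ) hw)

theorem IsLevel.lowerStar_eq {d : ℕ} {s : Pt d} {τ : Finset (Pt d)} (h : IsLevel s τ) {u : Pt d}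
    (hu : u ∈ τ) : lowerStar s τ = ⟪s, u⟫_ℝ :=
  (lowerStar_eq_iff ⟨u, hu⟩).2 ⟨fun w hw => (h w hw u hu).le, u, hu, rfl⟩

/-- Inversion of sums over nonempty subsets, by strong induction: removing the known values on
proper subsets leaves the value on the set itself. -/
theorem indegreeOfCounts_eq {d : ℕ} {δ N : Finset (Pt d) → ℤ} {σ : Finset (Pt d)}
    (h : ∀ τ ⊆ σ, τ.Nonempty → δ τ = ∑ ρ ∈ τ.powerset.erase ∅, N ρ) :
    ∀ τ ⊆ σ, τ.Nonempty → indegreeOfCounts δ τ = N τ := by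
  intro τ
  induction τ using Finset.strongInduction with
  | H τ ih =>
    intro hτ hne
    rw [indegreeOfCounts, h τ hτ hne]
    have h1 : ∑ ρ ∈ τ.powerset.attach,
        (if _h : ρ.1 ≠ τ ∧ ρ.1.Nonempty then indegreeOfCounts δ ρ.1 else 0) =
        ∑ ρ ∈ τ.powerset.attach, if ρ.1 ≠ τ ∧ ρ.1.Nonempty then N ρ.1 else 0 := by
      refine Finset.sum_congr rfl fun ρ _ => ?_
      split_ifs with h2
      · have h3 := Finset.mem_powerset.1 ρ.2
        exact ih ρ.1 (h3.ssubset_of_ne h2.1) (h3.trans hτ) h2.2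
      · rfl
    rw [h1, Finset.sum_attach τ.powerset (fun ρ => if ρ ≠ τ ∧ ρ.Nonempty then N ρ else 0),
      ← Finset.sum_filter]
    have h4 : τ.powerset.erase ∅ =
        insert τ (τ.powerset.filter fun ρ => ρ ≠ τ ∧ ρ.Nonempty) := by
      ext ρ
      simp only [Finset.mem_erase, Finset.mem_powerset, Finset.mem_insert, Finset.mem_filter,
        ← Finset.nonempty_iff_ne_empty]
      constructor
      · rintro ⟨h5, h6⟩
        by_cases e : ρ = τ
        · exact Or.inl e
        · exact Or.inr ⟨h6, e, h5⟩
      · rintro (rfl | ⟨h5, _, h6⟩)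
        · exact ⟨hne, subset_rfl⟩
        · exact ⟨h6, h5⟩
    rw [h4, Finset.sum_insert (by simp)]
    ring

theorem foldl_update_of_notMem {α β : Type*} [DecidableEq α] (f : α → β) {l : List α} {a : α}
    (h : a ∉ l) (g : α → β) : l.foldl (fun g a => Function.update g a (f a)) g a = g a := by
  induction l generalizing g with
  | nil => rfl
  | cons b l ih =>
    rw [List.mem_cons, not_or] at h
    rw [List.foldl_cons, ih h.2, Function.update_of_ne h.1]

theorem foldl_update_of_mem {α β : Type*} [DecidableEq α] (f : α → β) {l : List α} {a : α}
    (h : a ∈ l) (g : α → β) : l.foldl (fun g a => Function.update g a (f a)) g a = f a := by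
  induction l generalizing g with
  | nil => simp at h
  | cons b l ih =>
    rw [List.foldl_cons]
    by_cases hl : a ∈ l
    · exact ih hl _
    · obtain rfl : a = b := by simpa [hl] using h
      rw [foldl_update_of_notMem f hl, Function.update_self]

/-- The unit vector `s` is orthogonal to the affinely independent simplex `σ`, and `V` has no
further vertex at the height of `σ`. -/
structure Isolates {d : ℕ} (V : List (Pt d)) (σ : Finset (Pt d)) (s : Pt d) : Prop where
  norm_eq : ‖s‖ = 1
  level : IsLevel s σ
  indep : AffineIndependent ℝ ((↑) : σ → Pt d)
  subset : ∀ u ∈ σ, u ∈ V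
  ne_height : ∀ q ∈ V, q ∉ σ → ∀ u ∈ σ, ⟪s, q⟫_ℝ ≠ ⟪s, u⟫_ℝ

/-- The number of `k`-simplices of `K` that contain `σ` and whose other vertices are below `σ`. -/
def trueIndegree {d : ℕ} (K : Cpx d) (σ : Finset (Pt d)) (s : Pt d) (k : ℕ) : ℕ :=
  {α | α ∈ K.faces ∧ α.card = k + 1 ∧ σ ⊆ α ∧
    ∀ w ∈ α, w ∉ σ → ∀ u ∈ σ, ⟪s, w⟫_ℝ < ⟪s, u⟫_ℝ}.ncard

section Indegree

variable {d : ℕ} {pick : Set (Pt d) → Pt d} (hpick : IsDirectionRule pick)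
  {V : List (Pt d)} {σ : Finset (Pt d)} {s : Pt d} (hs : Isolates V σ s)

include hpick hs in
-- Vertices outside `σ` are strictly above or below it in direction `s`, and the tilt keeps them
-- there. The vertices of `σ` are tied in direction `s`, so the second direction decides their order
-- and places `τ` at the bottom.
theorem faceDirection_spec {τ : Finset (Pt d)} (hτ : τ ⊆ σ) (hne : τ.Nonempty) :
    ‖faceDirection pick V σ s τ‖ = 1 ∧ IsLevel (faceDirection pick V σ s τ) τ ∧
    (∀ w ∈ τ, ∀ x ∈ σ, x ∉ τ →
      ⟪faceDirection pick V σ s τ, w⟫_ℝ < ⟪faceDirection pick V σ s τ, x⟫_ℝ) ∧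
    ∀ q ∈ V, ∀ u ∈ τ,
      (⟪s, q⟫_ℝ < ⟪s, u⟫_ℝ →
        ⟪faceDirection pick V σ s τ, q⟫_ℝ < ⟪faceDirection pick V σ s τ, u⟫_ℝ) ∧
      (⟪s, u⟫_ℝ < ⟪s, q⟫_ℝ →
        ⟪faceDirection pick V σ s τ, u⟫_ℝ < ⟪faceDirection pick V σ s τ, q⟫_ℝ) := by
  unfold faceDirection
  split_ifs with h
  · subst h
    exact ⟨hs.norm_eq, hs.level, fun w _ x hx hxτ => absurd hx hxτ,
      fun q _ u _ => ⟨id, id⟩⟩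
  · obtain ⟨⟨h1, h2⟩, h3⟩ := hpick _ (exists_level_below hs.indep hne (hτ.ssubset_of_ne h))
    have ht := isTilt_tilt V hs.norm_eq h3
    refine ⟨ht.norm_eq, fun u hu w hw => ht.eq_of_eq (hs.level u (hτ hu) w (hτ hw)) (h1 u hu w hw),
      fun w hw x hx hxτ => ht.lt_of_eq (hs.level w (hτ hw) x hx) (h2 w hw x hx hxτ),
      fun q hq u hu => ⟨ht.lt_of_lt q hq u (hs.subset u (hτ hu)),
        ht.lt_of_lt u (hs.subset u (hτ hu)) q hq⟩⟩

include hpick hs in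
-- The highest vertex of `α` must be at the level of `τ`. This excludes vertices above `σ` and
-- vertices of `σ` outside `τ`, and requires a vertex of `σ`, because no vertex outside `σ` has
-- exactly this height.
theorem lowerStar_faceDirection_eq_iff {τ α : Finset (Pt d)} (hτ : τ ⊆ σ) (hne : τ.Nonempty)
    (hα : α.Nonempty) (hαV : ∀ w ∈ α, w ∈ V) :
    lowerStar (faceDirection pick V σ s τ) α =
      lowerStar (faceDirection pick V σ s τ) τ ↔
    (∀ w ∈ α, w ∉ σ → ∀ u ∈ σ, ⟪s, w⟫_ℝ < ⟪s, u⟫_ℝ) ∧ (∀ w ∈ α, w ∈ σ → w ∈ τ) ∧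
      ∃ w ∈ α, w ∈ σ := by
  obtain ⟨_, h1, h2, h3⟩ := faceDirection_spec hpick hs hτ hne
  obtain ⟨p, hp⟩ := hne
  rw [h1.lowerStar_eq hp, lowerStar_eq_iff hα]
  constructor
  · rintro ⟨h4, w, hw, h5⟩
    refine ⟨fun x hx hxσ u hu => ?_, fun x hx hxσ => ?_, w, hw, ?_⟩
    · rw [hs.level u hu p (hτ hp)]
      by_contra h6
      have h7 := lt_of_le_of_ne (not_lt.1 h6) (hs.ne_height x (hαV x hx) hxσ p (hτ hp)).symm
      exact absurd (h4 x hx) (not_le.2 ((h3 x (hαV x hx) p hp).2 h7))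
    · by_contra h6
      exact absurd (h4 x hx) (not_le.2 (h2 p hp x hxσ h6))
    · by_contra h6
      rcases lt_or_gt_of_ne (hs.ne_height w (hαV w hw) h6 p (hτ hp)) with h7 | h7
      · exact ((h3 w (hαV w hw) p hp).1 h7).ne h5
      · exact ((h3 w (hαV w hw) p hp).2 h7).ne' h5
  · rintro ⟨h4, h5, w, hw, hwσ⟩
    refine ⟨fun x hx => ?_, w, hw, h1 w (h5 w hw hwσ) p hp⟩
    by_cases hxσ : x ∈ σ
    · exact (h1 x (h5 x hx hxσ) p hp).le
    · exact ((h3 x (hαV x hx) p hp).1 (h4 x hx hxσ p (hτ hp))).le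

include hpick hs in
-- Classify the counted simplices by their intersection with `σ`, which ranges over the nonempty
-- subsets of `τ`. The summand for `ρ` does not depend on `τ`, which is what permits inversion.
theorem ncard_lowerStar_faceDirection {K : Cpx d} (hK : K.faces.Finite) (hV : ListsVertices K V)
    (k : ℕ) {τ : Finset (Pt d)} (hτ : τ ⊆ σ) (hne : τ.Nonempty) :
    (({α | α ∈ K.faces ∧ α.card = k + 1 ∧ lowerStar (faceDirection pick V σ s τ) α =
      lowerStar (faceDirection pick V σ s τ) τ}.ncard : ℕ) : ℤ) =
    ∑ ρ ∈ τ.powerset.erase ∅, (({α | α ∈ K.faces ∧ α.card = k + 1 ∧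
      (∀ w, w ∈ ρ ↔ w ∈ α ∧ w ∈ σ) ∧
      ∀ w ∈ α, w ∉ σ → ∀ u ∈ σ, ⟪s, w⟫_ℝ < ⟪s, u⟫_ℝ}.ncard : ℕ) : ℤ) := by
  classical
  have hfin : ∀ P : Finset (Pt d) → Prop,
      {α | α ∈ K.faces ∧ P α}.ncard = (hK.toFinset.filter P).card := by
    intro P
    rw [← Set.ncard_coe_finset]
    congr 1
    ext
    simp
  simp only [hfin]
  rw [Finset.card_eq_sum_card_fiberwise (f := fun α => α ∩ σ) (t := τ.powerset.erase ∅)]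
  · rw [Nat.cast_sum]
    refine Finset.sum_congr rfl fun ρ hρ => ?_
    rw [Finset.filter_filter]
    congr 2
    ext α
    simp only [Finset.mem_filter, Set.Finite.mem_toFinset, Finset.mem_erase,
      Finset.mem_powerset] at hρ ⊢
    refine and_congr_right fun hα => ?_
    rw [lowerStar_faceDirection_eq_iff hpick hs hτ hne (K.nonempty_of_mem_faces hα)
      (fun w hw => (hV.2 w).2 (K.down_closed hα (Finset.singleton_subset_iff.2 hw)
        (Finset.singleton_nonempty w)))]
    constructor
    · rintro ⟨⟨h1, h2, h3, h4⟩, rfl⟩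
      exact ⟨h1, fun w => Finset.mem_inter, h2⟩
    · rintro ⟨h1, h2, h3⟩
      obtain rfl : α ∩ σ = ρ := by ext w; rw [Finset.mem_inter, h2]
      refine ⟨⟨h1, h3, fun w hw hwσ => hρ.2 (Finset.mem_inter.2 ⟨hw, hwσ⟩), ?_⟩, rfl⟩
      obtain ⟨w, hw⟩ := Finset.nonempty_iff_ne_empty.2 hρ.1
      exact ⟨w, Finset.mem_inter.1 hw⟩
  · intro α hα
    simp only [Finset.coe_filter, Set.Finite.mem_toFinset, Set.mem_ofPred_eq] at hα
    obtain ⟨hα, _, h⟩ := hα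
    rw [lowerStar_faceDirection_eq_iff hpick hs hτ hne (K.nonempty_of_mem_faces hα)
      (fun w hw => (hV.2 w).2 (K.down_closed hα (Finset.singleton_subset_iff.2 hw)
        (Finset.singleton_nonempty w)))] at h
    obtain ⟨_, h2, w, hw, hwσ⟩ := h
    simp only [Finset.coe_erase, Set.mem_sdiff, Finset.mem_coe, Finset.mem_powerset,
      Set.mem_singleton_iff, ← Finset.nonempty_iff_ne_empty]
    refine ⟨fun x hx => ?_, w, Finset.mem_inter.2 ⟨hw, hwσ⟩⟩
    rw [Finset.mem_inter] at hx
    exact h2 x hx.1 hx.2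

include hpick hs in
-- Inversion isolates the simplices whose intersection with `σ` is all of `σ`, and these are the
-- ones counted by `trueIndegree`.
theorem indegree_output (F : Type*) [Field F] {K : Cpx d} (hK : K.faces.Finite)
    (hV : ListsVertices K V) (hσ : σ.Nonempty) (k : ℕ) :
    (indegree pick V σ s k).output (apd F K) = trueIndegree K σ s k := by
  classical
  unfold indegree
  simp only [OracleAlg.output_bind, OracleAlg.output_pure, OracleAlg.output_foldlM,
    OracleAlg.output_query]
  rw [indegreeOfCounts_eq (σ := σ) (N := fun ρ => (({α | α ∈ K.faces ∧ α.card = k + 1 ∧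
      (∀ w, w ∈ ρ ↔ w ∈ α ∧ w ∈ σ) ∧
      ∀ w ∈ α, w ∉ σ → ∀ u ∈ σ, ⟪s, w⟫_ℝ < ⟪s, u⟫_ℝ}.ncard : ℕ) : ℤ)) _ σ subset_rfl hσ]
  · unfold trueIndegree
    congr 2
    ext α
    simp only [Set.mem_ofPred_eq]
    refine and_congr_right fun _ => and_congr_right fun _ => and_congr_left fun _ => ?_
    exact ⟨fun h w hw => ((h w).1 hw).1, fun h w => ⟨fun hw => ⟨h hw, hw⟩, fun hw => hw.2⟩⟩
  · intro τ hτ hne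
    rw [← ncard_lowerStar_faceDirection hpick hs hK hV k hτ hne, ← simplexCount_apd F hK]
    have h := foldl_update_of_mem (fun τ => (simplexCount (apd F K (faceDirection pick V σ s τ)) k
      (lowerStar (faceDirection pick V σ s τ) τ) : ℤ)) (l := (σ.powerset.erase ∅).toList) (a := τ)
      (by simpa [← Finset.nonempty_iff_ne_empty] using ⟨hne, hτ⟩) (fun _ => 0)
    convert h

include hpick hs in
theorem indegree_asked_norm (O : Pt d → Diagram) (k : ℕ) :
    ∀ q ∈ (indegree pick V σ s k).asked O, ‖q‖ = 1 := by
  unfold indegree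
  rw [OracleAlg.asked_bind, OracleAlg.asked_pure, List.append_nil]
  refine OracleAlg.forall_asked_foldlM _ (fun δ τ hτ => ?_) _
  simp only [OracleAlg.asked_bind, OracleAlg.asked_pure, OracleAlg.asked_query, List.append_nil,
    List.mem_singleton, forall_eq]
  simp only [Finset.mem_toList, Finset.mem_erase, Finset.mem_powerset,
    ← Finset.nonempty_iff_ne_empty, ne_eq] at hτ
  exact (faceDirection_spec hpick hs hτ.2 hτ.1).1

end Indegree

/-- The empty face is not queried. The `- 1` matters for edges: at a single vertex an indegree costs
just one query. -/
theorem length_indegree_asked_le {d : ℕ} (pick : Set (Pt d) → Pt d) (V : List (Pt d))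
    (σ : Finset (Pt d)) (s : Pt d) (O : Pt d → Diagram) (k : ℕ) :
    ((indegree pick V σ s k).asked O).length ≤ 2 ^ σ.card - 1 := by
  unfold indegree
  rw [OracleAlg.asked_bind, OracleAlg.asked_pure, List.append_nil]
  refine (OracleAlg.length_asked_foldlM_le _ (n := 1) (fun δ τ hτ => le_of_eq rfl) _).trans ?_
  rw [mul_one, Finset.length_toList, Finset.card_erase_of_mem (by simp), Finset.card_powerset]

/-! ### The edges -/

open scoped Classical in
/-- The vertices `v` and `w` are joined by an edge of `K`. -/
def IsNeighbor {d : ℕ} (K : Cpx d) (v w : Pt d) : Prop :=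
  w ≠ v ∧ ({v, w} : Finset (Pt d)) ∈ K.faces

theorem mem_vertices_of_mem {d : ℕ} {K : Cpx d} {α : Finset (Pt d)} (hα : α ∈ K.faces) {w : Pt d}
    (hw : w ∈ α) : w ∈ K.vertices :=
  K.down_closed hα (Finset.singleton_subset_iff.2 hw) (Finset.singleton_nonempty w)

open scoped Classical in
theorem IsNeighbor.mem_vertices {d : ℕ} {K : Cpx d} {v w : Pt d} (h : IsNeighbor K v w) :
    w ∈ K.vertices := mem_vertices_of_mem h.2 (by simp)

open scoped Classical in
theorem ncard_edges_eq_length {d : ℕ} {K : Cpx d} {v : Pt d} {P : Pt d → Prop} {l : List (Pt d)}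
    (hl : l.Nodup) (h : ∀ w, w ∈ l ↔ IsNeighbor K v w ∧ P w) :
    {α | α ∈ K.faces ∧ α.card = 2 ∧ v ∈ α ∧ ∀ w ∈ α, w ≠ v → P w}.ncard = l.length := by
  have h1 : {α | α ∈ K.faces ∧ α.card = 2 ∧ v ∈ α ∧ ∀ w ∈ α, w ≠ v → P w} =
      (fun w => ({v, w} : Finset (Pt d))) '' ↑l.toFinset := by
    ext α
    simp only [Set.mem_ofPred_eq, Set.mem_image, Finset.mem_coe, List.mem_toFinset, h]
    constructor
    · rintro ⟨h1, h2, h3, h4⟩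
      obtain ⟨x, y, hxy, rfl⟩ := Finset.card_eq_two.1 h2
      simp only [Finset.mem_insert, Finset.mem_singleton] at h3 h4
      rcases h3 with rfl | rfl
      · exact ⟨y, ⟨⟨hxy.symm, h1⟩, h4 y (Or.inr rfl) hxy.symm⟩, rfl⟩
      · exact ⟨x, ⟨⟨hxy, by rwa [Finset.pair_comm]⟩, h4 x (Or.inl rfl) hxy⟩,
          Finset.pair_comm _ _⟩
    · rintro ⟨w, ⟨h1, h2⟩, rfl⟩
      refine ⟨h1.2, Finset.card_pair h1.1.symm, by simp, fun x hx hxv => ?_⟩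
      simp only [Finset.mem_insert, Finset.mem_singleton] at hx
      obtain rfl := hx.resolve_left hxv
      exact h2
  rw [h1, Set.InjOn.ncard_image, Set.ncard_coe_finset, List.toFinset_card_of_nodup hl]
  intro a ha b hb e
  have ha' := ((h a).1 (List.mem_toFinset.1 ha)).1.1
  have h2 : a ∈ ({v, b} : Finset (Pt d)) := by
    rw [← show ({v, a} : Finset (Pt d)) = {v, b} from e]
    simp
  simp only [Finset.mem_insert, Finset.mem_singleton] at h2
  exact h2.resolve_left ha'

theorem trueIndegree_singleton {d : ℕ} {K : Cpx d} {v s : Pt d} {l : List (Pt d)}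
    (hl : l.Nodup) (h : ∀ w, w ∈ l ↔ IsNeighbor K v w ∧ ⟪s, w⟫_ℝ < ⟪s, v⟫_ℝ) :
    trueIndegree K {v} s 1 = l.length := by
  rw [← ncard_edges_eq_length hl h]
  unfold trueIndegree
  simp

/-- The list `I` consists of vertices in `V` that are above `v` and sorted radially around `v`. -/
structure IsRadial {d : ℕ} (V : List (Pt d)) (v : Pt d) (I : List (Pt d)) : Prop where
  mem : ∀ w ∈ I, w ∈ V
  above : ∀ w ∈ I, coord v 0 < coord w 0
  sorted : I.Pairwise (fun u w => slopeFrom v u < slopeFrom v w)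

theorem IsRadial.sublist {d : ℕ} {V : List (Pt d)} {v : Pt d} {I J : List (Pt d)}
    (h : IsRadial V v I) (hJ : J.Sublist I) : IsRadial V v J :=
  ⟨fun w hw => h.mem w (hJ.subset hw), fun w hw => h.above w (hJ.subset hw), h.sorted.sublist hJ⟩

theorem IsRadial.nodup {d : ℕ} {V : List (Pt d)} {v : Pt d} {I : List (Pt d)}
    (h : IsRadial V v I) : I.Nodup := h.sorted.imp fun h e => by subst e; exact lt_irrefl _ h

/-! ### Binary search in a radial interval -/

section Search

variable {d : ℕ} {pick : Set (Pt d) → Pt d} {V : List (Pt d)} {v : Pt d}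

theorem take_half_ne_nil {α : Type*} {I : List α} (h : ¬ I.length ≤ 1) :
    I.take (I.length / 2) ≠ [] := by
  intro e
  have := congrArg List.length e
  simp only [List.length_take, List.length_nil] at this
  omega

theorem drop_half_ne_nil {α : Type*} {I : List α} (h : ¬ I.length ≤ 1) :
    I.drop (I.length / 2) ≠ [] := by
  intro e
  have := congrArg List.length e
  simp only [List.length_drop, List.length_nil] at this
  omega

/-- For points above `v`, the sign of the height relative to `v` is that of an affine function of
the slope. It is negative on `A` and positive on `B`, which has larger slopes, so it is increasing.
Therefore every point radially beyond `A ++ B` is also above `v`, whichever admissible direction was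
picked. -/
theorem splitDirection_spec (hpick : IsDirectionRule pick) (hd : 2 ≤ d)
    (hinj : ∀ u ∈ V, ∀ w ∈ V, coord u 0 = coord w 0 → u = w) (hv : v ∈ V) {A B : List (Pt d)}
    (h : IsRadial V v (A ++ B)) (hA : A ≠ []) (hB : B ≠ []) :
    Isolates V {v} (splitDirection pick V v A B) ∧
    (∀ w ∈ A, ⟪splitDirection pick V v A B, w⟫_ℝ < ⟪splitDirection pick V v A B, v⟫_ℝ) ∧
    (∀ w ∈ B, ⟪splitDirection pick V v A B, v⟫_ℝ < ⟪splitDirection pick V v A B, w⟫_ℝ) ∧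
    ∀ w, coord v 0 < coord w 0 → (∀ x ∈ A ++ B, slopeFrom v x < slopeFrom v w) →
      ⟪splitDirection pick V v A B, v⟫_ℝ < ⟪splitDirection pick V v A B, w⟫_ℝ := by
  have hAB := (List.pairwise_append.1 h.sorted).2.2
  obtain ⟨⟨h1, h2, h3, h4⟩, h5⟩ := hpick _ (exists_splitDirection hd hinj hv
    (fun w hw => h.above w (List.mem_append_left _ hw))
    (fun w hw => h.above w (List.mem_append_right _ hw)) hAB hA hB)
  change ∀ w ∈ A, ⟪splitDirection pick V v A B, w⟫_ℝ < ⟪splitDirection pick V v A B, v⟫_ℝ at h2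
  change ∀ w ∈ B, ⟪splitDirection pick V v A B, v⟫_ℝ < ⟪splitDirection pick V v A B, w⟫_ℝ at h3
  change ∀ i : Fin d, 2 ≤ (i : ℕ) → splitDirection pick V v A B i = 0 at h1
  refine ⟨⟨h5, ?_, affineIndependent_of_subsingleton ℝ _, by simpa using hv, ?_⟩, h2, h3, ?_⟩
  · intro u hu w hw
    rw [Finset.mem_singleton.1 hu, Finset.mem_singleton.1 hw]
  · intro q hq hqv u hu
    rw [Finset.mem_singleton.1 hu]
    exact h4 q hq (by simpa using hqv)
  · intro w hw hlt
    obtain ⟨a, ha⟩ := List.exists_mem_of_ne_nil A hA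
    obtain ⟨b, hb⟩ := List.exists_mem_of_ne_nil B hB
    set s := splitDirection pick V v A B
    have ha0 := h.above a (List.mem_append_left _ ha)
    have hb0 := h.above b (List.mem_append_right _ hb)
    have ea := inner_sub_inner_of_planar hd h1 ha0.ne'
    have eb := inner_sub_inner_of_planar hd h1 hb0.ne'
    have ew := inner_sub_inner_of_planar hd h1 hw.ne'
    have h6 : coord s 0 + coord s 1 * slopeFrom v a < 0 := by
      by_contra h6
      have := mul_nonneg (sub_pos.2 ha0).le (not_lt.1 h6)
      linarith [h2 a ha]
    have h7 : 0 < coord s 0 + coord s 1 * slopeFrom v b := by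
      by_contra h7
      have := mul_nonneg (sub_pos.2 hb0).le (neg_nonneg.2 (not_lt.1 h7))
      linarith [h3 b hb]
    have h8 : 0 < coord s 1 := by
      by_contra h8
      nlinarith [hAB a ha b hb]
    have h9 := mul_lt_mul_of_pos_left (hlt b (List.mem_append_right _ hb)) h8
    have := mul_pos (sub_pos.2 hw) (by linarith : 0 < coord s 0 + coord s 1 * slopeFrom v w)
    linarith

/-- Each split costs one query, and `(|A| - 1) + (|B| - 1) + 1 = |I| - 1`: a binary tree has one
internal node fewer than leaves. Neither the counts nor the oracle need to be correct for this
bound. -/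
theorem searchInterval_asked (hpick : IsDirectionRule pick) (hd : 2 ≤ d)
    (hinj : ∀ u ∈ V, ∀ w ∈ V, coord u 0 = coord w 0 → u = w) (hv : v ∈ V) (O : Pt d → Diagram)
    (n : ℕ) : ∀ (I : List (Pt d)), I.length = n → IsRadial V v I → ∀ (c : ℤ) (known : List (Pt d)),
      (∀ q ∈ (searchInterval pick V v I c known).asked O, ‖q‖ = 1) ∧
      ((searchInterval pick V v I c known).asked O).length ≤ n - 1 := by
  induction n using Nat.strong_induction_on with
  | _ n ih =>
    intro I hn hI c known
    rw [searchInterval]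
    split_ifs with h1 h2
    · simp
    · simp
    · have hA : (I.take (I.length / 2)).length < n := by
        rw [List.length_take]; omega
      have hB : (I.drop (I.length / 2)).length < n := by
        rw [List.length_drop]; omega
      have hAl := List.length_take (l := I) (i := I.length / 2)
      have hBl := List.length_drop (l := I) (i := I.length / 2)
      have hs := (splitDirection_spec hpick hd hinj hv (by rwa [List.take_append_drop])
        (take_half_ne_nil h2) (drop_half_ne_nil h2)).1
      have hq := indegree_asked_norm hpick hs O 1
      have hl := length_indegree_asked_le pick V {v} (splitDirection pick V v
        (I.take (I.length / 2)) (I.drop (I.length / 2))) O 1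
      rw [Finset.card_singleton] at hl
      simp only [OracleAlg.asked_bind, List.mem_append, List.length_append]
      have hA' := ih _ hA _ rfl (hI.sublist (List.take_sublist _ _))
      have hB' := ih _ hB _ rfl (hI.sublist (List.drop_sublist _ _))
      constructor
      · rintro q (hq' | hq' | hq')
        · exact hq q hq'
        · exact (hA' _ _).1 q hq'
        · exact (hB' _ _).1 q hq'
      · refine (add_le_add hl (add_le_add (hA' _ _).2 (hB' _ _).2)).trans ?_
        omega

open scoped Classical in
-- The last hypothesis is the invariant: a neighbor that is neither known nor in `I` lies radially
-- beyond `I`. Such neighbors are above `v` in the split direction and do not disturb the indegree.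
-- The geometric hypotheses are required only when `c ≠ 0`, since otherwise no splitting happens;
-- this covers `d = 1`.
theorem searchInterval_output (F : Type*) [Field F] {K : Cpx d} (hK : K.faces.Finite)
    (hV : ListsVertices K V) (hpick : IsDirectionRule pick)
    (hinj : ∀ u ∈ V, ∀ w ∈ V, coord u 0 = coord w 0 → u = w) (hv : v ∈ V) (n : ℕ) :
    ∀ (I : List (Pt d)), I.length = n → ∀ (c : ℤ) (known : List (Pt d)),
      (c ≠ 0 → 2 ≤ d ∧ IsRadial V v I) →
      c = (I.filter (fun w => IsNeighbor K v w)).length → known.Nodup →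
      (∀ w ∈ known, IsNeighbor K v w) → (∀ w ∈ I, w ∉ known) →
      (∀ w, IsNeighbor K v w → w ∉ I → w ∉ known →
        coord v 0 < coord w 0 ∧ ∀ x ∈ I, slopeFrom v x < slopeFrom v w) →
      ((searchInterval pick V v I c known).output (apd F K)).Nodup ∧
      ∀ w, w ∈ (searchInterval pick V v I c known).output (apd F K) ↔
        w ∈ known ∨ (w ∈ I ∧ IsNeighbor K v w) := by
  induction n using Nat.strong_induction_on with
  | _ n ih =>
    intro I hn c known hI hc hnd hkn hIk hrest
    rw [searchInterval]
    split_ifs with h1 h2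
    · subst h1
      refine ⟨hnd, fun w => ⟨Or.inl, ?_⟩⟩
      rintro (h | ⟨h2, h3⟩)
      · exact h
      · have h4 : I.filter (fun w => IsNeighbor K v w) = [] := List.length_eq_zero_iff.1 (by omega)
        have : w ∈ I.filter (fun w => IsNeighbor K v w) :=
          List.mem_filter.2 ⟨h2, decide_eq_true h3⟩
        rw [h4] at this
        simp at this
    · obtain ⟨w, hw⟩ := List.exists_mem_of_ne_nil (I.filter (fun w => IsNeighbor K v w)) (by
        intro e
        rw [e] at hc
        exact h1 (by simpa using hc))
      obtain ⟨hwI, hwn⟩ := List.mem_filter.1 hw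
      obtain ⟨x, rfl⟩ := List.length_eq_one_iff.1
        (le_antisymm h2 (List.length_pos_of_mem hwI))
      obtain rfl := List.mem_singleton.1 hwI
      have hwn' := of_decide_eq_true hwn
      refine ⟨List.nodup_cons.2 ⟨hIk w hwI, hnd⟩, fun y => ?_⟩
      change y ∈ w :: known ↔ _
      rw [List.mem_cons, List.mem_singleton]
      constructor
      · rintro (rfl | h)
        · exact Or.inr ⟨rfl, hwn'⟩
        · exact Or.inl h
      · rintro (h | ⟨h, _⟩)
        · exact Or.inr h
        · exact Or.inl h
    · obtain ⟨hd, hI⟩ := hI h1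
      set A := I.take (I.length / 2) with hAdef
      set B := I.drop (I.length / 2) with hBdef
      have hAB : A ++ B = I := List.take_append_drop _ _
      have hA : A.length < n := by rw [hAdef, List.length_take]; omega
      have hB : B.length < n := by rw [hBdef, List.length_drop]; omega
      have hmem : ∀ w, w ∈ I ↔ w ∈ A ∨ w ∈ B := fun w => by rw [← hAB, List.mem_append]
      have hRA : IsRadial V v A := hI.sublist (List.take_sublist _ _)
      have hRB : IsRadial V v B := hI.sublist (List.drop_sublist _ _)
      have hlt : ∀ a ∈ A, ∀ b ∈ B, slopeFrom v a < slopeFrom v b :=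
        (List.pairwise_append.1 (hAB ▸ hI.sorted)).2.2
      have hdisj : ∀ w ∈ A, w ∉ B := fun w hwA hwB => lt_irrefl _ (hlt w hwA w hwB)
      obtain ⟨hs, hsA, hsB, hsC⟩ := splitDirection_spec hpick hd hinj hv (hAB.symm ▸ hI)
        (take_half_ne_nil h2) (drop_half_ne_nil h2)
      set s := splitDirection pick V v A B with hsdef
      simp only [OracleAlg.output_bind]
      rw [indegree_output hpick hs F hK hV (by simp)]
      -- Below `v` in the split direction are some known neighbors and all neighbors in `A`. Those
      -- in `B` and those beyond the interval are above, so subtracting the known ones leaves the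
      -- count for `A`.
      have hdeg : trueIndegree K {v} s 1 =
          (known.filter (fun w => ⟪s, w⟫_ℝ < ⟪s, v⟫_ℝ) ++
            A.filter (fun w => IsNeighbor K v w)).length := by
        refine trueIndegree_singleton ?_ fun w => ?_
        · refine List.Nodup.append (hnd.filter _) (hRA.nodup.filter _) ?_
          intro w hw hw'
          exact hIk w ((hmem w).2 (Or.inl (List.mem_filter.1 hw').1)) (List.mem_filter.1 hw).1
        · simp only [List.mem_append, List.mem_filter, decide_eq_true_eq]
          constructor
          · rintro (⟨h3, h4⟩ | ⟨h3, h4⟩)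
            · exact ⟨hkn w h3, h4⟩
            · exact ⟨h4, hsA w h3⟩
          · rintro ⟨h3, h4⟩
            by_cases hwk : w ∈ known
            · exact Or.inl ⟨hwk, h4⟩
            · by_cases hwI : w ∈ I
              · rcases (hmem w).1 hwI with h5 | h5
                · exact Or.inr ⟨h5, h3⟩
                · exact absurd h4 (hsB w h5).not_gt
              · obtain ⟨h5, h6⟩ := hrest w h3 hwI hwk
                exact absurd h4 (hsC w h5 (hAB.symm ▸ h6)).not_gt
      rw [hdeg, List.length_append]
      have hcA : (((known.filter (fun w => ⟪s, w⟫_ℝ < ⟪s, v⟫_ℝ)).length +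
          (A.filter (fun w => IsNeighbor K v w)).length : ℕ) : ℤ) -
          ((known.filter (fun w => ⟪s, w⟫_ℝ < ⟪s, v⟫_ℝ)).length : ℤ) =
          ((A.filter (fun w => IsNeighbor K v w)).length : ℤ) := by push_cast; ring
      rw [hcA]
      have hcB : c - ((A.filter (fun w => IsNeighbor K v w)).length : ℤ) =
          ((B.filter (fun w => IsNeighbor K v w)).length : ℤ) := by
        rw [hc, ← hAB, List.filter_append, List.length_append]
        push_cast
        ring
      rw [hcB]
      -- While `A` is searched, the neighbors in `B` are unknown, but they lie radially beyond `A`,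
      -- so the invariant survives.
      obtain ⟨hA1, hA2⟩ := ih _ hA A rfl _ known (fun _ => ⟨hd, hRA⟩) rfl hnd hkn
        (fun w hw => hIk w ((hmem w).2 (Or.inl hw))) (fun w hw hwA hwk => by
          by_cases hwB : w ∈ B
          · exact ⟨hRB.above w hwB, fun x hx => hlt x hx w hwB⟩
          · obtain ⟨h3, h4⟩ := hrest w hw (fun h => ((hmem w).1 h).elim hwA hwB) hwk
            exact ⟨h3, fun x hx => h4 x ((hmem x).2 (Or.inl hx))⟩)
      set known' := (searchInterval pick V v A
        ((A.filter (fun w => IsNeighbor K v w)).length : ℤ) known).output (apd F K)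
      -- The neighbors in `A` precede `B` radially and would break the invariant, but by now they
      -- are known. This is why the first half is processed first.
      obtain ⟨hB1, hB2⟩ := ih _ hB B rfl _ known' (fun _ => ⟨hd, hRB⟩) rfl hA1
        (fun w hw => ((hA2 w).1 hw).elim (hkn w) And.right)
        (fun w hw hwk => ((hA2 w).1 hwk).elim (hIk w ((hmem w).2 (Or.inr hw)))
          fun h => hdisj w h.1 hw)
        (fun w hw hwB hwk => by
          rw [hA2, not_or] at hwk
          have hwA : w ∉ A := fun h => hwk.2 ⟨h, hw⟩
          obtain ⟨h3, h4⟩ := hrest w hw (fun h => ((hmem w).1 h).elim hwA hwB) hwk.1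
          exact ⟨h3, fun x hx => h4 x ((hmem x).2 (Or.inr hx))⟩)
      refine ⟨hB1, fun w => ?_⟩
      rw [hB2, hA2, hmem]
      tauto

end Search

/-! ### The sweep over the vertices -/

section Edges

variable {d : ℕ} {pick : Set (Pt d) → Pt d} {V : List (Pt d)} {K : Cpx d}

/-- The vertices of `K` are in general position and are listed by `V`, and every simplex of `K` has
at most `d` vertices. -/
structure Admissible (K : Cpx d) (V : List (Pt d)) : Prop where
  finite : K.faces.Finite
  lists : ListsVertices K V
  general : GeneralPosition K.vertices
  card_le : ∀ σ ∈ K.faces, σ.card ≤ d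

theorem Admissible.coord_inj (h : Admissible K V) :
    ∀ u ∈ V, ∀ w ∈ V, coord u 0 = coord w 0 → u = w := by
  intro u hu w hw e
  refine h.general.height_injective ((h.lists.2 u).1 hu) ((h.lists.2 w).1 hw) ?_
  simpa only [inner_basisVec] using e

open scoped Classical in
theorem IsNeighbor.symm {u v : Pt d} (h : IsNeighbor K u v) : IsNeighbor K v u :=
  ⟨h.1.symm, by rw [Finset.pair_comm]; exact h.2⟩

theorem IsNeighbor.coord_ne (hA : Admissible K V) {v w : Pt d} (h : IsNeighbor K v w) :
    coord w 0 ≠ coord v 0 := fun e =>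
  h.1 (hA.coord_inj w ((hA.lists.2 w).2 h.mem_vertices) v
    ((hA.lists.2 v).2 h.symm.mem_vertices) e)

open scoped Classical in
/-- The vertices of `V` above `v`, sorted radially around `v`. -/
def radialList (V : List (Pt d)) (v : Pt d) : List (Pt d) :=
  (V.filter (fun w => coord v 0 < coord w 0)).mergeSort
    (fun u w => decide (slopeFrom v u ≤ slopeFrom v w))

theorem mem_radialList {v w : Pt d} :
    w ∈ radialList V v ↔ w ∈ V ∧ coord v 0 < coord w 0 := by
  simp [radialList]

theorem length_radialList_le (v : Pt d) : (radialList V v).length ≤ V.length := by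
  unfold radialList
  rw [List.length_mergeSort]
  exact List.length_filter_le _ _

theorem isRadial_radialList (hA : Admissible K V) (hd : 2 ≤ d) {v : Pt d} (hv : v ∈ V) :
    IsRadial V v (radialList V v) := by
  classical
  refine ⟨fun w hw => (mem_radialList.1 hw).1, fun w hw => (mem_radialList.1 hw).2, ?_⟩
  have hnd : (radialList V v).Nodup :=
    (List.mergeSort_perm _ _).nodup_iff.2 (hA.lists.1.filter _)
  have h := List.pairwise_mergeSort
    (le := fun u w => decide (slopeFrom v u ≤ slopeFrom v w))
    (by intro a b c; simpa using le_trans) (by intro a b; simpa using le_total _ _)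
    (V.filter (fun w => coord v 0 < coord w 0))
  refine (h.and hnd).imp_of_mem ?_
  intro u w hu hw ⟨h1, h2⟩
  rw [decide_eq_true_eq] at h1
  have hu' := mem_radialList.1 hu
  have hw' := mem_radialList.1 hw
  exact h1.lt_of_ne fun e => h2 (slopeFrom_injOn hd hA.general ((hA.lists.2 v).1 hv)
    ((hA.lists.2 u).1 hu'.1) ((hA.lists.2 w).1 hw'.1) hu'.2.ne' hw'.2.ne' e)

open scoped Classical in
-- In direction `-e_1` an edge has the height of its `e_1`-lower endpoint. Since first coordinates
-- are distinct, the edges at the height of `v` are exactly those going up from `v`.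
theorem simplexCount_neg_basisVec (F : Type*) [Field F] (hA : Admissible K V) {v : Pt d}
    (hv : v ∈ V) :
    simplexCount (apd F K (-basisVec d 0)) 1 ⟪-basisVec d 0, v⟫_ℝ =
      ((radialList V v).filter (fun w => IsNeighbor K v w)).length := by
  rw [simplexCount_apd F hA.finite]
  have hnd : (radialList V v).Nodup :=
    (List.mergeSort_perm _ _).nodup_iff.2 (hA.lists.1.filter _)
  rw [← ncard_edges_eq_length (K := K) (v := v) (P := fun w => coord v 0 < coord w 0)
    (hnd.filter _)]
  · congr 1
    ext α
    simp only [Set.mem_ofPred_eq]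
    refine and_congr_right fun hα => and_congr_right fun _ => ?_
    rw [lowerStar_eq_iff (K.nonempty_of_mem_faces hα)]
    simp only [inner_neg_left, inner_basisVec, neg_le_neg_iff, neg_inj]
    have hαV : ∀ w ∈ α, w ∈ V := fun w hw => (hA.lists.2 w).2 (mem_vertices_of_mem hα hw)
    constructor
    · rintro ⟨h1, w, hw, e⟩
      obtain rfl := hA.coord_inj w (hαV w hw) v hv e
      exact ⟨hw, fun x hx hxw => (h1 x hx).lt_of_ne
        fun e => hxw (hA.coord_inj x (hαV x hx) w hv e.symm)⟩
    · rintro ⟨h1, h2⟩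
      refine ⟨fun w hw => ?_, v, h1, rfl⟩
      by_cases e : w = v
      · rw [e]
      · exact (h2 w hw e).le
  · intro w
    rw [List.mem_filter, mem_radialList, decide_eq_true_eq]
    exact ⟨fun h => ⟨h.2, h.1.2⟩, fun h => ⟨⟨(hA.lists.2 w).2 h.1.mem_vertices, h.2⟩, h.1⟩⟩

theorem two_le_of_isNeighbor (hA : Admissible K V) {v w : Pt d} (h : IsNeighbor K v w) : 2 ≤ d := by
  classical
  have h1 := hA.card_le _ h.2
  rwa [Finset.card_pair h.1.symm] at h1

/-- A nonzero count yields an edge, and simplices have at most `d` vertices. Thus the coordinate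
plane exists whenever the search actually splits an interval. -/
theorem two_le_of_simplexCount_ne_zero (F : Type*) [Field F] (hA : Admissible K V) {v : Pt d}
    (hv : v ∈ V)
    (h : simplexCount (apd F K (-basisVec d 0)) 1 ⟪-basisVec d 0, v⟫_ℝ ≠ 0) : 2 ≤ d := by
  classical
  rw [simplexCount_neg_basisVec F hA hv] at h
  obtain ⟨w, hw⟩ := List.exists_mem_of_length_pos (Nat.pos_of_ne_zero h)
  exact two_le_of_isNeighbor hA (of_decide_eq_true (List.mem_filter.1 hw).2)

open scoped Classical in
/-- The set `E` consists of those edges of `K` whose lower vertex lies in `S`. -/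
structure EdgesFrom (K : Cpx d) (S : Set (Pt d)) (E : Finset (Finset (Pt d))) : Prop where
  edge : ∀ α ∈ E, α ∈ K.faces ∧ α.card = 2
  mem_iff : ∀ u w, IsNeighbor K u w → coord u 0 < coord w 0 →
    (({u, w} : Finset (Pt d)) ∈ E ↔ u ∈ S)

open scoped Classical in
-- When `v` is reached, the edges from all lower vertices are known, so the known neighbors of `v`
-- are precisely its lower neighbors and the search supplies the upper ones.
theorem findUpEdges_output (F : Type*) [Field F] (hpick : IsDirectionRule pick)
    (hA : Admissible K V) {v : Pt d} (hv : v ∈ V) {S : Set (Pt d)} {E : Finset (Finset (Pt d))}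
    (hS : ∀ w ∈ V, w ∈ S ↔ coord w 0 < coord v 0) (hE : EdgesFrom K S E) :
    EdgesFrom K (insert v S)
      ((findUpEdges pick V (apd F K (-basisVec d 0)) E v).output (apd F K)) := by
  unfold findUpEdges
  simp only [OracleAlg.output_bind, OracleAlg.output_pure]
  change EdgesFrom K (insert v S) (E ∪ (((searchInterval pick V v (radialList V v) _ _).output
    (apd F K)).map (fun w => ({v, w} : Finset (Pt d)))).toFinset)
  set known := V.filter (fun w => ({v, w} : Finset (Pt d)) ∈ E ∧ w ≠ v) with hknown
  have hmk : ∀ w, w ∈ known ↔ IsNeighbor K v w ∧ coord w 0 < coord v 0 := by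
    intro w
    rw [hknown, List.mem_filter, decide_eq_true_eq]
    constructor
    · rintro ⟨h1, h2, h3⟩
      have hn : IsNeighbor K v w := ⟨h3, (hE.edge _ h2).1⟩
      refine ⟨hn, (not_lt.1 fun h4 => ?_).lt_of_ne (hn.coord_ne hA)⟩
      exact lt_irrefl _ ((hS v hv).1 ((hE.mem_iff v w hn h4).1 h2))
    · rintro ⟨hn, h2⟩
      have hw := (hA.lists.2 w).2 hn.mem_vertices
      refine ⟨hw, ?_, hn.1⟩
      rw [Finset.pair_comm]
      exact (hE.mem_iff w v hn.symm h2).2 ((hS w hw).2 h2)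
  obtain ⟨_, h2⟩ := searchInterval_output F hA.finite hA.lists hpick hA.coord_inj hv _
    (radialList V v) rfl (simplexCount (apd F K (-basisVec d 0)) 1 ⟪-basisVec d 0, v⟫_ℝ : ℤ) known
    (fun hc => by
      have hd := two_le_of_simplexCount_ne_zero F hA hv (by exact_mod_cast hc)
      exact ⟨hd, isRadial_radialList hA hd hv⟩)
    (by rw [simplexCount_neg_basisVec F hA hv]) (hA.lists.1.filter _)
    (fun w hw => ((hmk w).1 hw).1)
    (fun w hw hw' => lt_asymm (mem_radialList.1 hw).2 ((hmk w).1 hw').2)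
    -- Initially the search invariant holds vacuously: a neighbor below `v` is known and one above
    -- `v` is in the interval.
    (fun w hw hwI hwk => by
      rcases lt_or_gt_of_ne (hw.coord_ne hA) with h | h
      · exact absurd ((hmk w).2 ⟨hw, h⟩) hwk
      · exact absurd (mem_radialList.2 ⟨(hA.lists.2 w).2 hw.mem_vertices, h⟩) hwI)
  set res := (searchInterval pick V v (radialList V v)
    (simplexCount (apd F K (-basisVec d 0)) 1 ⟪-basisVec d 0, v⟫_ℝ : ℤ) known).output (apd F K)
  have hres : ∀ w, w ∈ res ↔ IsNeighbor K v w := by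
    intro w
    rw [h2, hmk, mem_radialList]
    constructor
    · rintro (h | h)
      · exact h.1
      · exact h.2
    · intro h
      rcases lt_or_gt_of_ne (h.coord_ne hA) with h3 | h3
      · exact Or.inl ⟨h, h3⟩
      · exact Or.inr ⟨⟨(hA.lists.2 w).2 h.mem_vertices, h3⟩, h⟩
  refine ⟨?_, ?_⟩
  · intro α hα
    rcases Finset.mem_union.1 hα with hα | hα
    · exact hE.edge α hα
    · rw [List.mem_toFinset, List.mem_map] at hα
      obtain ⟨w, hw, rfl⟩ := hα
      have hn := (hres w).1 hw
      exact ⟨hn.2, Finset.card_pair hn.1.symm⟩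
  · intro u w hn hlt
    rw [Finset.mem_union, hE.mem_iff u w hn hlt, List.mem_toFinset, List.mem_map,
      Set.mem_insert_iff, or_comm]
    constructor
    · rintro (⟨x, hx, e⟩ | h)
      · have hv' : v ∈ ({u, w} : Finset (Pt d)) := by rw [← e]; simp
        simp only [Finset.mem_insert, Finset.mem_singleton] at hv'
        rcases hv' with rfl | rfl
        · exact Or.inl rfl
        · exact Or.inr ((hS u ((hA.lists.2 u).2 hn.symm.mem_vertices)).2 hlt)
      · exact Or.inr h
    · rintro (rfl | h)
      · exact Or.inl ⟨w, (hres w).2 hn, rfl⟩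
      · exact Or.inr h

theorem findUpEdges_asked (F : Type*) [Field F] (hpick : IsDirectionRule pick)
    (hA : Admissible K V) {v : Pt d} (hv : v ∈ V) (E : Finset (Finset (Pt d))) :
    (∀ q ∈ (findUpEdges pick V (apd F K (-basisVec d 0)) E v).asked (apd F K), ‖q‖ = 1) ∧
    ((findUpEdges pick V (apd F K (-basisVec d 0)) E v).asked (apd F K)).length ≤ V.length := by
  unfold findUpEdges
  simp only [OracleAlg.asked_bind, OracleAlg.asked_pure, List.append_nil]
  by_cases hc : simplexCount (apd F K (-basisVec d 0)) 1 ⟪-basisVec d 0, v⟫_ℝ = 0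
  · rw [hc, searchInterval, if_pos (by simp)]
    simp
  · have hd := two_le_of_simplexCount_ne_zero F hA hv hc
    obtain ⟨h1, h2⟩ := searchInterval_asked hpick hd hA.coord_inj hv (apd F K) _
      (radialList V v) rfl (isRadial_radialList hA hd hv)
      (simplexCount (apd F K (-basisVec d 0)) 1 ⟪-basisVec d 0, v⟫_ℝ : ℤ) _
    exact ⟨h1, h2.trans ((Nat.sub_le _ _).trans (length_radialList_le v))⟩

/-- Induction along the sweep, with `S` the vertices already processed. Sortedness keeps `S` equal,
among the vertices, to those below the next one. -/
theorem foldl_findUpEdges (F : Type*) [Field F] (hpick : IsDirectionRule pick)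
    (hA : Admissible K V) (R : List (Pt d)) : ∀ (S : Set (Pt d)) (E : Finset (Finset (Pt d))),
      R.Pairwise (fun u w => coord u 0 < coord w 0) → (∀ w ∈ V, w ∈ S ∨ w ∈ R) →
      (∀ w ∈ R, w ∈ V) → (∀ u ∈ S, ∀ w ∈ R, coord u 0 < coord w 0) → EdgesFrom K S E →
      EdgesFrom K {v | v ∈ S ∨ v ∈ R} (R.foldl (fun E v =>
        (findUpEdges pick V (apd F K (-basisVec d 0)) E v).output (apd F K)) E) := by
  induction R with
  | nil =>
    intro S E _ _ _ _ hE
    simpa using hE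
  | cons v R ih =>
    intro S E hR hSR hRV hlt hE
    rw [List.pairwise_cons] at hR
    have h1 := findUpEdges_output F hpick hA (hRV v (by simp)) (S := S) (fun w hw => by
      refine ⟨fun h => hlt w h v (by simp), fun h => (hSR w hw).resolve_right fun h2 => ?_⟩
      rcases List.mem_cons.1 h2 with rfl | h2
      · exact lt_irrefl _ h
      · exact lt_asymm h (hR.1 w h2)) hE
    have h2 := ih (insert v S) _ hR.2 (fun w hw => by
      rcases hSR w hw with h | h
      · exact Or.inl (Or.inr h)
      · rcases List.mem_cons.1 h with rfl | h
        · exact Or.inl (Or.inl rfl)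
        · exact Or.inr h) (fun w hw => hRV w (by simp [hw])) (fun u hu w hw => by
      rcases hu with rfl | hu
      · exact hR.1 w hw
      · exact hlt u hu w (by simp [hw])) h1
    rw [List.foldl_cons]
    convert h2 using 1
    ext w
    simp only [Set.mem_ofPred_eq, List.mem_cons, Set.mem_insert_iff]
    tauto

theorem findEdges_output (F : Type*) [Field F] (hpick : IsDirectionRule pick)
    (hA : Admissible K V) (α : Finset (Pt d)) :
    α ∈ (findEdges pick V).output (apd F K) ↔ α ∈ K.faces ∧ α.card = 2 := by
  classical
  unfold findEdges
  simp only [OracleAlg.output_bind, OracleAlg.output_query, OracleAlg.output_foldlM]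
  set V' := V.mergeSort (fun u w => decide (coord u 0 ≤ coord w 0)) with hV'
  have hmem : ∀ w, w ∈ V' ↔ w ∈ V := fun w => by simp [hV']
  have hnd : V'.Nodup := (List.mergeSort_perm _ _).nodup_iff.2 hA.lists.1
  have hsort : V'.Pairwise (fun u w => coord u 0 < coord w 0) := by
    have h := List.pairwise_mergeSort (le := fun u w : Pt d => decide (coord u 0 ≤ coord w 0))
      (by intro a b c; simpa using le_trans) (by intro a b; simpa using le_total _ _) V
    refine (h.and hnd).imp_of_mem ?_
    intro u w hu hw ⟨h1, h2⟩
    rw [decide_eq_true_eq] at h1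
    exact h1.lt_of_ne fun e => h2 (hA.coord_inj u ((hmem u).1 hu) w ((hmem w).1 hw) e)
  have hE := foldl_findUpEdges F hpick hA V' ∅ ∅ hsort (fun w hw => Or.inr ((hmem w).2 hw))
    (fun w hw => (hmem w).1 hw) (by simp) ⟨by simp, by simp⟩
  refine ⟨hE.edge α, ?_⟩
  rintro ⟨h1, h2⟩
  obtain ⟨x, y, hxy, rfl⟩ := Finset.card_eq_two.1 h2
  have hn : IsNeighbor K x y := ⟨hxy.symm, h1⟩
  rcases lt_or_gt_of_ne (hn.coord_ne hA) with h | h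
  · rw [Finset.pair_comm]
    exact (hE.mem_iff y x hn.symm h).2 (Or.inr ((hmem y).2 ((hA.lists.2 y).2 hn.mem_vertices)))
  · exact (hE.mem_iff x y hn h).2 (Or.inr ((hmem x).2 ((hA.lists.2 x).2 hn.symm.mem_vertices)))

theorem findEdges_asked (F : Type*) [Field F] (hd : 1 ≤ d) (hpick : IsDirectionRule pick)
    (hA : Admissible K V) :
    (∀ q ∈ (findEdges pick V).asked (apd F K), ‖q‖ = 1) ∧
    ((findEdges pick V).asked (apd F K)).length ≤ 1 + V.length * V.length := by
  unfold findEdges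
  simp only [OracleAlg.asked_bind, OracleAlg.asked_query, OracleAlg.output_query,
    List.length_append, List.length_singleton]
  constructor
  · intro q hq
    rcases List.mem_append.1 hq with hq | hq
    · rw [List.mem_singleton.1 hq, norm_neg, norm_basisVec (by omega)]
    · refine OracleAlg.forall_asked_foldlM (P := fun q => ‖q‖ = 1) _ (fun E v hv => ?_) _ q hq
      exact (findUpEdges_asked F hpick hA (by simpa using hv) E).1
  · refine Nat.add_le_add_left ((OracleAlg.length_asked_foldlM_le _ (n := V.length)
      (fun E v hv => ?_) _).trans ?_) 1
    · exact (findUpEdges_asked F hpick hA (by simpa using hv) E).2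
    · rw [List.length_mergeSort]

end Edges

/-! ### Higher simplices -/

section Wedge

variable {d : ℕ} {V : List (Pt d)} {σ : Finset (Pt d)} {v : Pt d}

/-- Only `σ` and `v` are tied in direction `sm`. The tilt lifts `v` off `σ` and leaves every other
vertex on its side of `σ`. -/
theorem isolates_of_isTilt {sm s₃ t : Pt d} (hσ : AffineIndependent ℝ ((↑) : σ → Pt d))
    (hσV : ∀ u ∈ σ, u ∈ V) (hlevel : ∀ u ∈ σ, ∀ w ∈ σ, ⟪sm, u⟫_ℝ = ⟪sm, w⟫_ℝ)
    (hv : ∀ u ∈ σ, ⟪sm, u⟫_ℝ = ⟪sm, v⟫_ℝ)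
    (hne : ∀ q ∈ V, q ∉ σ → q ≠ v → ∀ u ∈ σ, ⟪sm, q⟫_ℝ ≠ ⟪sm, u⟫_ℝ)
    (h₃ : IsLevel s₃ σ) (h₃v : ∀ w ∈ σ, ⟪s₃, w⟫_ℝ < ⟪s₃, v⟫_ℝ)
    (ht : IsTilt {v | v ∈ V} sm s₃ t) :
    Isolates V σ t ∧ (∀ u ∈ σ, ⟪t, u⟫_ℝ < ⟪t, v⟫_ℝ) ∧
      ∀ q ∈ V, q ∉ σ → q ≠ v → ∀ u ∈ σ, (⟪t, q⟫_ℝ < ⟪t, u⟫_ℝ ↔ ⟪sm, q⟫_ℝ < ⟪sm, u⟫_ℝ) := by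
  have h1 : ∀ u ∈ σ, ⟪t, u⟫_ℝ < ⟪t, v⟫_ℝ := fun u hu => ht.lt_of_eq (hv u hu) (h₃v u hu)
  refine ⟨⟨ht.norm_eq, fun u hu w hw => ht.eq_of_eq (hlevel u hu w hw) (h₃ u hu w hw), hσ, hσV,
    fun q hq hqσ u hu => ?_⟩, h1, fun q hq hqσ hqv u hu => ⟨fun h => ?_,
      ht.lt_of_lt q hq u (hσV u hu)⟩⟩
  · by_cases hqv : q = v
    · subst hqv
      exact (h1 u hu).ne'
    · rcases lt_or_gt_of_ne (hne q hq hqσ hqv u hu) with h | h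
      · exact (ht.lt_of_lt q hq u (hσV u hu) h).ne
      · exact (ht.lt_of_lt u (hσV u hu) q hq h).ne'
  · refine (lt_or_gt_of_ne (hne q hq hqσ hqv u hu)).resolve_right fun h2 => ?_
    exact lt_asymm h (ht.lt_of_lt u (hσV u hu) q hq h2)

theorem Isolates.neg {s : Pt d} (h : Isolates V σ s) : Isolates V σ (-s) where
  norm_eq := by rw [norm_neg, h.norm_eq]
  level u hu w hw := by rw [inner_neg_left, inner_neg_left, h.level u hu w hw]
  indep := h.indep
  subset := h.subset
  ne_height q hq hqσ u hu := by
    rw [inner_neg_left, inner_neg_left]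
    exact fun e => h.ne_height q hq hqσ u hu (neg_injective e)

open scoped Classical in
-- The counted simplices have just one vertex besides `σ`. For any such vertex other than `v` the
-- two directions agree, while `v` is below `σ` only in direction `sU`; so `σ ∪ {v}` is the only
-- simplex that can make a difference.
theorem trueIndegree_wedge {K : Cpx d} (hK : K.faces.Finite) (hV : ListsVertices K V)
    (hvσ : v ∉ σ) {sL sU : Pt d} (hσ : σ.Nonempty)
    (hL : ∀ u ∈ σ, ⟪sL, u⟫_ℝ < ⟪sL, v⟫_ℝ) (hU : ∀ u ∈ σ, ⟪sU, v⟫_ℝ < ⟪sU, u⟫_ℝ)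
    (hLU : ∀ q ∈ V, q ∉ σ → q ≠ v → ∀ u ∈ σ,
      (⟪sL, q⟫_ℝ < ⟪sL, u⟫_ℝ ↔ ⟪sU, q⟫_ℝ < ⟪sU, u⟫_ℝ)) :
    trueIndegree K σ sU σ.card =
      trueIndegree K σ sL σ.card + if insert v σ ∈ K.faces then 1 else 0 := by
  obtain ⟨p, hp⟩ := hσ
  set T := insert v σ with hT
  have hmem : ∀ {α : Finset (Pt d)}, α ∈ K.faces → ∀ w ∈ α, w ∈ V := fun hα w hw =>
    (hV.2 w).2 (mem_vertices_of_mem hα hw)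
  set L := {α | α ∈ K.faces ∧ α.card = σ.card + 1 ∧ σ ⊆ α ∧
    ∀ w ∈ α, w ∉ σ → ∀ u ∈ σ, ⟪sL, w⟫_ℝ < ⟪sL, u⟫_ℝ} with hLdef
  have hLv : ∀ α ∈ L, v ∉ α := fun α hα hv =>
    lt_asymm (hα.2.2.2 v hv hvσ p hp) (hL p hp)
  have hset : {α | α ∈ K.faces ∧ α.card = σ.card + 1 ∧ σ ⊆ α ∧
      ∀ w ∈ α, w ∉ σ → ∀ u ∈ σ, ⟪sU, w⟫_ℝ < ⟪sU, u⟫_ℝ} = {α | α ∈ L ∨ (α = T ∧ T ∈ K.faces)} := by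
    ext α
    constructor
    · rintro ⟨h1, h2, h3, h4⟩
      by_cases hvα : v ∈ α
      · have : T = α := Finset.eq_of_subset_of_card_le (Finset.insert_subset hvα h3)
          (by rw [hT, Finset.card_insert_of_notMem hvσ, h2])
        exact Or.inr ⟨this.symm, this ▸ h1⟩
      · exact Or.inl ⟨h1, h2, h3, fun w hw hwσ u hu => (hLU w (hmem h1 w hw) hwσ
          (fun e => hvα (e ▸ hw)) u hu).2 (h4 w hw hwσ u hu)⟩
    · rintro (h | ⟨rfl, h⟩)
      · exact ⟨h.1, h.2.1, h.2.2.1, fun w hw hwσ u hu => (hLU w (hmem h.1 w hw) hwσ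
          (fun e => hLv α h (e ▸ hw)) u hu).1 (h.2.2.2 w hw hwσ u hu)⟩
      · refine ⟨h, Finset.card_insert_of_notMem hvσ, Finset.subset_insert _ _,
          fun w hw hwσ u hu => ?_⟩
        obtain rfl := (Finset.mem_insert.1 hw).resolve_right hwσ
        exact hU u hu
  have hTL : T ∉ L := fun h => hLv T h (Finset.mem_insert_self _ _)
  unfold trueIndegree
  rw [hset]
  split_ifs with h
  · rw [← Set.ncard_insert_of_notMem hTL (hK.subset fun α hα => hα.1)]
    congr 1
    ext α
    simp [h, or_comm]
  · simp only [h, and_false, or_false, add_zero]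
    rfl

end Wedge

/-! ### The wedge test and the pass through the dimensions -/

section Simplices

variable {d : ℕ} {pick : Set (Pt d) → Pt d} {V : List (Pt d)} {K : Cpx d}

/-- The directions below and above the wedge around `σ` that `isSimplex` uses. -/
theorem wedge_directions (hpick : IsDirectionRule pick) (hA : Admissible K V)
    {σ T : Finset (Pt d)} {v : Pt d} (hT : ∀ x, x ∈ T ↔ x = v ∨ x ∈ σ) (hσ : σ.Nonempty)
    (hσV : ∀ u ∈ σ, u ∈ V) (hv : v ∈ V) (hvσ : v ∉ σ) (hc : σ.card + 1 ≤ d) {s₁ s₂ s₃ : Pt d}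
    (h₁ : s₁ = pick {s | ∀ u ∈ T, ∀ w ∈ T, ⟪s, u⟫_ℝ = ⟪s, w⟫_ℝ})
    (h₂ : s₂ = pick {s | (∀ u ∈ T, ∀ w ∈ T, ⟪s, u⟫_ℝ = ⟪s, w⟫_ℝ) ∧
      ∀ q ∈ V, q ∉ T → ∀ u ∈ T, ⟪s, q⟫_ℝ ≠ ⟪s, u⟫_ℝ})
    (h₃ : s₃ = pick {s | (∀ u ∈ σ, ∀ w ∈ σ, ⟪s, u⟫_ℝ = ⟪s, w⟫_ℝ) ∧
      ∀ w ∈ σ, ⟪s, w⟫_ℝ < ⟪s, v⟫_ℝ}) :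
    let sL := tilt V (tilt V s₁ s₂) s₃
    let sU := -tilt V (-tilt V s₁ s₂) s₃
    Isolates V σ sL ∧ Isolates V σ sU ∧ (∀ u ∈ σ, ⟪sL, u⟫_ℝ < ⟪sL, v⟫_ℝ) ∧
      (∀ u ∈ σ, ⟪sU, v⟫_ℝ < ⟪sU, u⟫_ℝ) ∧
      ∀ q ∈ V, q ∉ σ → q ≠ v → ∀ u ∈ σ,
        (⟪sL, q⟫_ℝ < ⟪sL, u⟫_ℝ ↔ ⟪sU, q⟫_ℝ < ⟪sU, u⟫_ℝ) := by
  classical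
  intro sL sU
  obtain rfl : T = insert v σ := by ext x; rw [hT, Finset.mem_insert]
  have hTV : ↑(insert v σ) ⊆ K.vertices := by
    intro x hx
    rcases (hT x).1 hx with rfl | hx
    · exact (hA.lists.2 x).1 hv
    · exact (hA.lists.2 x).1 (hσV x hx)
  have hTc : (insert v σ).card ≤ d := by rwa [Finset.card_insert_of_notMem hvσ]
  have hTi := hA.general.affine_independent _ hTV (by omega)
  have hσi : AffineIndependent ℝ ((↑) : σ → Pt d) :=
    hTi.mono (Finset.coe_subset.2 (Finset.subset_insert v σ))
  have hvT := Finset.mem_insert_self v σ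
  have hσT : ∀ u ∈ σ, u ∈ insert v σ := fun u hu => Finset.mem_insert_of_mem hu
  -- A single isolating direction shows that the requirements on `s₁` and on `s₂` can both be met.
  obtain ⟨s, ⟨hs1, hs2⟩, hs3⟩ := exists_level_isolating (finite_vertices hA.finite)
    hA.general.affine_independent hTV ⟨v, hvT⟩ hTc
  obtain ⟨a1, n1⟩ := hpick {s | ∀ u ∈ insert v σ, ∀ w ∈ insert v σ, ⟪s, u⟫_ℝ = ⟪s, w⟫_ℝ}
    ⟨s, hs1, hs3⟩
  obtain ⟨⟨a2, b2⟩, n2⟩ := hpick {s | (∀ u ∈ insert v σ, ∀ w ∈ insert v σ, ⟪s, u⟫_ℝ = ⟪s, w⟫_ℝ) ∧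
    ∀ q ∈ V, q ∉ insert v σ → ∀ u ∈ insert v σ, ⟪s, q⟫_ℝ ≠ ⟪s, u⟫_ℝ}
    ⟨s, ⟨hs1, fun q hq => hs2 q ((hA.lists.2 q).1 hq)⟩, hs3⟩
  obtain ⟨s', ⟨hs1', hs2'⟩, hs3'⟩ := exists_level_below hTi hσ (Finset.ssubset_insert hvσ)
  obtain ⟨⟨a3, b3⟩, n3⟩ := hpick {s | (∀ u ∈ σ, ∀ w ∈ σ, ⟪s, u⟫_ℝ = ⟪s, w⟫_ℝ) ∧
    ∀ w ∈ σ, ⟪s, w⟫_ℝ < ⟪s, v⟫_ℝ} ⟨s', ⟨hs1', fun w hw => hs2' w hw v hvT hvσ⟩, hs3'⟩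
  rw [← h₁] at a1 n1
  rw [← h₂] at a2 b2 n2
  rw [← h₃] at a3 b3 n3
  have hm := isTilt_tilt V n1 n2
  set sm := tilt V s₁ s₂
  have hlev : ∀ u ∈ insert v σ, ∀ w ∈ insert v σ, ⟪sm, u⟫_ℝ = ⟪sm, w⟫_ℝ := fun u hu w hw =>
    hm.eq_of_eq (a1 u hu w hw) (a2 u hu w hw)
  have hTV' : ∀ u ∈ insert v σ, u ∈ V := fun u hu => (hA.lists.2 u).2 (hTV hu)
  -- In direction `s₁` further vertices may lie at the level of `σ ∪ {v}`. The tilt towards `s₂`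
  -- moves exactly these off it without moving any other vertex onto it.
  have hne : ∀ q ∈ V, q ∉ σ → q ≠ v → ∀ u ∈ σ, ⟪sm, q⟫_ℝ ≠ ⟪sm, u⟫_ℝ := by
    intro q hq hqσ hqv u hu
    rcases lt_trichotomy ⟪s₁, q⟫_ℝ ⟪s₁, u⟫_ℝ with h | h | h
    · exact (hm.lt_of_lt q hq u (hσV u hu) h).ne
    · have hqT : q ∉ insert v σ := fun h => ((hT q).1 h).elim hqv hqσ
      rcases lt_or_gt_of_ne (b2 q hq hqT u (hσT u hu)) with h2 | h2
      · exact (hm.lt_of_eq h h2).ne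
      · exact (hm.lt_of_eq h.symm h2).ne'
    · exact (hm.lt_of_lt u (hσV u hu) q hq h).ne'
  obtain ⟨l1, l2, l3⟩ := isolates_of_isTilt hσi hσV
    (fun u hu w hw => hlev u (hσT u hu) w (hσT w hw)) (fun u hu => hlev u (hσT u hu) v hvT) hne
    a3 b3 (isTilt_tilt V hm.norm_eq n3)
  -- Tilting `-sm` towards `s₃` also puts `v` above `σ`. Negating the result puts `v` below `σ` and
  -- restores the sides that the other vertices have for `sm`.
  have hneg : ‖-sm‖ = 1 := by rw [norm_neg, hm.norm_eq]
  obtain ⟨u1, u2, u3⟩ := isolates_of_isTilt (sm := -sm) hσi hσV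
    (fun u hu w hw => by
      rw [inner_neg_left, inner_neg_left, hlev u (hσT u hu) w (hσT w hw)])
    (fun u hu => by rw [inner_neg_left, inner_neg_left, hlev u (hσT u hu) v hvT])
    (fun q hq hqσ hqv u hu => by
      rw [inner_neg_left, inner_neg_left]
      exact fun e => hne q hq hqσ hqv u hu (neg_injective e))
    a3 b3 (isTilt_tilt V hneg n3)
  refine ⟨l1, u1.neg, l2, fun u hu => ?_, fun q hq hqσ hqv u hu => ?_⟩
  · rw [inner_neg_left, inner_neg_left]
    exact neg_lt_neg (u2 u hu)
  · rw [l3 q hq hqσ hqv u hu, inner_neg_left, inner_neg_left, neg_lt_neg_iff]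
    have h5 := u3 q hq hqσ hqv u hu
    rw [inner_neg_left, inner_neg_left, neg_lt_neg_iff] at h5
    have h6 := u1.ne_height q hq hqσ u hu
    have h7 := hne q hq hqσ hqv u hu
    constructor
    · intro h
      exact (lt_or_gt_of_ne h6).resolve_left fun h8 => lt_asymm h (h5.1 h8)
    · intro h
      exact (lt_or_gt_of_ne h7).resolve_right fun h8 => lt_asymm h (h5.2 h8)

open scoped Classical in
theorem isSimplex_output (F : Type*) [Field F] (hpick : IsDirectionRule pick)
    (hA : Admissible K V) {σ : Finset (Pt d)} {v : Pt d} (hσ : σ.Nonempty)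
    (hσV : ∀ u ∈ σ, u ∈ V) (hv : v ∈ V) (hvσ : v ∉ σ) (hc : σ.card + 1 ≤ d) :
    (isSimplex pick V σ v).output (apd F K) = true ↔ insert v σ ∈ K.faces := by
  obtain ⟨h1, h2, h3, h4, h5⟩ := wedge_directions hpick hA (T := insert v σ)
    (fun x => Finset.mem_insert) hσ hσV hv hvσ hc rfl rfl rfl
  unfold isSimplex
  simp only [OracleAlg.output_bind, OracleAlg.output_pure]
  rw [indegree_output hpick h2 F hA.finite hA.lists hσ, indegree_output hpick h1 F hA.finite
    hA.lists hσ, trueIndegree_wedge hA.finite hA.lists hvσ hσ h3 h4 h5, decide_eq_true_eq]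
  split_ifs with h <;> simp [h]

theorem isSimplex_asked (O : Pt d → Diagram) (hpick : IsDirectionRule pick)
    (hA : Admissible K V) {σ : Finset (Pt d)} {v : Pt d} (hσ : σ.Nonempty)
    (hσV : ∀ u ∈ σ, u ∈ V) (hv : v ∈ V) (hvσ : v ∉ σ) (hc : σ.card + 1 ≤ d) :
    (∀ q ∈ (isSimplex pick V σ v).asked O, ‖q‖ = 1) ∧
      ((isSimplex pick V σ v).asked O).length ≤ 2 * 2 ^ σ.card := by
  classical
  obtain ⟨h1, h2, _⟩ := wedge_directions hpick hA (T := insert v σ)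
    (fun x => Finset.mem_insert) hσ hσV hv hvσ hc rfl rfl rfl
  unfold isSimplex
  simp only [OracleAlg.asked_bind, OracleAlg.asked_pure, List.append_nil, List.length_append]
  constructor
  · intro q hq
    rcases List.mem_append.1 hq with hq | hq
    · exact indegree_asked_norm hpick h2 O _ q hq
    · exact indegree_asked_norm hpick h1 O _ q hq
  · refine (add_le_add (length_indegree_asked_le _ _ _ _ _ _)
      (length_indegree_asked_le _ _ _ _ _ _)).trans ?_
    omega

theorem mem_foldl_iff {α β : Type*} {f : Finset β → α → Finset β} {Q : α → β → Prop} {l : List α}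
    (h : ∀ Y, ∀ a ∈ l, ∀ x, x ∈ f Y a ↔ x ∈ Y ∨ Q a x) (Y : Finset β) (x : β) :
    x ∈ l.foldl f Y ↔ x ∈ Y ∨ ∃ a ∈ l, Q a x := by
  induction l generalizing Y with
  | nil => simp
  | cons a l ih =>
    rw [List.foldl_cons, ih (fun Y b hb => h Y b (by simp [hb])), h Y a (by simp)]
    simp [or_assoc]

open scoped Classical in
-- Nothing is missed because a simplex with `i + 1` vertices is found from any of its facets and the
-- omitted vertex. The outcome of a test does not depend on the simplices accumulated so far.
theorem findSimplices_spec (F : Type*) [Field F] (hpick : IsDirectionRule pick)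
    (hA : Admissible K V) {X : Finset (Finset (Pt d))} {i : ℕ} (hi : 1 ≤ i) (hid : i + 1 ≤ d)
    (hX : ∀ α, α ∈ X ↔ α ∈ K.faces ∧ α.card ≤ i) :
    (∀ α, α ∈ (findSimplices pick V X i).output (apd F K) ↔ α ∈ K.faces ∧ α.card ≤ i + 1) ∧
    (∀ q ∈ (findSimplices pick V X i).asked (apd F K), ‖q‖ = 1) ∧
    ((findSimplices pick V X i).asked (apd F K)).length ≤
      (X.filter (fun σ => σ.card = i)).card * (V.length * (2 * 2 ^ i)) := by
  have hσ : ∀ σ ∈ (X.filter (fun σ => σ.card = i)).toList,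
      σ.card = i ∧ σ ∈ K.faces ∧ σ.Nonempty ∧ (∀ u ∈ σ, u ∈ V) ∧ σ.card + 1 ≤ d := by
    intro σ h
    rw [Finset.mem_toList, Finset.mem_filter, hX] at h
    exact ⟨h.2, h.1.1, K.nonempty_of_mem_faces h.1.1,
      fun u hu => (hA.lists.2 u).2 (mem_vertices_of_mem h.1.1 hu), by omega⟩
  have hv : ∀ σ : Finset (Pt d), ∀ v ∈ V.filter (fun v => v ∉ σ), v ∈ V ∧ v ∉ σ := by
    intro σ v h
    rwa [List.mem_filter, decide_eq_true_eq] at h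
  unfold findSimplices
  refine ⟨fun α => ?_, ?_, ?_⟩
  · simp only [OracleAlg.output_foldlM, OracleAlg.output_bind, OracleAlg.output_pure]
    rw [mem_foldl_iff (Q := fun σ α => ∃ v ∈ V.filter (fun v => v ∉ σ),
      insert v σ ∈ K.faces ∧ α = insert v σ), hX]
    · constructor
      · rintro (h | ⟨σ, h1, v, h2, h3, rfl⟩)
        · exact ⟨h.1, by omega⟩
        · refine ⟨h3, ?_⟩
          rw [Finset.card_insert_of_notMem (hv σ v h2).2, (hσ σ h1).1]
      · rintro ⟨h1, h2⟩
        by_cases h3 : α.card ≤ i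
        · exact Or.inl ⟨h1, h3⟩
        · obtain ⟨v, hvα⟩ := K.nonempty_of_mem_faces h1
          have hc : (α.erase v).card = i := by rw [Finset.card_erase_of_mem hvα]; omega
          have hm : α.erase v ∈ K.faces := K.down_closed h1 (Finset.erase_subset _ _)
            (Finset.card_pos.1 (by omega))
          refine Or.inr ⟨α.erase v, ?_, v, ?_, ?_, ?_⟩
          · rw [Finset.mem_toList, Finset.mem_filter, hX]
            exact ⟨⟨hm, hc.le⟩, hc⟩
          · rw [List.mem_filter, decide_eq_true_eq]
            exact ⟨(hA.lists.2 v).2 (mem_vertices_of_mem h1 hvα), Finset.notMem_erase _ _⟩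
          · rwa [Finset.insert_erase hvα]
          · rw [Finset.insert_erase hvα]
    · intro Y σ hmem α
      obtain ⟨_, _, h1, h2, h3⟩ := hσ σ hmem
      refine mem_foldl_iff (Q := fun v α => insert v σ ∈ K.faces ∧ α = insert v σ) ?_ Y α
      intro Y v hmv x
      obtain ⟨h4, h5⟩ := hv σ v hmv
      have h6 := isSimplex_output F hpick hA h1 h2 h4 h5 h3
      split_ifs with h7
      · rw [Finset.mem_insert, or_comm]
        simp [h6.1 h7]
      · simp [mt h6.2 h7]
  · refine OracleAlg.forall_asked_foldlM _ (fun Y σ hmem => ?_) _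
    obtain ⟨_, _, h1, h2, h3⟩ := hσ σ hmem
    refine OracleAlg.forall_asked_foldlM _ (fun Y v hmv => ?_) _
    obtain ⟨h4, h5⟩ := hv σ v hmv
    rw [OracleAlg.asked_bind, OracleAlg.asked_pure, List.append_nil]
    exact (isSimplex_asked _ hpick hA h1 h2 h4 h5 h3).1
  · rw [← Finset.length_toList]
    refine OracleAlg.length_asked_foldlM_le _ (fun Y σ hmem => ?_) _
    obtain ⟨h0, _, h1, h2, h3⟩ := hσ σ hmem
    refine (OracleAlg.length_asked_foldlM_le _ (n := 2 * 2 ^ i) (fun Y v hmv => ?_) _).trans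
      (Nat.mul_le_mul_right _ (List.length_filter_le _ _))
    obtain ⟨h4, h5⟩ := hv σ v hmv
    rw [OracleAlg.asked_bind, OracleAlg.asked_pure, List.append_nil, ← h0]
    exact (isSimplex_asked _ hpick hA h1 h2 h4 h5 h3).2

open scoped Classical in
-- Each level is charged to the simplices of that cardinality, so over all levels a simplex is
-- charged at most once. Counting the simplices with at least `i` vertices makes the induction
-- close, and `2 ^ κ` dominates because tested simplices have at most `κ` vertices.
theorem foldlM_findSimplices_spec (F : Type*) [Field F] (hpick : IsDirectionRule pick)
    (hA : Admissible K V) {κ : ℕ} (hκ : κ + 1 ≤ d) (m : ℕ) :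
    ∀ (i : ℕ) (X : Finset (Finset (Pt d))), 1 ≤ i → i + m ≤ κ + 1 →
    (∀ α, α ∈ X ↔ α ∈ K.faces ∧ α.card ≤ i) →
    (∀ α, α ∈ ((List.range' i m).foldlM (fun X i => findSimplices pick V X i) X).output (apd F K) ↔
      α ∈ K.faces ∧ α.card ≤ i + m) ∧
    (∀ q ∈ ((List.range' i m).foldlM (fun X i => findSimplices pick V X i) X).asked (apd F K),
      ‖q‖ = 1) ∧
    (((List.range' i m).foldlM (fun X i => findSimplices pick V X i) X).asked (apd F K)).length ≤
      (hA.finite.toFinset.filter (fun σ => i ≤ σ.card)).card * (V.length * (2 * 2 ^ κ)) := by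
  induction m with
  | zero =>
    intro i X _ _ hX
    refine ⟨hX, by simp, by simp⟩
  | succ m ih =>
    intro i X hi hm hX
    obtain ⟨h1, h2, h3⟩ := findSimplices_spec F hpick hA hi (by omega) hX
    obtain ⟨h4, h5, h6⟩ := ih (i + 1) _ (by omega) (by omega) h1
    rw [List.range'_succ, List.foldlM_cons]
    simp only [OracleAlg.output_bind, OracleAlg.asked_bind, List.mem_append, List.length_append]
    refine ⟨fun α => ?_, fun q hq => hq.elim (h2 q) (h5 q), ?_⟩
    · rw [h4, Nat.add_right_comm, Nat.add_assoc]
    · have hsplit : (hA.finite.toFinset.filter (fun σ => i ≤ σ.card)).card =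
          (X.filter (fun σ => σ.card = i)).card +
            (hA.finite.toFinset.filter (fun σ => i + 1 ≤ σ.card)).card := by
        rw [← Finset.card_union_of_disjoint]
        · congr 1
          ext σ
          simp only [Finset.mem_filter, Finset.mem_union, Set.Finite.mem_toFinset, hX]
          constructor
          · rintro ⟨h7, h8⟩
            rcases h8.eq_or_lt with h9 | h9
            · exact Or.inl ⟨⟨h7, h9.ge⟩, h9.symm⟩
            · exact Or.inr ⟨h7, h9⟩
          · rintro (⟨⟨h7, _⟩, h9⟩ | ⟨h7, h8⟩)
            · exact ⟨h7, h9.ge⟩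
            · exact ⟨h7, by omega⟩
        · refine Finset.disjoint_left.2 fun σ h7 h8 => ?_
          have := (Finset.mem_filter.1 h7).2
          have := (Finset.mem_filter.1 h8).2
          omega
      rw [hsplit, add_mul]
      refine add_le_add (h3.trans (Nat.mul_le_mul_left _ (Nat.mul_le_mul_left _
        (Nat.mul_le_mul_left _ (Nat.pow_le_pow_right (by norm_num) (by omega)))))) h6

end Simplices

/-! ### The reconstruction -/

section Main

variable (F : Type*) [Field F] {d : ℕ} {pick : Set (Pt d) → Pt d} {K : Cpx d}

theorem ncard_vertices_le (hK : K.faces.Finite) : K.vertices.ncard ≤ K.faces.ncard := by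
  rw [← Set.ncard_image_of_injective K.vertices
    (Finset.singleton_injective : Function.Injective (fun v : Pt d => ({v} : Finset (Pt d))))]
  refine Set.ncard_le_ncard ?_ hK
  rintro _ ⟨v, hv, rfl⟩
  exact hv

theorem reconstruct_spec (hpick : IsDirectionRule pick) (hK : K.faces.Finite) {κ : ℕ}
    (hκ : HasDim K κ) (hκd : κ < d) (hgp : GeneralPosition K.vertices) :
    (∀ α, α ∈ (reconstruct d pick).output (apd F K) ↔ α ∈ K.faces) ∧
    (∀ q ∈ (reconstruct d pick).asked (apd F K), ‖q‖ = 1) ∧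
    ((reconstruct d pick).asked (apd F K)).length ≤
      3 * (2 ^ κ * K.faces.ncard * K.vertices.ncard + d) := by
  classical
  obtain ⟨v1, v2, v3⟩ := findVertices_spec F (by omega) hK hgp.height_injective
  unfold reconstruct
  simp only [OracleAlg.output_bind, OracleAlg.asked_bind, OracleAlg.output_query,
    OracleAlg.asked_query, dimOfDiagram_apd F hK _ hκ]
  set V := (findVertices d (apd F K (basisVec d 0))).output (apd F K) with hVdef
  have hA : Admissible K V := ⟨hK, v1, hgp, fun σ hσ => (card_le_of_hasDim hκ hσ).trans hκd⟩
  have e1 := findEdges_output F hpick hA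
  obtain ⟨e2, e3⟩ := findEdges_asked F (by omega) hpick hA
  set X := (V.map (fun v => ({v} : Finset (Pt d)))).toFinset ∪
    (findEdges pick V).output (apd F K) with hXdef
  have hX : ∀ α, α ∈ X ↔ α ∈ K.faces ∧ α.card ≤ 2 := by
    intro α
    rw [hXdef, Finset.mem_union, e1, List.mem_toFinset, List.mem_map]
    constructor
    · rintro (⟨v, hv, rfl⟩ | h)
      · exact ⟨(v1.2 v).1 hv, by simp⟩
      · exact ⟨h.1, h.2.le⟩
    · rintro ⟨h1, h2⟩
      have h0 := Finset.card_pos.2 (K.nonempty_of_mem_faces h1)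
      by_cases h3 : α.card = 2
      · exact Or.inr ⟨h1, h3⟩
      · obtain ⟨v, rfl⟩ := Finset.card_eq_one.1 (by omega : α.card = 1)
        exact Or.inl ⟨v, (v1.2 v).2 h1, rfl⟩
  have hcard := fun α (hα : α ∈ K.faces) => card_le_of_hasDim hκ hα
  obtain ⟨s1, s2, s3⟩ : (∀ α, α ∈ ((List.range' 2 (κ - 1)).foldlM
      (fun X i => findSimplices pick V X i) X).output (apd F K) ↔ α ∈ K.faces) ∧
      (∀ q ∈ ((List.range' 2 (κ - 1)).foldlM (fun X i => findSimplices pick V X i) X).asked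
        (apd F K), ‖q‖ = 1) ∧
      (((List.range' 2 (κ - 1)).foldlM (fun X i => findSimplices pick V X i) X).asked
        (apd F K)).length ≤ K.faces.ncard * (V.length * (2 * 2 ^ κ)) := by
    -- For `κ = 0` the truncated `κ - 1` vanishes and no level is run. Otherwise `2 + (κ - 1) = κ +
    -- 1`, the largest number of vertices of a simplex.
    rcases Nat.eq_zero_or_pos κ with h0 | h0
    · subst h0
      refine ⟨fun α => ?_, by simp, by simp⟩
      refine (hX α).trans ⟨And.left, fun h => ⟨h, (hcard α h).trans (by omega)⟩⟩
    · obtain ⟨h1, h2, h3⟩ := foldlM_findSimplices_spec F hpick hA hκd (κ - 1) 2 X (by omega)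
        (by omega) hX
      refine ⟨fun α => (h1 α).trans ⟨And.left, fun h => ⟨h, (hcard α h).trans (by omega)⟩⟩, h2,
        h3.trans (Nat.mul_le_mul_right _ ?_)⟩
      rw [Set.ncard_eq_toFinset_card _ hK]
      exact Finset.card_filter_le _ _
  refine ⟨s1, fun q hq => ?_, ?_⟩
  · simp only [List.mem_append, List.mem_singleton] at hq
    rcases hq with rfl | hq | hq | hq
    · exact norm_basisVec (by omega)
    · exact v2 q hq
    · exact e2 q hq
    · exact s2 q hq
  · simp only [List.length_append, List.length_singleton]
    have hn := v1.length_eq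
    -- With `N = 2 ^ κ * n * n₀`, the edge search costs at most `n₀ ^ 2 ≤ N` beyond its first query,
    -- because `n₀ ≤ n`, and the wedge tests cost at most `2 * N`. The initial query, the
    -- coordinates and the query of `-e_1` take at most `1 + 2 * (d - 1) + 1 = 2 * d`. Altogether
    -- this is at most `3 * (N + d)`.
    have h1 : V.length * V.length ≤ 2 ^ κ * K.faces.ncard * K.vertices.ncard := by
      rw [hn]
      refine Nat.mul_le_mul_right _ ((ncard_vertices_le hK).trans ?_)
      exact Nat.le_mul_of_pos_left _ (by positivity)
    have h2 : K.faces.ncard * (V.length * (2 * 2 ^ κ)) =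
        2 * (2 ^ κ * K.faces.ncard * K.vertices.ncard) := by rw [hn]; ring
    omega

/-- Distinctness of the vertex heights means that the multiset of zero-dimensional births has no
repetition, a property of the diagram alone. -/
theorem injOn_height_of_apd_eq {K' : Cpx d} (hK : K.faces.Finite) (hK' : K'.faces.Finite) {s : Pt d}
    (h : apd F K' s = apd F K s) (hinj : Set.InjOn (fun v => ⟪s, v⟫_ℝ) K.vertices) :
    Set.InjOn (fun v => ⟪s, v⟫_ℝ) K'.vertices := by
  have h1 := map_fst_apd_zero F hK s
  rw [← h, map_fst_apd_zero F hK' s] at h1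
  have h2 : ((finite_vertices hK').toFinset.val.map (fun v => ⟪s, v⟫_ℝ)).Nodup := by
    rw [h1, Multiset.nodup_map_iff_inj_on (Finset.nodup _)]
    intro x hx y hy e
    exact hinj (by simpa using hx) (by simpa using hy) e
  rw [Multiset.nodup_map_iff_inj_on (Finset.nodup _)] at h2
  intro x hx y hy e
  exact h2 x (by simpa using hx) y (by simpa using hy) e

theorem isFaithfulDiscretization_queriedDirections (hpick : IsDirectionRule pick)
    (hK : K.faces.Finite) {κ : ℕ} (hκ : HasDim K κ) (hκd : κ < d)
    (hgp : GeneralPosition K.vertices) :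
    IsFaithfulDiscretization F K {s | s ∈ queriedDirections F pick K} := by
  obtain ⟨h1, h2, _⟩ := reconstruct_spec F hpick hK hκ hκd hgp
  refine ⟨List.finite_toSet _, fun s hs => mem_sphere_zero_iff_norm.2 (h2 s hs), ?_⟩
  intro K' hK' hagree
  have hO : ∀ q ∈ (reconstruct d pick).asked (apd F K), apd F K' q = apd F K q := fun q hq =>
    hagree ⟨q, mem_sphere_zero_iff_norm.2 (h2 q hq)⟩ hq
  have hasked : ∀ q, q = basisVec d 0 ∨
      q ∈ (findVertices d (apd F K (basisVec d 0))).asked (apd F K) →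
      q ∈ (reconstruct d pick).asked (apd F K) := by
    intro q hq
    unfold reconstruct
    simp only [OracleAlg.asked_bind, OracleAlg.asked_query, OracleAlg.output_query,
      List.mem_append, List.mem_singleton]
    tauto
  have h0 : apd F K' (basisVec d 0) = apd F K (basisVec d 0) := hO _ (hasked _ (Or.inl rfl))
  have hinj := injOn_height_of_apd_eq F hK hK' h0 hgp.height_injective
  have hv := (findVertices_spec F (by omega) hK hgp.height_injective).1
  have hv' := (findVertices_spec F (by omega) hK' hinj).1
  rw [h0, (OracleAlg.congr_oracle (x := findVertices d (apd F K (basisVec d 0)))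
    (O := apd F K) (O' := apd F K') fun q hq => hO q (hasked q (Or.inr hq))).1] at hv'
  -- Both runs of the vertex stage are correct and have the same output. General position concerns
  -- the vertex set only, so it passes from `K` to `K'`, and the full reconstruction becomes valid
  -- for `K'`.
  have hvert : K'.vertices = K.vertices := by
    ext v
    rw [← hv.2, ← hv'.2]
  have h1' := (reconstruct_spec F hpick hK' (hasDim_congr F hK hK' h0 hκ) hκd
    (hvert ▸ hgp)).1
  rw [(OracleAlg.congr_oracle hO).1] at h1'
  refine Geometry.SimplicialComplex.ext ?_
  ext α
  rw [← h1, ← h1']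

end Main

end

end PHTRecon

open PHTRecon
theorem mainTheorem2 :
    ∃ C : ℕ, ∀ (F : Type*) [Field F] (d : ℕ)
      (pick : Set (Pt d) → Pt d), IsDirectionRule pick →
      ∀ (K : Cpx d), K.faces.Finite →
      ∀ κ : ℕ, HasDim K κ → κ < d → GeneralPosition K.vertices →
        (((reconstruct d pick).output (apd F K) : Finset (Finset (Pt d))) :
            Set (Finset (Pt d))) = K.faces ∧
        (queriedDirections F pick K).length
            ≤ C * (2 ^ κ * K.faces.ncard * K.vertices.ncard + d) ∧
        IsFaithfulDiscretization F K {s | s ∈ queriedDirections F pick K} := by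
  refine ⟨3, fun F _ d pick hpick K hK κ hκ hκd hgp => ?_⟩
  obtain ⟨h1, _, h3⟩ := reconstruct_spec F hpick hK hκ hκd hgp
  exact ⟨Set.ext h1, h3, isFaithfulDiscretization_queriedDirections F hpick hK hκ hκd hgp⟩
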